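/- \textbf{Theorem (Hochster's formula for relative complexes).} Let $k$ be a field, $n\ge 0$, $R=k[x_1,\dots,x_n]$ and $\mathfrak m=\langle x_1,\dots,x_n\rangle$. A simplicial complex on $[n]=\{1,\dots,n\}$ is a family of subsets of $[n]$ closed under taking subsets; the void complex $\emptyset$ is allowed and differs from $\{\emptyset\}$. Put $\dim\sigma=|\sigma|-1$, and let $\mathrm{Lk}(\sigma,\Delta)=\{\tau\in\Delta:\sigma\cap\tau=\emptyset,\ \sigma\cup\tau\in\Delta\}$ (which is void if $\sigma\notin\Delta$). For simplicial complexes $\Gamma\subseteq\Delta$ let $\widetilde H_j(\Delta,\Gamma)$, $j\in\mathbb Z$, be the reduced relative simplicial homology with coefficients in $k$, i.e. the homology of the quotient $\widetilde C_\bullet(\Delta)/\widetilde C_\bullet(\Gamma)$ of augmented chain complexes, where the empty face (if present) spans degree $-1$. Let $\Psi=(\Delta,\Gamma)$ be a relative simplicial complex, i.e. $\Gamma\subsetneq\Delta$ are simplicial complexes on $[n]$, and write $\mathrm{Lk}(\sigma,\Psi)=(\mathrm{Lk}(\sigma,\Delta),\mathrm{Lk}(\sigma,\Gamma))$. Let $I_\Delta=\langle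 \prod_{i\in\tau}x_i:\tau\subseteq[n],\ \tau\notin\Delta\rangle$, and let $M=\ker(R/I_\Delta\twoheadrightarrow R/I_\Gamma)$ be the face module of $\Psi$, with the $\mathbb Z^n$-grading in which (the class of) $x^\alpha$ has degree $\alpha$. Fix $i\ge 0$ and let $H^i_{\mathfrak m}(M)$ be the $i$-th local cohomology module of $M$ with support in $\mathfrak m$. It is isomorphic, as an $R$-module, to the $i$-th cohomology of the $\mathbb Z^n$-graded \v{C}ech complex $0\to M\to\bigoplus_j M_{x_j}\to\cdots\to M_{x_1\cdots x_n}\to 0$, and through such an isomorphism it carries the fine grading $H^i_{\mathfrak m}(M)=\bigoplus_{\alpha\in\mathbb Z^n}H^i_{\mathfrak m}(M)_\alpha$ as an $R$-module, with $\dim_k H^i_{\mathfrak m}(M)_\alpha<\infty$ for every $\alpha$. For $\alpha\in\mathbb Z^n$ put $\sigma_\alpha=\{j\in[n]:\alpha_j\ne 0\}$. Then, as $k$-vector spaces, \[ H^i_{\mathfrak m}(M)_\alpha\;\cong\;\begin{cases}\widetilde H_{i-\dim\sigma_\alpha-2}(\mathrm{Lk}(\sigma_\alpha,\Psi)) & \text{if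 }\alpha\le 0\text{ (coordinatewise) and }\sigma_\alpha\in\Delta,\\ 0&\text{otherwise.}\end{cases} \] Equivalently, the fine Hilbert series of $H^i_{\mathfrak m}(M)$, as a formal series in $t_1^{-1},\dots,t_n^{-1}$, is \[ \sum_{\alpha\in\mathbb Z^n}\dim_k H^i_{\mathfrak m}(M)_\alpha\, t^\alpha\;=\;\sum_{\sigma\in\Delta}\dim_k\widetilde H_{i-\dim\sigma-2}(\mathrm{Lk}(\sigma,\Psi))\prod_{j\in\sigma}\frac{t_j^{-1}}{1-t_j^{-1}} . \] -/

import Mathlib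

open CategoryTheory MvPolynomial
open scoped ModuleCat

universe u

noncomputable section

/-! ### Simplicial complexes, links and relative homology -/

/-- A simplicial complex on the vertex set `[n]`: a family of subsets of `[n]` closed under taking
subsets. The void complex `⊥ = ∅` is allowed and is different from `{∅}`; a nonvoid complex
contains the empty face, and not every `i : Fin n` has to be a vertex. -/
abbrev SimplComplex (n : ℕ) : Type := LowerSet (Finset (Fin n))

/-- The dimension `|σ| - 1` of a face `σ`. -/
def faceDim {n : ℕ} (σ : Finset (Fin n)) : ℤ := (σ.card : ℤ) - 1

/-- The link of `σ ⊆ [n]` in `Δ`; it is the void complex if `σ ∉ Δ`. -/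
def SimplComplex.link {n : ℕ} (σ : Finset (Fin n)) (Δ : SimplComplex n) : SimplComplex n where
  carrier := {τ | τ ∈ Δ ∧ Disjoint σ τ ∧ σ ∪ τ ∈ Δ}
  lower' := by
    rintro τ ρ hρ ⟨h1, h2, h3⟩
    exact ⟨Δ.lower hρ h1, h2.mono_right hρ, Δ.lower (Finset.union_subset_union_right hρ) h3⟩

section Homology

variable (k : Type u) [Field k] {n : ℕ}

/-- The oriented simplicial boundary map
`∂ [v₀ < ⋯ < v_j] = ∑ₗ (-1)ˡ [v₀, …, v̂ₗ, …, v_j]`, extended to all subsets of `[n]`; a chain is given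
by its coefficient function. It is augmented: `∂ [v] = [∅]`. The coefficient of `∂ c` at `ρ` collects
the contributions of the sets `ρ ∪ {v}`, `v ∉ ρ`. -/
def boundary : (Finset (Fin n) → k) →ₗ[k] (Finset (Fin n) → k) :=
  LinearMap.pi fun ρ => ∑ v ∈ ρᶜ, (-1 : k) ^ (ρ.filter (· < v)).card • LinearMap.proj (insert v ρ)

/-- The reduced (augmented) simplicial `j`-chains of `Δ`, `j : ℤ`, with basis the faces of `Δ` of
dimension `j`, including the empty face for `j = -1`. -/
def simplicialChains (Δ : SimplComplex n) (j : ℤ) : Submodule k (Finset (Fin n) → k) where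
  carrier := {c | ∀ τ : Finset (Fin n), ¬ (τ ∈ Δ ∧ faceDim τ = j) → c τ = 0}
  add_mem' hb hc τ hτ := by simp [hb τ hτ, hc τ hτ]
  zero_mem' _ _ := rfl
  smul_mem' r c hc τ hτ := by simp [hc τ hτ]

/-- Relative cycles: `j`-chains of `Δ` whose boundary is a chain of `Γ`. -/
def relCycles (Δ Γ : SimplComplex n) (j : ℤ) : Submodule k (Finset (Fin n) → k) :=
  simplicialChains k Δ j ⊓ (simplicialChains k Γ (j - 1)).comap (boundary k)

/-- Relative boundaries: boundaries of `(j+1)`-chains of `Δ`, up to `j`-chains of `Γ`. -/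
def relBoundaries (Δ Γ : SimplComplex n) (j : ℤ) : Submodule k (Finset (Fin n) → k) :=
  (simplicialChains k Δ (j + 1)).map (boundary k) ⊔ simplicialChains k Γ j

/-- The reduced relative homology `H̃_j(Δ, Γ; k)` of a pair `Γ ⊆ Δ`. It is the
reduced homology of `Δ` if `Γ` is void, and the unreduced one if `Γ = {∅}`. -/
abbrev relHomology (Δ Γ : SimplComplex n) (j : ℤ) : Type u :=
  relCycles k Δ Γ j ⧸ (relBoundaries k Δ Γ j).submoduleOf (relCycles k Δ Γ j)

end Homology

/-! ### Face modules -/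

section FaceModule

variable (k : Type u) [Field k] {n : ℕ}

/-- The squarefree monomial `x^τ`. -/
def sqfreeMonomial (τ : Finset (Fin n)) : MvPolynomial (Fin n) k := ∏ i ∈ τ, X i

/-- The face ideal (Stanley-Reisner ideal) of `Δ`. -/
def faceIdeal (Δ : SimplComplex n) : Ideal (MvPolynomial (Fin n) k) :=
  Ideal.span {f | ∃ τ : Finset (Fin n), τ ∉ Δ ∧ f = sqfreeMonomial k τ}

theorem faceIdeal_anti {Δ Γ : SimplComplex n} (h : Γ ≤ Δ) : faceIdeal k Δ ≤ faceIdeal k Γ := by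
  apply Ideal.span_mono
  rintro f ⟨τ, hτ, rfl⟩
  exact ⟨τ, fun hΓ => hτ (h hΓ), rfl⟩

/-- The face module `ker (k[Δ] → k[Γ])` of the pair `(Δ, Γ)`, as a module over `k[x₁, …, xₙ]`. -/
def faceModule {Δ Γ : SimplComplex n} (h : Γ ≤ Δ) :
    Submodule (MvPolynomial (Fin n) k) (MvPolynomial (Fin n) k ⧸ faceIdeal k Δ) :=
  LinearMap.ker (Submodule.mapQ (faceIdeal k Δ) (faceIdeal k Γ) LinearMap.id
    (faceIdeal_anti k h))

/-- The degree `α` part of `k[x₁, …, xₙ]`, `α ∈ ℤⁿ`: the line spanned by `x^α` if `α ≥ 0`, and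
`0` otherwise. -/
def polyDegree (α : Fin n → ℤ) : Submodule k (MvPolynomial (Fin n) k) :=
  Submodule.span k {f | ∃ a : Fin n →₀ ℕ, (∀ i, (a i : ℤ) = α i) ∧ f = monomial a 1}

/-- The fine grading of the face module: an element of the face module, seen in `k[Δ]`, has
degree `α` if it is the class of a polynomial of degree `α`. -/
def faceModuleDegree {Δ Γ : SimplComplex n} (h : Γ ≤ Δ) (α : Fin n → ℤ) :
    Submodule k (faceModule k h) :=
  ((polyDegree k α).map (Ideal.Quotient.mkₐ k (faceIdeal k Δ)).toLinearMap).comap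
    ((faceModule k h).subtype.restrictScalars k)

end FaceModule

/-- A family of `k`-subspaces `N_α`, `α ∈ ℤⁿ`, is a fine grading of the `k[x₁, …, xₙ]`-module `N`
if `N = ⨁ N_α` and `x_j N_α ⊆ N_{α + e_j}`. -/
def IsFineGrading {k : Type u} [Field k] {n : ℕ} {N : Type u} [AddCommGroup N] [Module k N]
    [Module (MvPolynomial (Fin n) k) N] (𝓝 : (Fin n → ℤ) → Submodule k N) : Prop :=
  DirectSum.IsInternal 𝓝 ∧
    ∀ (α : Fin n → ℤ) (j : Fin n), ∀ m ∈ 𝓝 α,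
      (X j : MvPolynomial (Fin n) k) • m ∈ 𝓝 (α + Pi.single j 1)

/-! ### The Čech complex with respect to `x₁, …, xₙ` and its fine grading -/

section Cech

variable (k : Type u) [Field k] {n : ℕ}
variable (M : Type u) [AddCommGroup M] [Module (MvPolynomial (Fin n) k) M]

/-- The localization `M_{x^S}`. -/
abbrev cechLoc (S : Finset (Fin n)) : Type u :=
  LocalizedModule (Submonoid.powers (sqfreeMonomial k S)) M

theorem isUnit_cechLoc {T S : Finset (Fin n)} (h : T ⊆ S)
    (x : Submonoid.powers (sqfreeMonomial k T)) :
    IsUnit (algebraMap (MvPolynomial (Fin n) k)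
      (Module.End (MvPolynomial (Fin n) k) (cechLoc k M S)) x) := by
  obtain ⟨_, a, rfl⟩ := x
  have hS : sqfreeMonomial k S ^ a = sqfreeMonomial k T ^ a * sqfreeMonomial k (S \ T) ^ a := by
    rw [← mul_pow, mul_comm (sqfreeMonomial k T)]
    exact congrArg (· ^ a) (Finset.prod_sdiff h).symm
  have hu := IsLocalizedModule.map_units
    (LocalizedModule.mkLinearMap (Submonoid.powers (sqfreeMonomial k S)) M)
    (⟨sqfreeMonomial k S ^ a, a, rfl⟩ : Submonoid.powers (sqfreeMonomial k S))
  change IsUnit (algebraMap (MvPolynomial (Fin n) k) _ (sqfreeMonomial k S ^ a)) at hu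
  rw [hS, map_mul] at hu
  change IsUnit (algebraMap (MvPolynomial (Fin n) k) _ (sqfreeMonomial k T ^ a))
  exact ((show Commute _ _ from Algebra.commutes _ _).isUnit_mul_iff.mp hu).1

/-- The localization map `M_{x^T} → M_{x^S}` for `T ⊆ S`. -/
def cechRes {T S : Finset (Fin n)} (h : T ⊆ S) :
    cechLoc k M T →ₗ[MvPolynomial (Fin n) k] cechLoc k M S :=
  LocalizedModule.lift _ (LocalizedModule.mkLinearMap _ M) (isUnit_cechLoc k M h)

variable (n)

/-- All Čech cochains `⨁_{S ⊆ [n]} M_{x^S}`. -/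
abbrev CechCochain : Type u := ∀ S : Finset (Fin n), cechLoc k M S

/-- The Čech differential,
`(d f)_S = ∑_{v ∈ S} (-1)^{#{w ∈ S | w < v}} f_{S \ {v}}` in `M_{x^S}`. -/
def cechD : CechCochain k n M →ₗ[MvPolynomial (Fin n) k] CechCochain k n M :=
  LinearMap.pi fun S => ∑ v ∈ S,
    (-1 : MvPolynomial (Fin n) k) ^ (S.filter (· < v)).card •
      (cechRes k M (S.erase_subset v)) ∘ₗ LinearMap.proj (S.erase v)

/-- The `p`-cochains `⨁_{|S| = p} M_{x^S}`, for `p : ℤ`. -/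
def cechCochains (p : ℤ) : Submodule (MvPolynomial (Fin n) k) (CechCochain k n M) where
  carrier := {f | ∀ S : Finset (Fin n), (S.card : ℤ) ≠ p → f S = 0}
  add_mem' hf hg S hS := by simp [hf S hS, hg S hS]
  zero_mem' _ _ := rfl
  smul_mem' r f hf S hS := by simp [hf S hS]

/-- The `p`-cocycles. -/
def cechCocycles (p : ℤ) : Submodule (MvPolynomial (Fin n) k) (CechCochain k n M) :=
  cechCochains k n M p ⊓ LinearMap.ker (cechD k n M)

/-- The `p`-coboundaries. -/
def cechCoboundaries (p : ℤ) : Submodule (MvPolynomial (Fin n) k) (CechCochain k n M) :=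
  (cechCochains k n M (p - 1)).map (cechD k n M)

/-- The `i`-th cohomology of the Čech complex
`0 → M → ⨁ⱼ M_{xⱼ} → ⋯ → M_{x₁⋯xₙ} → 0`, with `M` in cohomological degree `0`. -/
abbrev CechCohomology (i : ℕ) : Type u :=
  cechCocycles k n M i ⧸ (cechCoboundaries k n M i).submoduleOf (cechCocycles k n M i)

variable {k n M}
variable [Module k M]

/-- `y ∈ M_{x^S}` is homogeneous of degree `α` if `y = m / (x^S)^a` with `m ∈ M` homogeneous of
degree `α + a • 𝟏_S`. -/
def IsHomogeneousLoc (𝓜 : (Fin n → ℤ) → Submodule k M) (α : Fin n → ℤ) (S : Finset (Fin n))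
    (y : cechLoc k M S) : Prop :=
  ∃ (a : ℕ) (m : M), m ∈ 𝓜 (fun i => α i + if i ∈ S then (a : ℤ) else 0) ∧
    y = LocalizedModule.mk m
      (⟨sqfreeMonomial k S ^ a, a, rfl⟩ : Submonoid.powers (sqfreeMonomial k S))

/-- Homogeneous cohomology classes: those of cocycles with all components homogeneous of degree
`α`. -/
def IsHomogeneousClass (𝓜 : (Fin n → ℤ) → Submodule k M) (i : ℕ) (α : Fin n → ℤ)
    (c : CechCohomology k n M i) : Prop :=
  ∃ z : cechCocycles k n M i, (∀ S, IsHomogeneousLoc 𝓜 α S (z.1 S)) ∧ c = Submodule.Quotient.mk z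

end Cech

/-! ### Local cohomology -/

section LocalCohomology

variable (k : Type u) [Field k]

/-- The irrelevant ideal `⟨x₁, …, xₙ⟩`. -/
def irrelevantIdeal (n : ℕ) : Ideal (MvPolynomial (Fin n) k) :=
  Ideal.span (Set.range X)

/-- The `i`-th local cohomology of the `k[x₁, …, xₙ]`-module `M` with support in `⟨x₁, …, xₙ⟩`. -/
abbrev LocCoh (n : ℕ) (M : Type u) [AddCommGroup M] [Module (MvPolynomial (Fin n) k) M] (i : ℕ) :
    ModuleCat.{u} (MvPolynomial (Fin n) k) :=
  (localCohomology (irrelevantIdeal k n) i).obj (ModuleCat.of (MvPolynomial (Fin n) k) M)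

variable {k} {n : ℕ}

/-- The degree `α` part of local cohomology: the `k`-span of the classes which are homogeneous
of degree `α` under an identification `e` with the cohomology of the finely graded Čech complex
of the finely graded module `(M, 𝓜)`. -/
def locCohDegree {M : Type u} [AddCommGroup M] [Module (MvPolynomial (Fin n) k) M] [Module k M]
    (𝓜 : (Fin n → ℤ) → Submodule k M) {i : ℕ}
    (e : LocCoh k n M i ≃ₗ[MvPolynomial (Fin n) k] CechCohomology k n M i) (α : Fin n → ℤ) :
    Submodule k (LocCoh k n M i) :=
  Submodule.span k {c | IsHomogeneousClass 𝓜 i α (e c)}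

end LocalCohomology

/-! ### Hilbert series -/

/-- The support of `α ∈ ℤⁿ`. -/
def intSupport {n : ℕ} (α : Fin n → ℤ) : Finset (Fin n) := Finset.univ.filter (α · ≠ 0)

/-- The fine Hilbert series `∑_α dim_k N_α t^α`, as the function `α ↦ dim_k N_α`. -/
def hilbertSeries {k : Type u} [Field k] {n : ℕ} {N : Type u} [AddCommGroup N] [Module k N]
    (𝓝 : (Fin n → ℤ) → Submodule k N) : (Fin n → ℤ) → ℚ :=
  fun α => Module.finrank k (𝓝 α)

/-- The formal series `f(t₁⁻¹, …, tₙ⁻¹)` for a power series `f`, as the function sending `α` to the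
coefficient of `t^α`. -/
def substInv {n : ℕ} (f : MvPowerSeries (Fin n) ℚ) : (Fin n → ℤ) → ℚ :=
  open Classical in
  fun α => if α ≤ 0 then MvPowerSeries.coeff (Finsupp.equivFunOnFinite.symm fun i => (α i).natAbs) f
    else 0

end

/-! The proof has two independent halves.

Local cohomology is Čech cohomology. Local cohomology is `colim Ext^i(R/𝔪^t, M)`, with `Ext`
obtained by deriving `Hom(-, Y)` in its first variable. A short exact sequence in `Y` thus becomes a
sequence of functors that is exact on projectives. Its connecting morphisms are natural in the first
variable, so they survive the filtered colimit. Embed `M` in an injective `E` with cokernel `Q`. In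
degree zero both theories are naturally the `𝔪`-power torsion, and in positive degrees both vanish
on `E`. For `Ext` this is exactness of `Hom(-, E)`. For Čech cohomology
(`cechCocycles_le_cechCoboundaries`) variables are eliminated one at a time, since torsion elements
of `E` are divisible by the other variables. Hence `H¹(M)` is the cokernel of `H⁰(E) → H⁰(Q)` and
`H^{i+2}(M) ≅ H^{i+1}(Q)` in both theories, and `nonempty_locCoh_equiv_cech` follows by induction.

The Čech complex in one fine degree. The face module has as basis the monomials with support in `Δ`
and not in `Γ`. So in degree `α` the localization at `x^S` is a line or zero, and is nonzero exactly
when `S ∪ supp α` lies in `Δ` but not in `Γ` and `α ≥ 0` off `S` (`IsDegreeFace`). Restrictions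
preserve coefficients, so the strand of degree `α` is a simplicial cochain complex on this family of
sets. If `α_j > 0`, the family is stable under adding and removing `j`, and a cone argument gives
exactness (`exists_faceCoboundary_eq`). If `supp α ∉ Δ`, the family is empty. If `α ≤ 0`, it is the
family of faces `S ⊇ σ = supp α` of `Δ` outside `Γ`, and `S ↦ S \ σ`, with a shuffle sign,
identifies its chains with the relative chains of the links (`nonempty_relHomology_equiv`); `|S| =
i` means `dim (S \ σ) = i - dim σ - 2`. Cohomology and homology have equal dimension because
transposed matrices have equal rank (`finrank_relHomology_link`).

The Hilbert series follows because `∏ x_j / (1 - x_j)` over `σ` is the sum of the monomials with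
support exactly `σ`. -/

noncomputable section

/-! ### Connecting morphisms of left derived functors -/

namespace LeftDerivedConnecting

open Limits

universe v w v' w'

variable {C : Type w} [Category.{v} C] [Abelian C] [HasProjectiveResolutions C]
  {D : Type w'} [Category.{v'} D] [Abelian D]
  {F₁ F₂ F₃ : C ⥤ D} [F₁.Additive] [F₂.Additive] [F₃.Additive]
  (a : F₁ ⟶ F₂) (b : F₂ ⟶ F₃) (w : ∀ X, a.app X ≫ b.app X = 0)

/-- The short complex of chain complexes obtained by evaluating `F₁ ⟶ F₂ ⟶ F₃`. -/
abbrev complexes (K : ChainComplex C ℕ) : ShortComplex (ChainComplex D ℕ) :=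
  ShortComplex.mk ((NatTrans.mapHomologicalComplex a (ComplexShape.down ℕ)).app K)
    ((NatTrans.mapHomologicalComplex b (ComplexShape.down ℕ)).app K)
    (by ext i; exact w _)

variable (h : ∀ (P : C) [Projective P], (ShortComplex.mk (a.app P) (b.app P) (w P)).ShortExact)

-- The terms of a resolution are projective, so exactness on projectives is all that the long exact
-- homology sequence requires.
omit [HasProjectiveResolutions C] in
include h in
theorem shortExact_complexes {X : C} (P : ProjectiveResolution X) :
    (complexes a b w P.complex).ShortExact :=
  HomologicalComplex.shortExact_of_degreewise_shortExact _ fun i => h (P.complex.X i)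

/-- Functoriality of `complexes`. -/
def complexesMap {K L : ChainComplex C ℕ} (φ : K ⟶ L) :
    complexes a b w K ⟶ complexes a b w L where
  τ₁ := (F₁.mapHomologicalComplex _).map φ
  τ₂ := (F₂.mapHomologicalComplex _).map φ
  τ₃ := (F₃.mapHomologicalComplex _).map φ
  comm₁₂ := ((NatTrans.mapHomologicalComplex a (ComplexShape.down ℕ)).naturality φ)
  comm₂₃ := ((NatTrans.mapHomologicalComplex b (ComplexShape.down ℕ)).naturality φ)

theorem down_rel (n : ℕ) : (ComplexShape.down ℕ).Rel (n + 1) n := rfl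

/-- The left derived functors, computed by a projective resolution. -/
def isoHomology {X : C} (P : ProjectiveResolution X) (F : C ⥤ D) [F.Additive] (n : ℕ) :
    (F.leftDerived n).obj X ≅ ((F.mapHomologicalComplex (ComplexShape.down ℕ)).obj
      P.complex).homology n :=
  P.isoLeftDerivedObj F n

theorem isoHomology_inv_naturality {X Y : C} (f : X ⟶ Y) (P : ProjectiveResolution X)
    (Q : ProjectiveResolution Y) (φ : P.complex ⟶ Q.complex)
    (comm : φ.f 0 ≫ Q.π.f 0 = P.π.f 0 ≫ f) (F : C ⥤ D) [F.Additive] (n : ℕ) :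
    (isoHomology P F n).inv ≫ (F.leftDerived n).map f =
      HomologicalComplex.homologyMap ((F.mapHomologicalComplex _).map φ) n ≫
        (isoHomology Q F n).inv :=
  ProjectiveResolution.isoLeftDerivedObj_inv_naturality f P Q φ comm F n

theorem isoHomology_inv_leftDerived_app {F G : C ⥤ D} [F.Additive] [G.Additive] (α : F ⟶ G)
    {X : C} (P : ProjectiveResolution X) (n : ℕ) :
    (isoHomology P F n).inv ≫ (NatTrans.leftDerived α n).app X =
      HomologicalComplex.homologyMap ((NatTrans.mapHomologicalComplex α _).app P.complex) n ≫
        (isoHomology P G n).inv := by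
  rw [Iso.inv_comp_eq]
  exact ProjectiveResolution.leftDerived_app_eq α P n

/-- The connecting morphism on a projective resolution. -/
def connectingHom {X : C} (P : ProjectiveResolution X) (n : ℕ) :
    ((F₃.mapHomologicalComplex (ComplexShape.down ℕ)).obj P.complex).homology (n + 1) ⟶
    ((F₁.mapHomologicalComplex (ComplexShape.down ℕ)).obj P.complex).homology n :=
  (shortExact_complexes a b w h P).δ (n + 1) n (down_rel n)

omit [HasProjectiveResolutions C] in
theorem connectingHom_naturality {X Y : C} (P : ProjectiveResolution X)
    (Q : ProjectiveResolution Y) (φ : P.complex ⟶ Q.complex) (n : ℕ) :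
    HomologicalComplex.homologyMap ((F₃.mapHomologicalComplex _).map φ) (n + 1) ≫
      connectingHom a b w h Q n = connectingHom a b w h P n ≫
        HomologicalComplex.homologyMap ((F₁.mapHomologicalComplex _).map φ) n :=
  (HomologicalComplex.HomologySequence.δ_naturality (complexesMap a b w φ)
    (shortExact_complexes a b w h P) (shortExact_complexes a b w h Q) (n + 1) n (down_rel n)).symm

/-- The connecting morphism `L_{n+1} F₃ ⟶ L_n F₁`. -/
def connecting (n : ℕ) : F₃.leftDerived (n + 1) ⟶ F₁.leftDerived n where
  app X := (isoHomology (projectiveResolution X) F₃ (n + 1)).hom ≫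
    connectingHom a b w h (projectiveResolution X) n ≫
      (isoHomology (projectiveResolution X) F₁ n).inv
  naturality X Y f := by
    -- A lift of `f` to the chosen resolutions reduces the claim to naturality of the snake map for
    -- this chain map.
    have comm := ProjectiveResolution.lift_commutes_zero f
      (projectiveResolution X) (projectiveResolution Y)
    rw [← cancel_epi (isoHomology (projectiveResolution X) F₃ (n + 1)).inv,
      reassoc_of% (isoHomology_inv_naturality f _ _ _ comm F₃ (n + 1)), Category.assoc,
      Category.assoc, isoHomology_inv_naturality f _ _ _ comm F₁ n, Iso.inv_hom_id_assoc,
      Iso.inv_hom_id_assoc, reassoc_of% (connectingHom_naturality a b w h)]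

variable {a b w}

theorem isZero_homology {X : C} (P : ProjectiveResolution X) (F : C ⥤ D) [F.Additive] {n : ℕ}
    (hz : IsZero ((F.leftDerived n).obj X)) :
    IsZero (((F.mapHomologicalComplex _).obj P.complex).homology n) :=
  hz.of_iso (P.isoLeftDerivedObj F n).symm

/-- The connecting morphism sits between `L_{n+1} F₂` and `L_n F₂`, which both vanish at `X`. -/
theorem isIso_connecting_app (n : ℕ) (X : C) (h₁ : IsZero ((F₂.leftDerived (n + 1)).obj X))
    (h₀ : IsZero ((F₂.leftDerived n).obj X)) : IsIso ((connecting a b w h n).app X) := by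
  have : IsIso (connectingHom a b w h (projectiveResolution X) n) :=
    (shortExact_complexes a b w h (projectiveResolution X)).isIso_δ (n + 1) n (down_rel n)
      (isZero_homology _ _ h₁) (isZero_homology _ _ h₀)
  dsimp only [connecting]
  infer_instance

theorem mono_connecting_app (n : ℕ) (X : C) (h₁ : IsZero ((F₂.leftDerived (n + 1)).obj X)) :
    Mono ((connecting a b w h n).app X) := by
  have : Mono (connectingHom a b w h (projectiveResolution X) n) :=
    (shortExact_complexes a b w h (projectiveResolution X)).mono_δ (n + 1) n (down_rel n)
      (isZero_homology _ _ h₁)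
  dsimp only [connecting]
  infer_instance

theorem connecting_comp (n : ℕ) (X : C) :
    (connecting a b w h n).app X ≫ (NatTrans.leftDerived a n).app X = 0 := by
  have : connectingHom a b w h (projectiveResolution X) n ≫ HomologicalComplex.homologyMap
      ((NatTrans.mapHomologicalComplex a _).app (projectiveResolution X).complex) n = 0 :=
    (shortExact_complexes a b w h (projectiveResolution X)).δ_comp (n + 1) n (down_rel n)
  dsimp only [connecting]
  rw [Category.assoc, Category.assoc, isoHomology_inv_leftDerived_app, reassoc_of% this,
    Limits.zero_comp, Limits.comp_zero]

/-- Exactness at `L_n F₁`. After passing to opposites this identifies the kernel of `Ext^n(N, X₃) →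
Ext^{n+1}(N, X₁)`. -/
theorem exact_connecting (n : ℕ) (X : C) :
    (ShortComplex.mk ((connecting a b w h n).app X) ((NatTrans.leftDerived a n).app X)
      (connecting_comp h n X)).Exact := by
  refine (ShortComplex.exact_iff_of_iso ?_).1
    ((shortExact_complexes a b w h (projectiveResolution X)).homology_exact₁ (n + 1) n (down_rel n))
  refine ShortComplex.isoMk (isoHomology (projectiveResolution X) F₃ (n + 1)).symm
    (isoHomology (projectiveResolution X) F₁ n).symm
    (isoHomology (projectiveResolution X) F₂ n).symm ?_ ?_
  · change (isoHomology (projectiveResolution X) F₃ (n + 1)).inv ≫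
      (isoHomology (projectiveResolution X) F₃ (n + 1)).hom ≫ _ = _
    rw [Iso.inv_hom_id_assoc]
    rfl
  · exact isoHomology_inv_leftDerived_app a _ n

end LeftDerivedConnecting
end

noncomputable section

/-! ### Local cohomology and short exact sequences -/

namespace LocalCohomologySequence

open Limits Opposite LeftDerivedConnecting

variable {R : Type u} [CommRing R]

/-- `Hom(-, Y)` as a functor to the opposite category of modules. -/
abbrev homOp (Y : ModuleCat.{u} R) : ModuleCat.{u} R ⥤ (ModuleCat.{u} R)ᵒᵖ :=
  ((linearYoneda R (ModuleCat.{u} R)).obj Y).rightOp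

/-- `Hom(-, Y)` is contravariantly functorial in `Y`, with values in the opposite category. -/
abbrev homOpMap {Y Z : ModuleCat.{u} R} (f : Y ⟶ Z) : homOp Z ⟶ homOp Y :=
  NatTrans.rightOp ((linearYoneda R (ModuleCat.{u} R)).map f)

theorem homOpMap_comp_app (S : ShortComplex (ModuleCat.{u} R)) (N : ModuleCat.{u} R) :
    (homOpMap S.g).app N ≫ (homOpMap S.f).app N = 0 := by
  apply Quiver.Hom.unop_inj
  ext f
  exact (Category.assoc _ _ _).trans ((congrArg (f ≫ ·) S.zero).trans comp_zero)

/-- `Hom(P, -)` is left exact, and the lifting property of `P` gives surjectivity. The passage to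
opposites reverses the arrows, so `S.X₃` comes first. -/
theorem shortExact_homOp {S : ShortComplex (ModuleCat.{u} R)} (hS : S.ShortExact)
    (P : ModuleCat.{u} R) [Projective P] :
    (ShortComplex.mk ((homOpMap S.g).app P) ((homOpMap S.f).app P)
      (homOpMap_comp_app S P)).ShortExact := by
  let T : ShortComplex (ModuleCat.{u} R) := ShortComplex.mk
    (((linearYoneda R (ModuleCat.{u} R)).map S.f).app (op P))
    (((linearYoneda R (ModuleCat.{u} R)).map S.g).app (op P))
    (by ext f; exact (Category.assoc _ _ _).trans ((congrArg (f ≫ ·) S.zero).trans comp_zero))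
  have hT : T.ShortExact := by
    have := hS.mono_f
    have := hS.epi_g
    refine ShortComplex.ShortExact.mk' ?_ ?_ ?_
    · rw [ShortComplex.moduleCat_exact_iff]
      intro (f : P ⟶ S.X₂) (hf : f ≫ S.g = 0)
      exact ⟨hS.exact.lift f hf, hS.exact.lift_f f hf⟩
    · rw [ModuleCat.mono_iff_injective]
      intro (f : P ⟶ S.X₁) (g : P ⟶ S.X₁) (hfg : f ≫ S.f = g ≫ S.f)
      exact (cancel_mono S.f).1 hfg
    · rw [ModuleCat.epi_iff_surjective]
      intro (f : P ⟶ S.X₃)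
      exact ⟨Projective.factorThru f S.g, Projective.factorThru_comp f S.g⟩
  exact hT.op

/-- `Hom(-, E)` is exact, so applying it to a projective resolution creates no homology in positive
degrees: `Ext^{n+1}(N, E) = 0`. -/
theorem isZero_leftDerived_homOp (E : ModuleCat.{u} R) [Injective E] (N : ModuleCat.{u} R)
    (n : ℕ) : IsZero (((homOp E).leftDerived (n + 1)).obj N) := by
  let P := projectiveResolution N
  refine IsZero.of_iso ?_ (isoHomology P (homOp E) (n + 1))
  rw [← HomologicalComplex.exactAt_iff_isZero_homology,
    HomologicalComplex.exactAt_iff' _ (n + 2) (n + 1) n (by simp) (by simp)]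
  have hP : (P.complex.sc' (n + 2) (n + 1) n).Exact := by
    rw [← HomologicalComplex.exactAt_iff' _ (n + 2) (n + 1) n (by simp) (by simp)]
    exact P.complex_exactAt_succ n
  let T : ShortComplex (ModuleCat.{u} R) := ShortComplex.mk
    (((linearYoneda R (ModuleCat.{u} R)).obj E).map (P.complex.d (n + 1) n).op)
    (((linearYoneda R (ModuleCat.{u} R)).obj E).map (P.complex.d (n + 2) (n + 1)).op)
    (by rw [← Functor.map_comp, ← op_comp, HomologicalComplex.d_comp_d, op_zero,
          Functor.map_zero])
  have hT : T.Exact := by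
    rw [ShortComplex.moduleCat_exact_iff]
    intro (f : P.complex.X (n + 1) ⟶ E) (hf : P.complex.d (n + 2) (n + 1) ≫ f = 0)
    exact ⟨hP.descToInjective f hf, hP.comp_descToInjective f hf⟩
  exact hT.op

variable (J : Ideal R)

/-- The diagram computing `H^i_J(Y)`, natural in `Y`. -/
abbrev extDiagram (i : ℕ) : ModuleCat.{u} R ⥤ (ℕᵒᵖ)ᵒᵖ ⥤ ModuleCat.{u} R :=
  (localCohomology.diagram (localCohomology.idealPowersDiagram J) i).flip

/-- Local cohomology as a pointwise colimit. -/
def localCohomologyIso (i : ℕ) : localCohomology J i ≅ extDiagram J i ⋙ colim :=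
  colimitIsoFlipCompColim _

variable {J}
variable {S : ShortComplex (ModuleCat.{u} R)} (hS : S.ShortExact)

variable (J) in
/-- The connecting morphism on the diagrams of `Ext` modules. -/
def extConnecting (i : ℕ) : (extDiagram J i).obj S.X₃ ⟶ (extDiagram J (i + 1)).obj S.X₁ :=
  Functor.whiskerLeft (localCohomology.ringModIdeals (localCohomology.idealPowersDiagram J)).op
    (NatTrans.leftOp (connecting (homOpMap S.g) (homOpMap S.f) (homOpMap_comp_app S)
      (fun P _ => shortExact_homOp hS P) i))

/-- The index starts at `i + 1` because `Ext⁰` into an injective module need not vanish. -/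
theorem isIso_extConnecting [Injective S.X₂] (i : ℕ) :
    IsIso (extConnecting J hS (i + 1)) := by
  have (t : (ℕᵒᵖ)ᵒᵖ) : IsIso ((extConnecting J hS (i + 1)).app t) := by
    have := isIso_connecting_app (fun P _ => shortExact_homOp hS P) (i + 1)
      (((localCohomology.ringModIdeals (localCohomology.idealPowersDiagram J)).op.obj t).unop)
      (isZero_leftDerived_homOp S.X₂ _ _) (isZero_leftDerived_homOp S.X₂ _ _)
    exact inferInstanceAs (IsIso ((connecting (homOpMap S.g) (homOpMap S.f) (homOpMap_comp_app S)
      (fun P _ => shortExact_homOp hS P) (i + 1)).app _).unop)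
  exact NatIso.isIso_of_isIso_app _

/-- Dimension shifting for local cohomology. -/
theorem nonempty_iso_succ [Injective S.X₂] (i : ℕ) (hS : S.ShortExact) :
    Nonempty ((localCohomology J (i + 1)).obj S.X₃ ≅ (localCohomology J (i + 2)).obj S.X₁) := by
  have := isIso_extConnecting (J := J) hS i
  exact ⟨(localCohomologyIso J (i + 1)).app S.X₃ ≪≫
    colim.mapIso (asIso (extConnecting J hS (i + 1))) ≪≫
    ((localCohomologyIso J (i + 2)).app S.X₁).symm⟩

theorem exact_ext (S : ShortComplex (ModuleCat.{u} R)) (hS : S.ShortExact) (N : ModuleCat.{u} R)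
    (x : ((Ext R (ModuleCat.{u} R) 0).obj (op N)).obj S.X₃) :
    ((connecting (homOpMap S.g) (homOpMap S.f) (homOpMap_comp_app S)
      (fun P _ => shortExact_homOp hS P) 0).app N).unop x = 0 ↔
    ∃ y, ((Ext R (ModuleCat.{u} R) 0).obj (op N)).map S.g y = x := by
  have h := (exact_connecting (fun P _ => shortExact_homOp hS P) 0 N).unop
  rw [ShortComplex.moduleCat_exact_iff] at h
  refine ⟨h x, ?_⟩
  rintro ⟨y, rfl⟩
  exact congr($((ShortComplex.mk _ _ (connecting_comp
    (fun P _ => shortExact_homOp hS P) 0 N)).unop.zero) y)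

theorem surjective_ext (S : ShortComplex (ModuleCat.{u} R)) (hS : S.ShortExact)
    [Injective S.X₂] (N : ModuleCat.{u} R) :
    Function.Surjective ((connecting (homOpMap S.g) (homOpMap S.f) (homOpMap_comp_app S)
      (fun P _ => shortExact_homOp hS P) 0).app N).unop := by
  have := mono_connecting_app (fun P _ => shortExact_homOp hS P) 0 N
    (isZero_leftDerived_homOp S.X₂ _ _)
  exact (ModuleCat.epi_iff_surjective _).1 inferInstance

/-! ### Exactness of filtered colimits of modules -/

section Colimit

variable {K : Type} [SmallCategory K] {F G H : K ⥤ ModuleCat.{u} R}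

theorem colimMap_ι_apply (b : G ⟶ H) (t : K) (x : G.obj t) :
    colim.map b (colimit.ι G t x) = colimit.ι H t (b.app t x) :=
  congr($(ι_colimMap b t) x)

theorem colimit_w_apply {t t' : K} (φ : t ⟶ t') (x : G.obj t) :
    colimit.ι G t' (G.map φ x) = colimit.ι G t x :=
  congr($(colimit.w G φ) x)

instance [IsFiltered K] : PreservesColimitsOfShape K (forget (ModuleCat.{u} R)) :=
  have := preservesFilteredColimitsOfSize_of_univLE.{u, u, 0, 0} (forget (ModuleCat.{u} R))
  inferInstance

theorem colimMap_surjective [IsFiltered K] (b : G ⟶ H) (hb : ∀ t, Function.Surjective (b.app t)) :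
    Function.Surjective (colim.map b) := by
  intro x
  obtain ⟨t, y, rfl⟩ := Concrete.colimit_exists_rep H x
  obtain ⟨z, rfl⟩ := hb t y
  exact ⟨colimit.ι G t z, colimMap_ι_apply b t z⟩

/-- An element killed by `b` comes from some stage, and its image already dies at a later stage,
where exactness supplies a preimage. -/
theorem colimMap_exact [IsFiltered K] (a : F ⟶ G) (b : G ⟶ H)
    (hab : ∀ t x, b.app t x = 0 ↔ ∃ y, a.app t y = x) (x : (colim.obj G : ModuleCat.{u} R)) :
    colim.map b x = 0 ↔ ∃ y, colim.map a y = x := by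
  constructor
  · intro hx
    obtain ⟨t, y, rfl⟩ := Concrete.colimit_exists_rep G x
    have h0 : colimit.ι H t (b.app t y) = colimit.ι H t 0 := by
      rw [← colimMap_ι_apply, map_zero]; exact hx
    obtain ⟨t', φ, ψ, h⟩ := Concrete.colimit_exists_of_rep_eq H _ _ h0
    have h1 : b.app t' (G.map φ y) = 0 :=
      (congr($(b.naturality φ) y)).trans (h.trans (map_zero _))
    obtain ⟨z, hz⟩ := (hab t' _).1 h1
    exact ⟨colimit.ι F t' z, by rw [colimMap_ι_apply, hz]; exact colimit_w_apply φ y⟩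
  · rintro ⟨y, rfl⟩
    obtain ⟨t, z, rfl⟩ := Concrete.colimit_exists_rep F y
    have h1 := (hab t _).2 ⟨z, rfl⟩
    erw [colimMap_ι_apply, colimMap_ι_apply, h1, map_zero]

end Colimit

/-- Since `H⁰` of an injective module need not vanish, the first connecting map is only surjective.
It presents `H¹(X₁)` as the cokernel of `H⁰(X₂) → H⁰(X₃)`, a description shared with Čech
cohomology. -/
theorem exists_connecting_zero [Injective S.X₂] (hS : S.ShortExact) :
    ∃ d : (localCohomology J 0).obj S.X₃ ⟶ (localCohomology J 1).obj S.X₁,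
      Function.Surjective d ∧ ∀ x, d x = 0 ↔ ∃ y, (localCohomology J 0).map S.g y = x := by
  let e₀ := localCohomologyIso J 0
  let e₁ := localCohomologyIso J 1
  have hb : ∀ t, Function.Surjective ((extConnecting J hS 0).app t) := fun t =>
    surjective_ext S hS _
  have hab := colimMap_exact ((extDiagram J 0).map S.g) (extConnecting J hS 0)
    (fun t x => exact_ext S hS _ x)
  refine ⟨e₀.hom.app S.X₃ ≫ colim.map (extConnecting J hS 0) ≫ e₁.inv.app S.X₁, ?_, ?_⟩
  · have hsurj : Function.Surjective (e₀.hom.app S.X₃) :=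
      (e₀.app S.X₃).toLinearEquiv.surjective
    have hsurj' : Function.Surjective (e₁.inv.app S.X₁) :=
      (e₁.app S.X₁).toLinearEquiv.symm.surjective
    exact hsurj'.comp ((colimMap_surjective _ hb).comp hsurj)
  · intro x
    have hinj : Function.Injective (e₁.inv.app S.X₁) :=
      (e₁.app S.X₁).toLinearEquiv.symm.injective
    have hinj' : Function.Injective (e₀.hom.app S.X₃) :=
      (e₀.app S.X₃).toLinearEquiv.injective
    have hsurj : Function.Surjective (e₀.hom.app S.X₂) :=
      (e₀.app S.X₂).toLinearEquiv.surjective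
    change e₁.inv.app S.X₁ (colim.map (extConnecting J hS 0) (e₀.hom.app S.X₃ x)) = 0 ↔ _
    rw [map_eq_zero_iff _ hinj, hab]
    constructor
    · rintro ⟨y, hy⟩
      obtain ⟨z, rfl⟩ := hsurj y
      exact ⟨z, hinj' (congr($(e₀.hom.naturality S.g) z).trans hy)⟩
    · rintro ⟨z, rfl⟩
      exact ⟨e₀.hom.app S.X₂ z, congr($(e₀.hom.naturality S.g) z).symm⟩

/-! #### Degree zero -/

/-- Naturality of `L₀F → F` in the functor `F`. As `Ext` is derived in its first variable,
naturality of `Ext⁰ = Hom` in the second variable is an instance of this. -/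
theorem leftDerived_comp_fromLeftDerivedZero {C : Type*} [Category C] [Abelian C]
    [HasProjectiveResolutions C] {D : Type*} [Category D] [Abelian D] {F G : C ⥤ D}
    [F.Additive] [G.Additive] (α : F ⟶ G) (X : C) :
    (NatTrans.leftDerived α 0).app X ≫ G.fromLeftDerivedZero.app X =
      F.fromLeftDerivedZero.app X ≫ α.app X := by
  let P := projectiveResolution X
  have hF (F : C ⥤ D) [F.Additive] : (isoHomology P F 0).inv ≫ F.fromLeftDerivedZero.app X =
      HomologicalComplex.homologyι _ 0 ≫ P.fromLeftDerivedZero' F := by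
    rw [Iso.inv_comp_eq, P.fromLeftDerivedZero_eq F]
    rfl
  rw [← cancel_epi (isoHomology P F 0).inv, reassoc_of% (isoHomology_inv_leftDerived_app α P 0),
    reassoc_of% (hF F), hF G, HomologicalComplex.homologyι_naturality_assoc]
  congr 1
  rw [← cancel_epi (HomologicalComplex.pOpcycles _ _), HomologicalComplex.p_opcyclesMap_assoc,
    ProjectiveResolution.pOpcycles_comp_fromLeftDerivedZero',
    ProjectiveResolution.pOpcycles_comp_fromLeftDerivedZero'_assoc]
  exact (α.naturality (P.π.f 0)).symm

/-- `Hom(-, Y)` turns colimits into limits, as is seen on underlying sets, where it is a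
representable functor. Hence it is right exact into the opposite category and agrees with its `L₀`.
-/
theorem preservesFiniteColimits_homOp (Y : ModuleCat.{u} R) :
    PreservesFiniteColimits (homOp Y) := by
  have : PreservesLimits ((linearYoneda R (ModuleCat.{u} R)).obj Y ⋙ forget _) :=
    (inferInstance : PreservesLimits (yoneda.obj Y))
  have : PreservesLimits ((linearYoneda R (ModuleCat.{u} R)).obj Y) :=
    preservesLimits_of_reflects_of_preserves _ (forget _)
  exact preservesFiniteColimits_rightOp _

/-- `Ext⁰` is `Hom`. -/
def homIsoExt (N Y : ModuleCat.{u} R) :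
    ModuleCat.of R (N ⟶ Y) ≅ ((Ext R (ModuleCat.{u} R) 0).obj (op N)).obj Y :=
  have := preservesFiniteColimits_homOp Y
  (asIso ((homOp Y).fromLeftDerivedZero.app N)).unop

theorem homIsoExt_naturality_left {N N' : ModuleCat.{u} R} (f : N' ⟶ N) (Y : ModuleCat.{u} R)
    (g : N ⟶ Y) : ((Ext R (ModuleCat.{u} R) 0).map f.op).app Y ((homIsoExt N Y).hom g) =
      (homIsoExt N' Y).hom (f ≫ g) :=
  congr($(congrArg Quiver.Hom.unop ((homOp Y).fromLeftDerivedZero.naturality f)) g)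

theorem homIsoExt_naturality_right (N : ModuleCat.{u} R) {Y Z : ModuleCat.{u} R} (f : Y ⟶ Z)
    (g : N ⟶ Y) : ((Ext R (ModuleCat.{u} R) 0).obj (op N)).map f ((homIsoExt N Y).hom g) =
      (homIsoExt N Z).hom (g ≫ f) :=
  congr($(congrArg Quiver.Hom.unop (leftDerived_comp_fromLeftDerivedZero (homOpMap f) N)) g)

/-- Evaluation of homomorphisms `R/I → Y` at `1`. -/
def evalOne (I : Ideal R) (Y : ModuleCat.{u} R) :
    ModuleCat.of R (ModuleCat.of R (R ⧸ I) ⟶ Y) ⟶ Y :=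
  ModuleCat.ofHom
    { toFun := fun g : ModuleCat.of R (R ⧸ I) ⟶ Y => g.hom (Submodule.Quotient.mk 1)
      map_add' := fun _ _ => rfl
      map_smul' := fun _ _ => rfl }

theorem evalOne_injective (I : Ideal R) (Y : ModuleCat.{u} R) :
    Function.Injective (evalOne I Y) := by
  intro (f : ModuleCat.of R (R ⧸ I) ⟶ Y) (g : ModuleCat.of R (R ⧸ I) ⟶ Y)
    (h : f.hom (Submodule.Quotient.mk 1) = g.hom (Submodule.Quotient.mk 1))
  refine ModuleCat.hom_ext (LinearMap.ext fun x => ?_)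
  obtain ⟨x, rfl⟩ := Submodule.Quotient.mk_surjective _ x
  have hx : (Submodule.Quotient.mk x : R ⧸ I) = x • Submodule.Quotient.mk 1 := by
    rw [← Submodule.Quotient.mk_smul, smul_eq_mul, mul_one]
  rw [hx, map_smul, map_smul, h]

theorem exists_evalOne_iff (I : Ideal R) (Y : ModuleCat.{u} R) (y : Y) :
    (∃ f, evalOne I Y f = y) ↔ ∀ r ∈ I, r • y = 0 := by
  constructor
  · rintro ⟨(f : ModuleCat.of R (R ⧸ I) ⟶ Y), rfl⟩ r hr
    change r • f.hom (Submodule.Quotient.mk 1) = 0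
    rw [← map_smul, ← Submodule.Quotient.mk_smul, smul_eq_mul, mul_one,
      (Submodule.Quotient.mk_eq_zero I).2 hr, map_zero]
  · intro h
    refine ⟨ModuleCat.ofHom (Submodule.liftQ I (LinearMap.toSpanSingleton R Y y) h), ?_⟩
    exact one_smul R y

/-- Evaluation at `1` of a class in `Ext⁰(R/J^t, Y)`. -/
def extEval (J : Ideal R) (Y : ModuleCat.{u} R) : (extDiagram J 0).obj Y ⟶
    (Functor.const _).obj Y where
  app t := (homIsoExt (ModuleCat.of R (R ⧸ J ^ unop (unop t))) Y).inv ≫ evalOne _ Y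
  naturality t t' φ := by
    refine ModuleCat.hom_ext (LinearMap.ext fun x => ?_)
    obtain ⟨g, rfl⟩ := (homIsoExt (ModuleCat.of R (R ⧸ J ^ unop (unop t)))
      Y).toLinearEquiv.surjective x
    change evalOne _ Y ((homIsoExt _ Y).inv (((extDiagram J 0).obj Y).map φ
      ((homIsoExt _ Y).hom g))) = evalOne _ Y ((homIsoExt _ Y).inv ((homIsoExt _ Y).hom g))
    have h := homIsoExt_naturality_left ((localCohomology.ringModIdeals
      (localCohomology.idealPowersDiagram J)).map φ.unop) Y g
    erw [h, Iso.hom_inv_id_apply, Iso.hom_inv_id_apply]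
    rfl

theorem extEval_naturality (J : Ideal R) {Y Z : ModuleCat.{u} R} (f : Y ⟶ Z) (t) (x) :
    (extEval J Z).app t (((extDiagram J 0).map f).app t x) = f ((extEval J Y).app t x) := by
  obtain ⟨g, rfl⟩ := (homIsoExt (ModuleCat.of R (R ⧸ J ^ unop (unop t)))
    Y).toLinearEquiv.surjective x
  have h := homIsoExt_naturality_right (ModuleCat.of R (R ⧸ J ^ unop (unop t))) f g
  change evalOne _ Z ((homIsoExt _ Z).inv (((extDiagram J 0).map f).app t
      ((homIsoExt _ Y).hom g))) = f (evalOne _ Y ((homIsoExt _ Y).inv ((homIsoExt _ Y).hom g)))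
  erw [h, Iso.hom_inv_id_apply, Iso.hom_inv_id_apply]
  rfl

/-- The map `colim Ext⁰(R/J^t, Y) → Y`. -/
def colimEval (J : Ideal R) (Y : ModuleCat.{u} R) : colim.obj ((extDiagram J 0).obj Y) ⟶ Y :=
  colimit.desc _ (Cocone.mk Y (extEval J Y))

theorem colimEval_ι (J : Ideal R) (Y : ModuleCat.{u} R) (t) (x) :
    colimEval J Y (colimit.ι ((extDiagram J 0).obj Y) t x) = (extEval J Y).app t x :=
  congr($(colimit.ι_desc (Cocone.mk Y (extEval J Y)) t) x)

/-- Local cohomology in degree zero is the torsion submodule, naturally. -/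
theorem exists_torsion (J : Ideal R) : ∃ τ : localCohomology J 0 ⟶ 𝟭 (ModuleCat.{u} R),
    ∀ Y, Function.Injective (τ.app Y) ∧
      ∀ y, (∃ x, τ.app Y x = y) ↔ ∃ t : ℕ, ∀ r ∈ J ^ t, r • (y : Y) = 0 := by
  refine ⟨(localCohomologyIso J 0).hom ≫
    { app := fun Y => colimEval J Y, naturality := fun Y Z f => ?_ }, fun Y => ⟨?_, fun y => ?_⟩⟩
  · ext x
    obtain ⟨t, x, rfl⟩ := Concrete.colimit_exists_rep _ x
    change colimEval J Z (colim.map ((extDiagram J 0).map f)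
      (colimit.ι ((extDiagram J 0).obj Y) t x)) =
      f (colimEval J Y (colimit.ι ((extDiagram J 0).obj Y) t x))
    erw [colimMap_ι_apply, colimEval_ι, colimEval_ι]
    exact extEval_naturality J f t x
  · have h : Function.Injective (colimEval J Y) := by
      rw [injective_iff_map_eq_zero]
      intro x hx
      obtain ⟨t, x, rfl⟩ := Concrete.colimit_exists_rep _ x
      have h1 := (colimEval_ι J Y t x).symm.trans hx
      have h2 : (homIsoExt _ Y).toLinearEquiv.symm x = 0 :=
        evalOne_injective _ Y (h1.trans (map_zero (evalOne _ Y).hom).symm)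
      rw [(LinearEquiv.map_eq_zero_iff _).1 h2]
      exact map_zero (colimit.ι ((extDiagram J 0).obj Y) t).hom
    exact h.comp ((localCohomologyIso J 0).app Y).toLinearEquiv.injective
  · constructor
    · rintro ⟨x, rfl⟩
      obtain ⟨t, z, hz⟩ := Concrete.colimit_exists_rep _ ((localCohomologyIso J 0).hom.app Y x)
      refine ⟨unop (unop t), (exists_evalOne_iff _ Y _).1 ⟨(homIsoExt _ Y).inv z, ?_⟩⟩
      refine (colimEval_ι J Y t z).symm.trans ?_
      rw [hz]
      rfl
    · rintro ⟨t, ht⟩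
      obtain ⟨f, hf⟩ := (exists_evalOne_iff _ Y y).2 ht
      obtain ⟨x, hx⟩ := ((localCohomologyIso J 0).app Y).toLinearEquiv.surjective
        (colimit.ι ((extDiagram J 0).obj Y) (op (op t)) ((homIsoExt _ Y).hom f))
      refine ⟨x, (congrArg (colimEval J Y) hx).trans ((colimEval_ι J Y (op (op t)) _).trans ?_)⟩
      change evalOne _ Y ((homIsoExt _ Y).inv ((homIsoExt _ Y).hom f)) = y
      erw [Iso.hom_inv_id_apply, hf]

end LocalCohomologySequence
end

noncomputable section

/-! ### Localizations at squarefree monomials -/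

section CechBasic

variable {k : Type u} [Field k] {n : ℕ}
variable {M : Type u} [AddCommGroup M] [Module (MvPolynomial (Fin n) k) M]
variable {N : Type u} [AddCommGroup N] [Module (MvPolynomial (Fin n) k) N]
variable {P : Type u} [AddCommGroup P] [Module (MvPolynomial (Fin n) k) P]

/-- The fraction `m / (x^S)^a`. -/
def cechMk (S : Finset (Fin n)) (m : M) (a : ℕ) : cechLoc k M S :=
  LocalizedModule.mk m (⟨sqfreeMonomial k S ^ a, a, rfl⟩ : Submonoid.powers (sqfreeMonomial k S))

theorem exists_cechMk {S : Finset (Fin n)} (y : cechLoc k M S) :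
    ∃ (m : M) (a : ℕ), y = cechMk S m a := by
  refine LocalizedModule.induction_on (fun m s => ?_) y
  obtain ⟨_, a, rfl⟩ := s
  exact ⟨m, a, rfl⟩

theorem cechMk_eq_iff {S : Finset (Fin n)} {m m' : M} {a b : ℕ} :
    cechMk (k := k) S m a = cechMk S m' b ↔
      ∃ c : ℕ, sqfreeMonomial k S ^ (c + b) • m = sqfreeMonomial k S ^ (c + a) • m' := by
  simp only [pow_add, mul_smul]
  refine LocalizedModule.mk_eq.trans ⟨?_, ?_⟩
  · rintro ⟨⟨_, c, rfl⟩, h⟩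
    exact ⟨c, h⟩
  · rintro ⟨c, h⟩
    exact ⟨⟨_, c, rfl⟩, h⟩

theorem cechMk_eq_zero_iff {S : Finset (Fin n)} {m : M} {a : ℕ} :
    cechMk (k := k) S m a = 0 ↔ ∃ c : ℕ, sqfreeMonomial k S ^ c • m = 0 := by
  have h0 : (0 : cechLoc k M S) = cechMk S 0 0 := (LocalizedModule.zero_mk _).symm
  rw [h0, cechMk_eq_iff]
  simp

theorem smul_cechMk {S : Finset (Fin n)} (r : MvPolynomial (Fin n) k) (m : M) (a : ℕ) :
    r • cechMk (k := k) S m a = cechMk S (r • m) a :=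
  LocalizedModule.smul'_mk _ _ _

theorem cechMk_add {S : Finset (Fin n)} (m m' : M) (a : ℕ) :
    cechMk (k := k) S (m + m') a = cechMk S m a + cechMk S m' a := by
  simp only [cechMk, IsLocalizedModule.mk_eq_mk', IsLocalizedModule.mk'_add]

theorem cechMk_cancel {S : Finset (Fin n)} (m : M) (a b : ℕ) :
    cechMk (k := k) S (sqfreeMonomial k S ^ b • m) (b + a) = cechMk S m a := by
  rw [cechMk_eq_iff]
  exact ⟨0, by rw [smul_smul, ← pow_add]; ring_nf⟩

theorem pow_smul_cechMk {S : Finset (Fin n)} (m : M) (a : ℕ) :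
    sqfreeMonomial k S ^ a • cechMk (k := k) S m a = cechMk S m 0 := by
  rw [smul_cechMk]
  exact cechMk_cancel m 0 a

theorem sqfreeMonomial_union {S T : Finset (Fin n)} (h : Disjoint S T) :
    sqfreeMonomial k (S ∪ T) = sqfreeMonomial k S * sqfreeMonomial k T :=
  Finset.prod_union h

theorem sqfreeMonomial_sdiff {S T : Finset (Fin n)} (h : T ⊆ S) :
    sqfreeMonomial k S = sqfreeMonomial k T * sqfreeMonomial k (S \ T) := by
  rw [mul_comm]
  exact (Finset.prod_sdiff h).symm

theorem sqfreeMonomial_singleton (v : Fin n) : sqfreeMonomial k {v} = X v :=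
  Finset.prod_singleton _ _

theorem sqfreeMonomial_pow_smul_injective {T S : Finset (Fin n)} (h : T ⊆ S) (a : ℕ) :
    Function.Injective fun y : cechLoc k M S => sqfreeMonomial k T ^ a • y :=
  ((Module.End.isUnit_iff _).1 (isUnit_cechLoc k M h ⟨_, a, rfl⟩)).1

theorem eq_zero_of_X_pow_smul {S : Finset (Fin n)} {v : Fin n} (hv : v ∈ S) {a : ℕ}
    {y : cechLoc k M S} (h : (X v : MvPolynomial (Fin n) k) ^ a • y = 0) : y = 0 := by
  have := sqfreeMonomial_pow_smul_injective (k := k) (M := M) (Finset.singleton_subset_iff.2 hv) a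
  apply this
  simp only [sqfreeMonomial_singleton, h, smul_zero]

/-- Numerator and denominator both acquire the factor `(x^{S \ T})^a`. It suffices to compare after
multiplication by `(x^T)^a`, which is injective on the localization at `x^S`. -/
theorem cechRes_cechMk {T S : Finset (Fin n)} (h : T ⊆ S) (m : M) (a : ℕ) :
    cechRes k M h (cechMk T m a) = cechMk S (sqfreeMonomial k (S \ T) ^ a • m) a := by
  apply sqfreeMonomial_pow_smul_injective (k := k) (M := M) h a
  simp only
  rw [← map_smul, pow_smul_cechMk, smul_cechMk, smul_smul, ← mul_pow, ← sqfreeMonomial_sdiff h,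
    ← smul_cechMk, pow_smul_cechMk]
  exact LinearMap.congr_fun (LocalizedModule.lift_comp _ _ (isUnit_cechLoc k M h)) m

theorem cechRes_mk_zero {T S : Finset (Fin n)} (h : T ⊆ S) (m : M) :
    cechRes k M h (cechMk T m 0) = cechMk S m 0 := by
  rw [cechRes_cechMk, pow_zero, one_smul]

theorem cechRes_cechRes {U T S : Finset (Fin n)} (h : U ⊆ T) (h' : T ⊆ S) (y : cechLoc k M U) :
    cechRes k M h' (cechRes k M h y) = cechRes k M (h.trans h') y := by
  obtain ⟨m, a, rfl⟩ := exists_cechMk y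
  rw [cechRes_cechMk, cechRes_cechMk, cechRes_cechMk, smul_smul, ← mul_pow]
  congr 3
  rw [← sqfreeMonomial_union (Finset.disjoint_left.2 fun a ha hb =>
    (Finset.mem_sdiff.1 ha).2 (Finset.mem_sdiff.1 hb).1)]
  congr 1
  ext v
  have := @h v
  have := @h' v
  simp only [Finset.mem_union, Finset.mem_sdiff]
  tauto

/-- Localization of a linear map. -/
def cechLocMap (f : M →ₗ[MvPolynomial (Fin n) k] N) (S : Finset (Fin n)) :
    cechLoc k M S →ₗ[MvPolynomial (Fin n) k] cechLoc k N S :=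
  IsLocalizedModule.map (Submonoid.powers (sqfreeMonomial k S))
    (LocalizedModule.mkLinearMap _ M) (LocalizedModule.mkLinearMap _ N) f

theorem cechLocMap_cechMk (f : M →ₗ[MvPolynomial (Fin n) k] N) (S : Finset (Fin n)) (m : M)
    (a : ℕ) : cechLocMap f S (cechMk S m a) = cechMk S (f m) a := by
  simp only [cechMk, IsLocalizedModule.mk_eq_mk']
  exact IsLocalizedModule.map_mk' _ _ _ _ _ _

theorem cechRes_cechLocMap (f : M →ₗ[MvPolynomial (Fin n) k] N) {T S : Finset (Fin n)}
    (h : T ⊆ S) (y : cechLoc k M T) :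
    cechRes k N h (cechLocMap f T y) = cechLocMap f S (cechRes k M h y) := by
  obtain ⟨m, a, rfl⟩ := exists_cechMk y
  rw [cechLocMap_cechMk, cechRes_cechMk, cechRes_cechMk, cechLocMap_cechMk, map_smul]

/-! ### The Čech complex -/

theorem cechD_apply (f : CechCochain k n M) (S : Finset (Fin n)) :
    cechD k n M f S = ∑ v ∈ S, (-1 : MvPolynomial (Fin n) k) ^ (S.filter (· < v)).card •
      cechRes k M (S.erase_subset v) (f (S.erase v)) := by
  simp [cechD, LinearMap.pi_apply, LinearMap.sum_apply]

/-- The terms at `(v, w)` and `(w, v)` cancel; this is the combinatorial core of `d² = 0`. -/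
theorem sum_sum_erase_eq_zero {A : Type*} [AddCommGroup A] (S : Finset (Fin n))
    (F : Fin n → Fin n → A) (hF : ∀ v ∈ S, ∀ w ∈ S, v ≠ w → F v w + F w v = 0) :
    ∑ v ∈ S, ∑ w ∈ S.erase v, F v w = 0 := by
  rw [Finset.sum_sigma']
  refine Finset.sum_involution (fun p _ => ⟨p.2, p.1⟩) ?_ ?_ ?_ ?_
  · rintro ⟨v, w⟩ h
    simp only [Finset.mem_sigma, Finset.mem_erase] at h
    exact hF v h.1 w h.2.2 (Ne.symm h.2.1)
  · rintro ⟨v, w⟩ h _ h'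
    simp only [Finset.mem_sigma, Finset.mem_erase] at h
    exact h.2.1 (congrArg Sigma.fst h')
  · rintro ⟨v, w⟩ h
    simp only [Finset.mem_sigma, Finset.mem_erase] at h ⊢
    exact ⟨h.2.2, Ne.symm h.2.1, h.1⟩
  · rintro ⟨v, w⟩ _
    rfl

/-- The number of elements of `S` below `v` and of `S \ {v}` below `w` have the opposite parity
of the numbers obtained by exchanging `v` and `w`. -/
theorem sign_erase_comm {A : Type*} [CommRing A] {S : Finset (Fin n)} {v w : Fin n} (hv : v ∈ S)
    (hw : w ∈ S) (h : v ≠ w) :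
    (-1 : A) ^ (S.filter (· < v)).card * (-1) ^ ((S.erase v).filter (· < w)).card =
      - ((-1) ^ (S.filter (· < w)).card * (-1) ^ ((S.erase w).filter (· < v)).card) := by
  wlog hvw : v < w generalizing v w with H
  · rw [H hw hv h.symm (lt_of_le_of_ne (not_lt.1 hvw) h.symm), neg_neg]
  have h1 : (S.erase w).filter (· < v) = S.filter (· < v) := by
    ext a
    simp only [Finset.mem_filter, Finset.mem_erase]
    exact ⟨fun h => ⟨h.1.2, h.2⟩, fun h => ⟨⟨(h.2.trans hvw).ne, h.1⟩, h.2⟩⟩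
  have h2 : (S.filter (· < w)).card = ((S.erase v).filter (· < w)).card + 1 := by
    rw [Finset.filter_erase, Finset.card_erase_add_one (Finset.mem_filter.2 ⟨hv, hvw⟩)]
  rw [h1, h2, pow_succ]
  ring

theorem cechD_cechD (f : CechCochain k n M) : cechD k n M (cechD k n M f) = 0 := by
  funext S
  rw [cechD_apply]
  simp only [cechD_apply, map_sum, map_smul, Finset.smul_sum, cechRes_cechRes, smul_smul]
  let F : Fin n → Fin n → cechLoc k M S := fun v w =>
    ((-1 : MvPolynomial (Fin n) k) ^ (S.filter (· < v)).card *
      (-1) ^ ((S.erase v).filter (· < w)).card) •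
      cechRes k M (((S.erase v).erase_subset w).trans (S.erase_subset v)) (f ((S.erase v).erase w))
  refine sum_sum_erase_eq_zero S F fun v hv w hw hvw => ?_
  -- Removing `v` and `w` in either order gives equal sets, but the values of `f` there have
  -- different types, so the equality must be transported.
  have h : ∀ {T T' : Finset (Fin n)} (hT : T ⊆ S) (hT' : T' ⊆ S), T = T' →
      cechRes k M hT (f T) = cechRes k M hT' (f T') := by
    rintro T _ hT hT' rfl; rfl
  simp only [F]
  rw [sign_erase_comm hv hw hvw, h _ (((S.erase w).erase_subset v).trans (S.erase_subset w))
    (Finset.erase_right_comm (s := S) (a := v) (b := w)),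
    neg_smul, neg_add_cancel]

theorem cechD_mem {p : ℤ} {f : CechCochain k n M} (hf : f ∈ cechCochains k n M p) :
    cechD k n M f ∈ cechCochains k n M (p + 1) := by
  intro S hS
  rw [cechD_apply]
  refine Finset.sum_eq_zero fun v hv => ?_
  rw [hf, map_zero, smul_zero]
  have := Finset.card_erase_add_one hv
  omega

theorem cechCoboundaries_le (p : ℤ) : cechCoboundaries k n M p ≤ cechCocycles k n M p := by
  rintro _ ⟨g, hg, rfl⟩
  refine ⟨?_, cechD_cechD g⟩
  have := cechD_mem hg
  rwa [sub_add_cancel] at this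

/-- The map of Čech cochains induced by a linear map. -/
def cechMap (f : M →ₗ[MvPolynomial (Fin n) k] N) :
    CechCochain k n M →ₗ[MvPolynomial (Fin n) k] CechCochain k n N :=
  LinearMap.pi fun S => cechLocMap f S ∘ₗ LinearMap.proj S

theorem cechMap_apply (f : M →ₗ[MvPolynomial (Fin n) k] N) (z : CechCochain k n M)
    (S : Finset (Fin n)) : cechMap f z S = cechLocMap f S (z S) := rfl

theorem cechD_cechMap (f : M →ₗ[MvPolynomial (Fin n) k] N) (z : CechCochain k n M) :
    cechD k n N (cechMap f z) = cechMap f (cechD k n M z) := by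
  funext S
  simp only [cechD_apply, cechMap_apply, map_sum, map_smul, cechRes_cechLocMap]

theorem cechMap_mem (f : M →ₗ[MvPolynomial (Fin n) k] N) {p : ℤ} {z : CechCochain k n M}
    (hz : z ∈ cechCochains k n M p) : cechMap f z ∈ cechCochains k n N p := by
  intro S hS
  rw [cechMap_apply, hz S hS, map_zero]

theorem cechMap_mem_cocycles (f : M →ₗ[MvPolynomial (Fin n) k] N) {p : ℤ} {z : CechCochain k n M}
    (hz : z ∈ cechCocycles k n M p) : cechMap f z ∈ cechCocycles k n N p := by
  refine ⟨cechMap_mem f hz.1, ?_⟩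
  change cechD k n N (cechMap f z) = 0
  rw [cechD_cechMap, LinearMap.mem_ker.1 hz.2, map_zero]

theorem cechLocMap_injective {f : M →ₗ[MvPolynomial (Fin n) k] N} (hf : Function.Injective f)
    (S : Finset (Fin n)) : Function.Injective (cechLocMap f S) :=
  IsLocalizedModule.map_injective (Submonoid.powers (sqfreeMonomial k S))
    (LocalizedModule.mkLinearMap _ M) (LocalizedModule.mkLinearMap _ N) f hf

theorem cechLocMap_surjective {f : M →ₗ[MvPolynomial (Fin n) k] N} (hf : Function.Surjective f)
    (S : Finset (Fin n)) : Function.Surjective (cechLocMap f S) :=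
  IsLocalizedModule.map_surjective (Submonoid.powers (sqfreeMonomial k S))
    (LocalizedModule.mkLinearMap _ M) (LocalizedModule.mkLinearMap _ N) f hf

theorem cechLocMap_exact {f : M →ₗ[MvPolynomial (Fin n) k] N}
    {g : N →ₗ[MvPolynomial (Fin n) k] P} (hfg : Function.Exact f g) (S : Finset (Fin n)) :
    Function.Exact (cechLocMap f S) (cechLocMap g S) :=
  IsLocalizedModule.map_exact (Submonoid.powers (sqfreeMonomial k S))
    (LocalizedModule.mkLinearMap _ M) (LocalizedModule.mkLinearMap _ N)
    (LocalizedModule.mkLinearMap _ P) f g hfg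

theorem cechMap_injective {f : M →ₗ[MvPolynomial (Fin n) k] N} (hf : Function.Injective f) :
    Function.Injective (cechMap f) := by
  intro z z' h
  funext S
  have h1 : cechLocMap f S (z S) = cechLocMap f S (z' S) := congrFun h S
  exact cechLocMap_injective hf S h1

theorem exists_cechMap_eq {g : N →ₗ[MvPolynomial (Fin n) k] P} (hg : Function.Surjective g)
    {p : ℤ} {c : CechCochain k n P} (hc : c ∈ cechCochains k n P p) :
    ∃ b ∈ cechCochains k n N p, cechMap g b = c := by
  have h (S) : ∃ y, ((S.card : ℤ) ≠ p → y = 0) ∧ cechLocMap g S y = c S := by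
    by_cases hS : (S.card : ℤ) = p
    · obtain ⟨y, hy⟩ := cechLocMap_surjective hg S (c S)
      exact ⟨y, fun h => absurd hS h, hy⟩
    · exact ⟨0, fun _ => rfl, by rw [map_zero, hc S hS]⟩
  choose b hb hb' using h
  exact ⟨b, hb, funext hb'⟩

theorem exists_cechMap_eq_of_map_eq_zero {f : M →ₗ[MvPolynomial (Fin n) k] N}
    {g : N →ₗ[MvPolynomial (Fin n) k] P} (hfg : Function.Exact f g)
    (hf : Function.Injective f) {p : ℤ} {b : CechCochain k n N} (hb : b ∈ cechCochains k n N p)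
    (h : cechMap g b = 0) : ∃ a ∈ cechCochains k n M p, cechMap f a = b := by
  have h' (S) : ∃ y, cechLocMap f S y = b S :=
    (cechLocMap_exact hfg S (b S)).1 (congrFun h S)
  choose a ha using h'
  refine ⟨a, fun S hS => ?_, funext ha⟩
  refine cechLocMap_injective hf S ((ha S).trans ?_)
  rw [hb S hS, map_zero]

theorem cechMap_cechMap_eq_zero {f : M →ₗ[MvPolynomial (Fin n) k] N}
    {g : N →ₗ[MvPolynomial (Fin n) k] P} (hfg : Function.Exact f g) (a : CechCochain k n M) :
    cechMap g (cechMap f a) = 0 := by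
  funext S
  exact (cechLocMap_exact hfg S _).2 ⟨a S, rfl⟩

theorem exists_factor_of_surjective {R A B C : Type*} [Ring R] [AddCommGroup A] [Module R A]
    [AddCommGroup B] [Module R B] [AddCommGroup C] [Module R C] (f : A →ₗ[R] B) (g : A →ₗ[R] C)
    (hf : Function.Surjective f) (h : LinearMap.ker f ≤ LinearMap.ker g) :
    ∃ ψ : B →ₗ[R] C, ∀ a, ψ (f a) = g a := by
  refine ⟨(LinearMap.ker f).liftQ g h ∘ₗ (f.quotKerEquivOfSurjective hf).symm.toLinearMap,
    fun a => ?_⟩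
  have : (f.quotKerEquivOfSurjective hf).symm (f a) = Submodule.Quotient.mk a := by
    rw [LinearEquiv.symm_apply_eq]
    rfl
  simp only [LinearMap.comp_apply, LinearEquiv.coe_coe, this]
  exact Submodule.liftQ_apply _ _ _

/-- The connecting map of the Čech complexes of a short exact sequence. -/
theorem exists_cech_connecting {f : M →ₗ[MvPolynomial (Fin n) k] N}
    {g : N →ₗ[MvPolynomial (Fin n) k] P} (hf : Function.Injective f) (hfg : Function.Exact f g)
    (hg : Function.Surjective g) (p : ℕ)
    (hN : cechCocycles k n N (p + 1 : ℕ) ≤ cechCoboundaries k n N (p + 1 : ℕ)) :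
    ∃ ψ : cechCocycles k n P p →ₗ[MvPolynomial (Fin n) k] CechCohomology k n M (p + 1),
      Function.Surjective ψ ∧ ∀ z, ψ z = 0 ↔ ∃ e ∈ cechCocycles k n N p, cechMap g e = z.1 := by
  -- `W` consists of the cochains of `N` whose image in `P` is a cocycle. The connecting map is `ψ₂`
  -- composed with the inverse relation of `ψ₁`, where `ψ₁ b = g b` and `ψ₂ b` is the class of `f⁻¹
  -- (d b)`.
  let W := cechCochains k n N p ⊓ LinearMap.ker (cechD k n P ∘ₗ cechMap g)
  have hd (b : W) : ∃ a : cechCocycles k n M (p + 1 : ℕ), cechMap f a.1 = cechD k n N b.1 := by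
    obtain ⟨b, hb, hb'⟩ := b
    have h0 : cechMap g (cechD k n N b) = 0 := by rw [← cechD_cechMap]; exact hb'
    obtain ⟨a, ha, hab⟩ := exists_cechMap_eq_of_map_eq_zero hfg hf (cechD_mem hb) h0
    refine ⟨⟨a, by exact_mod_cast ha, ?_⟩, hab⟩
    apply cechMap_injective hf
    rw [← cechD_cechMap, hab, cechD_cechD, map_zero]
  choose α hα using hd
  have hinj : ∀ a a' : cechCocycles k n M (p + 1 : ℕ), cechMap f a.1 = cechMap f a'.1 → a = a' :=
    fun a a' h => Subtype.ext (cechMap_injective hf h)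
  let ψ₁ : W →ₗ[MvPolynomial (Fin n) k] cechCocycles k n P p :=
    LinearMap.codRestrict _ (cechMap g ∘ₗ W.subtype) fun b => ⟨cechMap_mem g b.2.1, b.2.2⟩
  let ψ₂ : W →ₗ[MvPolynomial (Fin n) k] CechCohomology k n M (p + 1) :=
    (Submodule.mkQ _) ∘ₗ
    { toFun := α
      map_add' := fun b b' => hinj _ _ (by
        rw [hα]; simp only [Submodule.coe_add, map_add, hα])
      map_smul' := fun r b => hinj _ _ (by
        rw [hα]; simp only [Submodule.coe_smul, map_smul, hα, RingHom.id_apply]) }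
  have hψ₂ (b : W) : ψ₂ b = 0 ↔ ∃ a ∈ cechCochains k n M p,
      b.1 - cechMap f a ∈ cechCocycles k n N p := by
    have : ψ₂ b = 0 ↔ (α b).1 ∈ cechCoboundaries k n M (p + 1 : ℕ) :=
      (Submodule.Quotient.mk_eq_zero _)
    rw [this]
    constructor
    · rintro ⟨a, ha, hab⟩
      have ha : a ∈ cechCochains k n M p := by
        have e : ((p + 1 : ℕ) : ℤ) - 1 = p := by push_cast; ring
        rwa [e] at ha
      refine ⟨a, ha, sub_mem b.2.1 (cechMap_mem f ha), ?_⟩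
      change cechD k n N (b.1 - cechMap f a) = 0
      rw [map_sub, ← hα, cechD_cechMap, hab, sub_self]
    · rintro ⟨a, ha, hab⟩
      refine ⟨a, ?_, ?_⟩
      · have e : ((p + 1 : ℕ) : ℤ) - 1 = p := by push_cast; ring
        rwa [e]
      · apply cechMap_injective hf
        rw [← cechD_cechMap, hα]
        have := LinearMap.mem_ker.1 hab.2
        rw [map_sub, sub_eq_zero] at this
        exact this.symm
  have hψ₁ : Function.Surjective ψ₁ := by
    rintro ⟨c, hc, hc'⟩
    obtain ⟨b, hb, rfl⟩ := exists_cechMap_eq hg hc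
    exact ⟨⟨b, hb, hc'⟩, rfl⟩
  -- The choice of a lift does not matter: a cochain killed by `g` comes from `M`, so its
  -- differential pulls back to a coboundary.
  obtain ⟨ψ, hψ⟩ := exists_factor_of_surjective ψ₁ ψ₂ hψ₁ (by
    intro b hb
    rw [LinearMap.mem_ker] at hb
    obtain ⟨a, ha, hab⟩ := exists_cechMap_eq_of_map_eq_zero hfg hf b.2.1 (congrArg Subtype.val hb)
    rw [LinearMap.mem_ker, hψ₂]
    exact ⟨a, ha, by rw [hab, sub_self]; exact zero_mem _⟩)
  refine ⟨ψ, ?_, ?_⟩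
  · intro c
    obtain ⟨⟨a, ha⟩, rfl⟩ := Submodule.Quotient.mk_surjective _ c
    -- Surjectivity uses that every `(p+1)`-cocycle of `N` is a coboundary.
    obtain ⟨b, hb, hab⟩ := hN (cechMap_mem_cocycles f ha)
    have e : ((p + 1 : ℕ) : ℤ) - 1 = p := by push_cast; ring
    rw [e] at hb
    have hbW : b ∈ W := by
      refine ⟨hb, ?_⟩
      change cechD k n P (cechMap g b) = 0
      rw [cechD_cechMap, hab,
        cechMap_cechMap_eq_zero hfg]
    refine ⟨ψ₁ ⟨b, hbW⟩, ?_⟩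
    rw [hψ]
    change Submodule.Quotient.mk (α ⟨b, hbW⟩) = _
    rw [hinj (α ⟨b, hbW⟩) ⟨a, ha⟩ ((hα _).trans hab)]
  · intro z
    obtain ⟨b, rfl⟩ := hψ₁ z
    rw [hψ, hψ₂]
    constructor
    · rintro ⟨a, ha, hab⟩
      refine ⟨_, hab, ?_⟩
      rw [map_sub, cechMap_cechMap_eq_zero hfg, sub_zero]
      rfl
    · rintro ⟨e, he, heb⟩
      obtain ⟨a, ha, hab⟩ := exists_cechMap_eq_of_map_eq_zero hfg hf (sub_mem b.2.1 he.1)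
        (by rw [map_sub, heb]; exact sub_self _)
      refine ⟨a, ha, ?_⟩
      rwa [hab, sub_sub_cancel]

/-- Dimension shifting for Čech cohomology. -/
theorem nonempty_cech_equiv_succ {f : M →ₗ[MvPolynomial (Fin n) k] N}
    {g : N →ₗ[MvPolynomial (Fin n) k] P} (hf : Function.Injective f) (hfg : Function.Exact f g)
    (hg : Function.Surjective g)
    (hN : ∀ p : ℕ, cechCocycles k n N (p + 1 : ℕ) ≤ cechCoboundaries k n N (p + 1 : ℕ)) (p : ℕ) :
    Nonempty (CechCohomology k n P (p + 1) ≃ₗ[MvPolynomial (Fin n) k]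
      CechCohomology k n M (p + 2)) := by
  obtain ⟨ψ, hψ, hψ'⟩ := exists_cech_connecting hf hfg hg (p + 1) (hN (p + 1))
  refine ⟨(Submodule.quotEquivOfEq _ (LinearMap.ker ψ) ?_).trans (ψ.quotKerEquivOfSurjective hψ)⟩
  -- Because `H^{p+1}(N) = 0`, a cocycle of `P` lifts to a cocycle of `N` exactly when it is a
  -- coboundary.
  ext z
  rw [LinearMap.mem_ker, hψ']
  change z.1 ∈ cechCoboundaries k n P (p + 1 : ℕ) ↔ _
  constructor
  · rintro ⟨c, hc, hcz⟩
    obtain ⟨b, hb, rfl⟩ := exists_cechMap_eq hg hc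
    exact ⟨cechD k n N b, cechCoboundaries_le _ ⟨b, hb, rfl⟩, by rw [← cechD_cechMap, hcz]⟩
  · rintro ⟨e, he, hez⟩
    obtain ⟨b, hb, rfl⟩ := hN p he
    exact ⟨cechMap g b, cechMap_mem g hb, by rw [cechD_cechMap, hez]⟩

end CechBasic
end

noncomputable section

/-! ### Acyclicity of injective modules for the Čech complex -/

section Acyclic

variable {k : Type u} [Field k] {n : ℕ}

/-- The elements killed by a power of each variable `x_v`, `v ∈ V`. -/
def varTorsion (k : Type u) [Field k] {n : ℕ} (V : Finset (Fin n)) (N : Type u) [AddCommGroup N]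
    [Module (MvPolynomial (Fin n) k) N] : Submodule (MvPolynomial (Fin n) k) N where
  carrier := {y | ∀ v ∈ V, ∃ b : ℕ, (X v : MvPolynomial (Fin n) k) ^ b • y = 0}
  add_mem' {y z} hy hz v hv := by
    obtain ⟨b, hb⟩ := hy v hv
    obtain ⟨c, hc⟩ := hz v hv
    refine ⟨b + c, ?_⟩
    rw [smul_add, pow_add, mul_smul _ _ z, hc, smul_zero, add_zero, mul_comm, mul_smul, hb,
      smul_zero]
  zero_mem' v _ := ⟨0, smul_zero _⟩
  smul_mem' r y hy v hv := by
    obtain ⟨b, hb⟩ := hy v hv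
    exact ⟨b, by rw [smul_comm, hb, smul_zero]⟩

theorem map_mem_varTorsion {N P : Type u} [AddCommGroup N] [Module (MvPolynomial (Fin n) k) N]
    [AddCommGroup P] [Module (MvPolynomial (Fin n) k) P] (f : N →ₗ[MvPolynomial (Fin n) k] P)
    {V : Finset (Fin n)} {y : N} (hy : y ∈ varTorsion k V N) : f y ∈ varTorsion k V P := by
  intro v hv
  obtain ⟨b, hb⟩ := hy v hv
  exact ⟨b, by rw [← map_smul, hb, map_zero]⟩

/-- `x_w` is a nonzerodivisor modulo the powers `x_v^{b_v}`, `v ∈ V`: membership in this monomial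
ideal depends only on the exponents at `V`, which multiplication by `x_w` does not change. -/
theorem mem_span_of_X_mul_mem (V : Finset (Fin n)) (b : Fin n → ℕ) {w : Fin n} (hw : w ∉ V)
    {p : MvPolynomial (Fin n) k}
    (hp : X w * p ∈ Ideal.span ((fun s => monomial s (1 : k)) ''
      {s | ∃ v ∈ V, s = Finsupp.single v (b v)})) :
    p ∈ Ideal.span ((fun s => monomial s (1 : k)) ''
      {s | ∃ v ∈ V, s = Finsupp.single v (b v)}) := by
  rw [mem_ideal_span_monomial_image] at hp ⊢
  intro s hs
  obtain ⟨_, ⟨v, hv, rfl⟩, h⟩ := hp (Finsupp.single w 1 + s) (by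
    rw [mem_support_iff, coeff_X_mul] at *
    exact hs)
  refine ⟨_, ⟨v, hv, rfl⟩, ?_⟩
  have hvw : v ≠ w := fun h => hw (h ▸ hv)
  rw [Finsupp.single_le_iff] at h ⊢
  simpa [Finsupp.single_apply, hvw.symm] using h

/-- Let `J` be generated by powers `x_v^{b_v}` that kill `e`. Multiplication by `x_w` is injective
on `R/J`, so the map `R/J → E`, `1 ↦ e`, extends along it. The image of `1` under the extension is
`e'`, again killed by `J`. -/
theorem exists_X_smul_eq_of_injective (E : Type u) [AddCommGroup E]
    [Module (MvPolynomial (Fin n) k) E] [Module.Injective (MvPolynomial (Fin n) k) E]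
    (V : Finset (Fin n)) {w : Fin n} (hw : w ∉ V) {e : E} (he : e ∈ varTorsion k V E) :
    ∃ e' ∈ varTorsion k V E, (X w : MvPolynomial (Fin n) k) • e' = e := by
  choose! b hb using he
  let J : Ideal (MvPolynomial (Fin n) k) := Ideal.span ((fun s => monomial s (1 : k)) ''
      {s | ∃ v ∈ V, s = Finsupp.single v (b v)})
  have hJ (v) (hv : v ∈ V) : (X v : MvPolynomial (Fin n) k) ^ b v ∈ J := by
    rw [X_pow_eq_monomial]
    exact Ideal.subset_span ⟨_, ⟨v, hv, rfl⟩, rfl⟩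
  let φ : (MvPolynomial (Fin n) k ⧸ J) →ₗ[MvPolynomial (Fin n) k] (MvPolynomial (Fin n) k ⧸ J) :=
    LinearMap.lsmul _ _ (X w)
  have hφ : Function.Injective φ := by
    rw [injective_iff_map_eq_zero]
    intro x hx
    obtain ⟨p, rfl⟩ := Submodule.Quotient.mk_surjective _ x
    have hx' : (Submodule.Quotient.mk (X w * p) : MvPolynomial (Fin n) k ⧸ J) = 0 := hx
    rw [Submodule.Quotient.mk_eq_zero] at hx' ⊢
    exact mem_span_of_X_mul_mem V b hw hx'
  let f : (MvPolynomial (Fin n) k ⧸ J) →ₗ[MvPolynomial (Fin n) k] E :=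
    Submodule.liftQ J (LinearMap.toSpanSingleton _ E e) (by
      refine Ideal.span_le.2 ?_
      rintro _ ⟨_, ⟨v, hv, rfl⟩, rfl⟩
      have := hb v hv
      rw [X_pow_eq_monomial] at this
      exact this)
  obtain ⟨h, hh⟩ := Module.Injective.out φ hφ f
  refine ⟨h (Submodule.Quotient.mk 1), fun v hv => ⟨b v, ?_⟩, ?_⟩
  · rw [← map_smul, ← Submodule.Quotient.mk_smul, smul_eq_mul, mul_one,
      (Submodule.Quotient.mk_eq_zero J).2 (hJ v hv), map_zero]
  · rw [← map_smul]
    exact (hh (Submodule.Quotient.mk 1)).trans (one_smul _ e)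

-- This divisibility of torsion elements is the only property of injective modules that acyclicity
-- uses.
variable {E : Type u} [AddCommGroup E] [Module (MvPolynomial (Fin n) k) E]
  (hE : ∀ (V : Finset (Fin n)) (w : Fin n), w ∉ V → ∀ e ∈ varTorsion k V E,
    ∃ e' ∈ varTorsion k V E, (X w : MvPolynomial (Fin n) k) • e' = e)

include hE in
theorem exists_X_pow_smul_eq {V : Finset (Fin n)} {w : Fin n} (hw : w ∉ V) (a : ℕ) {e : E}
    (he : e ∈ varTorsion k V E) :
    ∃ e' ∈ varTorsion k V E, (X w : MvPolynomial (Fin n) k) ^ a • e' = e := by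
  induction a with
  | zero => exact ⟨e, he, by rw [pow_zero, one_smul]⟩
  | succ a ih =>
    obtain ⟨e₁, he₁, rfl⟩ := ih
    obtain ⟨e₂, he₂, rfl⟩ := hE V w hw e₁ he₁
    exact ⟨e₂, he₂, by rw [pow_succ, mul_smul]⟩

-- A torsion element lifts from the localization at `x^{S'}` to that at `x^S` because the factor
-- `x_w` of its denominator can be divided out of the numerator, once the numerator itself is made
-- torsion.
include hE in
theorem exists_cechRes_eq {V S S' : Finset (Fin n)} {w : Fin n} (hwV : w ∉ V)
    (hS : S' \ S = {w}) (h : S ⊆ S') {y : cechLoc k E S'} (hy : y ∈ varTorsion k V _) :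
    ∃ y' ∈ varTorsion k V (cechLoc k E S), cechRes k E h y' = y := by
  obtain ⟨m, a, rfl⟩ := exists_cechMk y
  have h1 : ∀ v ∈ V, ∃ b c : ℕ, sqfreeMonomial k S' ^ c •
      (X v : MvPolynomial (Fin n) k) ^ b • m = 0 := by
    intro v hv
    obtain ⟨b, hb⟩ := hy v hv
    rw [smul_cechMk, cechMk_eq_zero_iff] at hb
    exact ⟨b, hb⟩
  choose! b c hbc using h1
  -- The sum of the exponents `c v` serves all `v ∈ V` at once.
  have hm : sqfreeMonomial k S' ^ (∑ v ∈ V, c v) • m ∈ varTorsion k V E := by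
    intro v hv
    refine ⟨b v, ?_⟩
    rw [← Finset.add_sum_erase V c hv, add_comm, pow_add, mul_smul, smul_comm,
      smul_comm (X v ^ b v),
      hbc v hv, smul_zero]
  obtain ⟨m', hm', hmm⟩ := exists_X_pow_smul_eq hE hwV (∑ v ∈ V, c v + a) hm
  refine ⟨cechMk S m' (∑ v ∈ V, c v + a), ?_, ?_⟩
  · intro v hv
    obtain ⟨b, hb⟩ := hm' v hv
    refine ⟨b, ?_⟩
    rw [smul_cechMk, hb]
    exact cechMk_eq_zero_iff.2 ⟨0, smul_zero _⟩
  · rw [cechRes_cechMk, hS, sqfreeMonomial_singleton, hmm, cechMk_cancel]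

theorem neg_one_pow_mul_self {R : Type*} [CommRing R] (a : ℕ) :
    ((-1 : R) ^ a) * (-1) ^ a = 1 := by
  rw [← mul_pow]; simp

/-- One step of the elimination of variables from a cocycle. -/
theorem exists_cech_elimination (hE : ∀ (V : Finset (Fin n)) (w : Fin n), w ∉ V →
      ∀ e ∈ varTorsion k V E, ∃ e' ∈ varTorsion k V E, (X w : MvPolynomial (Fin n) k) • e' = e)
    {V : Finset (Fin n)} {w : Fin n} (hw : w ∉ V) {p : ℤ} {f : CechCochain k n E}
    (hf : f ∈ cechCocycles k n E (p + 1)) (hfV : ∀ S, ¬ Disjoint S V → f S = 0)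
    (hfT : ∀ S, f S ∈ varTorsion k V (cechLoc k E S)) :
    ∃ g ∈ cechCochains k n E p,
      (∀ S, ¬ Disjoint S (insert w V) → (f - cechD k n E g) S = 0) ∧
      ∀ S, (f - cechD k n E g) S ∈ varTorsion k (insert w V) (cechLoc k E S) := by
  -- The cochain `g` lives on sets `S` disjoint from `V` that miss `w`, and lifts `± f (insert w S)`
  -- there; subtracting `d g` cancels the components of `f` that contain `w`.
  have h1 (S : Finset (Fin n)) : ∃ y ∈ varTorsion k V (cechLoc k E S),
      (¬ (w ∉ S ∧ Disjoint S V ∧ (S.card : ℤ) = p) → y = 0) ∧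
      (w ∉ S → Disjoint S V → (S.card : ℤ) = p → 
        cechRes k E (Finset.subset_insert w S) y =
          (-1 : MvPolynomial (Fin n) k) ^ ((insert w S).filter (· < w)).card • f (insert w S)) := by
    by_cases hS : w ∉ S ∧ Disjoint S V ∧ (S.card : ℤ) = p
    · obtain ⟨y, hy, hy'⟩ := exists_cechRes_eq hE hw
        (Finset.insert_sdiff_cancel hS.1) (Finset.subset_insert w S)
        (Submodule.smul_mem _ ((-1 : MvPolynomial (Fin n) k) ^
          ((insert w S).filter (· < w)).card) (hfT (insert w S)))
      exact ⟨y, hy, fun h => absurd hS h, fun _ _ _ => hy'⟩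
    · exact ⟨0, zero_mem _, fun _ => rfl, fun h h' h'' => absurd ⟨h, h', h''⟩ hS⟩
  choose g hgT hg0 hg using h1
  have hgp : g ∈ cechCochains k n E p := fun S hS => hg0 S fun h => hS h.2.2
  have hres : ∀ {T S S' : Finset (Fin n)} (h : T ⊆ S) (h' : T ⊆ S'), S = S' →
      ∀ z : CechCochain k n E, cechRes k E h (z T) = 0 → cechRes k E h' (z T) = 0 := by
    rintro T S _ h h' rfl z hz; exact hz
  -- components meeting `insert w V`
  have hzero : ∀ S, ¬ Disjoint S (insert w V) → (f - cechD k n E g) S = 0 := by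
    intro S hS
    by_cases hSV : Disjoint S V
    · have hwS : w ∈ S := by
        by_contra h
        exact hS (Finset.disjoint_insert_right.2 ⟨h, hSV⟩)
      -- As `g` vanishes on sets containing `w`, only the term that removes `w` survives.
      rw [Pi.sub_apply, sub_eq_zero, cechD_apply, Finset.sum_eq_single_of_mem w hwS]
      · by_cases hp : (S.card : ℤ) = p + 1
        · have hc := Finset.card_erase_add_one hwS
          have hins : insert w (S.erase w) = S := Finset.insert_erase hwS
          have h := hg (S.erase w) (Finset.notMem_erase w S)
            (hSV.mono_left (S.erase_subset w)) (by omega)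
          have h' : ∀ S', (hS' : S' = S) → ∀ hh : S.erase w ⊆ S',
            cechRes k E hh (g (S.erase w)) = (-1 : MvPolynomial (Fin n) k) ^
              (S'.filter (· < w)).card • f S' →
            f S = (-1 : MvPolynomial (Fin n) k) ^ (S.filter (· < w)).card •
              cechRes k E (S.erase_subset w) (g (S.erase w)) := by
            rintro _ rfl hh e
            rw [e, smul_smul, neg_one_pow_mul_self, one_smul]
          exact h' _ hins _ h
        · rw [hf.1 S hp, hgp, map_zero, smul_zero]
          have hc := Finset.card_erase_add_one hwS
          omega
      · intro v hv hvw
        rw [hg0, map_zero, smul_zero]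
        exact fun h => h.1 (Finset.mem_erase.2 ⟨hvw.symm, hwS⟩)
    · rw [Pi.sub_apply, hfV S hSV, zero_sub, neg_eq_zero, cechD_apply]
      refine Finset.sum_eq_zero fun v hv => ?_
      by_cases h : Disjoint (S.erase v) V
      · have hvV : v ∈ V := by
          by_contra hvV
          apply hSV
          rw [← Finset.insert_erase hv]
          exact Finset.disjoint_insert_left.2 ⟨hvV, h⟩
        -- The restriction is `x_v`-torsion in a localization where `x_v` is invertible, hence zero.
        obtain ⟨b, hb⟩ := map_mem_varTorsion (cechRes k E (S.erase_subset v))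
          (hgT (S.erase v)) v hvV
        rw [eq_zero_of_X_pow_smul hv hb, smul_zero]
      · rw [hg0 _ (fun h' => h h'.2.1), map_zero, smul_zero]
  refine ⟨g, hgp, hzero, fun S v hv => ?_⟩
  by_cases hS : Disjoint S (insert w V)
  swap
  · exact ⟨0, by rw [hzero S hS, smul_zero]⟩
  rcases Finset.mem_insert.1 hv with rfl | hv
  -- The new cocycle vanishes on all sets containing the eliminated variable `v`, so the cocycle
  -- condition at `insert v S` says that its component at `S` restricts to zero there. This means
  -- that a power of `x_v` kills the component.
  · have hd : cechD k n E (f - cechD k n E g) = 0 := by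
      rw [map_sub, cechD_cechD, sub_zero]; exact hf.2
    have hvS : v ∉ S := (Finset.disjoint_insert_right.1 hS).1
    have h0 : cechD k n E (f - cechD k n E g) (insert v S) = 0 := congrFun hd _
    rw [cechD_apply, Finset.sum_eq_single_of_mem v (Finset.mem_insert_self v S)] at h0
    · have h2 : cechRes k E (Finset.subset_insert v S) ((f - cechD k n E g) S) = 0 := by
        have h3 := congrArg (((-1 : MvPolynomial (Fin n) k) ^
          ((insert v S).filter (· < v)).card) • ·) h0
        simp only [smul_smul, neg_one_pow_mul_self, one_smul, smul_zero] at h3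
        have h4 : ∀ T (hT : T ⊆ insert v S), T = S →
            cechRes k E hT ((f - cechD k n E g) T) = 0 →
            cechRes k E (Finset.subset_insert v S) ((f - cechD k n E g) S) = 0 := by
          rintro _ hT rfl h; exact h
        exact h4 _ _ (Finset.erase_insert hvS) h3
      obtain ⟨m, a, hm⟩ := exists_cechMk ((f - cechD k n E g) S)
      rw [hm, cechRes_cechMk, cechMk_eq_zero_iff, Finset.insert_sdiff_cancel hvS,
        sqfreeMonomial_singleton, ← Finset.insert_erase (Finset.mem_insert_self v S),
        Finset.erase_insert hvS] at h2
      obtain ⟨c, hc⟩ := h2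
      refine ⟨c + a, ?_⟩
      rw [hm, smul_cechMk, cechMk_eq_zero_iff]
      refine ⟨c, ?_⟩
      have h5 : sqfreeMonomial k (insert v S) = X v * sqfreeMonomial k S :=
        Finset.prod_insert hvS
      rw [smul_smul] at hc ⊢
      rw [← hc, h5]
      congr 1
      ring
    · intro u hu huv
      rw [hzero, map_zero, smul_zero]
      exact Finset.not_disjoint_iff.2 ⟨v, Finset.mem_erase.2 ⟨huv.symm, Finset.mem_insert_self v S⟩,
        Finset.mem_insert_self v V⟩
  · refine (sub_mem (hfT S) ?_ : (f - cechD k n E g) S ∈ varTorsion k V _) v hv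
    rw [cechD_apply]
    exact sum_mem fun u hu => Submodule.smul_mem _ _ (map_mem_varTorsion _ (hgT _))

-- Modulo coboundaries, a cocycle can be made to vanish on sets meeting `V` and to have `V`-torsion
-- components, for larger and larger `V`. When `V` is everything, only the empty set is left, and
-- its cardinality is not `p + 1`.
include hE in
theorem cechCocycles_le_cechCoboundaries (p : ℕ) :
    cechCocycles k n E (p + 1 : ℕ) ≤ cechCoboundaries k n E (p + 1 : ℕ) := by
  have e : ((p + 1 : ℕ) : ℤ) - 1 = p := by push_cast; ring
  have key : ∀ (m : ℕ) (V : Finset (Fin n)), Vᶜ.card = m → ∀ f ∈ cechCocycles k n E (p + 1 : ℕ),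
      (∀ S, ¬ Disjoint S V → f S = 0) → (∀ S, f S ∈ varTorsion k V (cechLoc k E S)) →
      f ∈ cechCoboundaries k n E (p + 1 : ℕ) := by
    intro m
    induction m with
    | zero =>
      intro V hV f hf hfV _
      have : f = 0 := by
        funext S
        by_cases hS : S = ∅
        · refine hf.1 S ?_
          rw [hS, Finset.card_empty]
          push_cast
          omega
        · refine hfV S fun h => hS ?_
          have hV' : V = Finset.univ := by
            rw [← Finset.compl_eq_empty_iff, ← Finset.card_eq_zero, hV]
          rw [hV'] at h
          exact Finset.disjoint_self_iff_empty S |>.1 (h.mono_right (Finset.subset_univ S))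
      rw [this]
      exact zero_mem _
    | succ m ih =>
      intro V hV f hf hfV hfT
      obtain ⟨w, hw⟩ : Vᶜ.Nonempty := by
        rw [← Finset.card_pos, hV]; omega
      obtain ⟨g, hg, h1, h2⟩ := exists_cech_elimination (p := p) hE (Finset.mem_compl.1 hw)
        (by exact_mod_cast hf) hfV hfT
      have hdg : cechD k n E g ∈ cechCoboundaries k n E (p + 1 : ℕ) := ⟨g, by rwa [e], rfl⟩
      have h3 := ih (insert w V) (by
        rw [Finset.compl_insert, Finset.card_erase_of_mem hw, hV]; rfl) (f - cechD k n E g)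
        (sub_mem hf (cechCoboundaries_le _ hdg)) h1 h2
      have h4 := add_mem h3 hdg
      rwa [sub_add_cancel] at h4
  intro f hf
  exact key _ ∅ rfl f hf (fun S hS => absurd (Finset.disjoint_empty_right S) hS)
    (fun S v hv => absurd hv (Finset.notMem_empty v))

end Acyclic
end

noncomputable section

/-! ### Local cohomology is Čech cohomology -/

section Comparison

variable {k : Type u} [Field k] {n : ℕ}

theorem bijective_mkLinearMap_empty (k : Type u) [Field k] (n : ℕ) (M : Type u) [AddCommGroup M]
    [Module (MvPolynomial (Fin n) k) M] :
    Function.Bijective (LocalizedModule.mkLinearMap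
      (Submonoid.powers (sqfreeMonomial k (∅ : Finset (Fin n)))) M) := by
  have h1 : sqfreeMonomial k (∅ : Finset (Fin n)) = 1 := Finset.prod_empty
  constructor
  · intro m m' (h : cechMk (k := k) ∅ m 0 = cechMk ∅ m' 0)
    rw [cechMk_eq_iff] at h
    simpa [h1] using h
  · intro y
    obtain ⟨m, a, rfl⟩ := exists_cechMk y
    refine ⟨m, (?_ : cechMk (k := k) ∅ m 0 = _)⟩
    rw [cechMk_eq_iff]
    exact ⟨0, by simp [h1]⟩

/-- The value at the empty set of a Čech cochain. -/
def cechZeroEval (k : Type u) [Field k] (n : ℕ) (M : Type u) [AddCommGroup M]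
    [Module (MvPolynomial (Fin n) k) M] : CechCochain k n M →ₗ[MvPolynomial (Fin n) k] M :=
  (LinearEquiv.ofBijective _ (bijective_mkLinearMap_empty k n M)).symm.toLinearMap ∘ₗ
    LinearMap.proj ∅

theorem cechZeroEval_eq_iff {M : Type u} [AddCommGroup M] [Module (MvPolynomial (Fin n) k) M]
    (z : CechCochain k n M) (m : M) : cechZeroEval k n M z = m ↔ z ∅ = cechMk ∅ m 0 :=
  LinearEquiv.symm_apply_eq _

theorem cechZeroEval_cechMap {M N : Type u} [AddCommGroup M] [Module (MvPolynomial (Fin n) k) M]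
    [AddCommGroup N] [Module (MvPolynomial (Fin n) k) N] (f : M →ₗ[MvPolynomial (Fin n) k] N)
    (z : CechCochain k n M) : cechZeroEval k n N (cechMap f z) = f (cechZeroEval k n M z) := by
  rw [cechZeroEval_eq_iff, cechMap_apply, (cechZeroEval_eq_iff z _).1 rfl, cechLocMap_cechMk]

theorem cechZeroEval_injective {M : Type u} [AddCommGroup M] [Module (MvPolynomial (Fin n) k) M]
    {z z' : CechCochain k n M} (hz : z ∈ cechCochains k n M 0) (hz' : z' ∈ cechCochains k n M 0)
    (h : cechZeroEval k n M z = cechZeroEval k n M z') : z = z' := by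
  funext S
  by_cases hS : S = ∅
  · subst hS
    rw [(cechZeroEval_eq_iff z _).1 rfl, (cechZeroEval_eq_iff z' _).1 rfl, h]
  · have : (S.card : ℤ) ≠ 0 := by simpa using hS
    rw [hz S this, hz' S this]

/-- If each variable acts nilpotently on `m`, then `𝔪` lies in the radical of the annihilator. As
`𝔪` is finitely generated, a power of it lies in the annihilator. -/
theorem forall_irrelevantIdeal_pow_iff {M : Type u} [AddCommGroup M]
    [Module (MvPolynomial (Fin n) k) M] (m : M) :
    (∃ t : ℕ, ∀ r ∈ irrelevantIdeal k n ^ t, r • m = 0) ↔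
      m ∈ varTorsion k (Finset.univ : Finset (Fin n)) M := by
  constructor
  · rintro ⟨t, ht⟩ v _
    have hv : (X v : MvPolynomial (Fin n) k) ∈ irrelevantIdeal k n := Ideal.subset_span ⟨v, rfl⟩
    exact ⟨t, ht _ (Ideal.pow_mem_pow hv t)⟩
  · intro h
    let A : Ideal (MvPolynomial (Fin n) k) :=
      LinearMap.ker (LinearMap.toSpanSingleton (MvPolynomial (Fin n) k) M m)
    have hA : irrelevantIdeal k n ≤ A.radical := by
      refine Ideal.span_le.2 ?_
      rintro _ ⟨v, rfl⟩
      obtain ⟨b, hb⟩ := h v (Finset.mem_univ v)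
      exact ⟨b, hb⟩
    obtain ⟨t, ht⟩ := Ideal.exists_pow_le_of_le_radical_of_fg hA (IsNoetherian.noetherian _)
    exact ⟨t, fun r hr => ht hr⟩

/-- The differential of a `0`-cochain has component `m / 1` at `{v}`, which vanishes exactly when a
power of `x_v` kills `m`. -/
theorem exists_cechZeroEval_iff {M : Type u} [AddCommGroup M]
    [Module (MvPolynomial (Fin n) k) M] (m : M) :
    (∃ z ∈ cechCocycles k n M 0, cechZeroEval k n M z = m) ↔
      m ∈ varTorsion k (Finset.univ : Finset (Fin n)) M := by
  have hone : ∀ S : Finset (Fin n), S.card ≠ 1 → ∀ z ∈ cechCochains k n M 0,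
      cechD k n M z S = 0 := by
    intro S hS z hz
    have := cechD_mem hz
    exact this S (by push_cast; omega)
  have hsing : ∀ (v : Fin n) (z : CechCochain k n M), z ∅ = cechMk ∅ (cechZeroEval k n M z) 0 →
      cechD k n M z {v} = cechMk {v} (cechZeroEval k n M z) 0 := by
    intro v z hz
    rw [cechD_apply, Finset.sum_singleton]
    have h1 : (({v} : Finset (Fin n)).filter (· < v)).card = 0 := by
      rw [Finset.card_eq_zero, Finset.filter_eq_empty_iff]
      intro a ha
      rw [Finset.mem_singleton.1 ha]
      exact lt_irrefl v
    rw [h1, pow_zero, one_smul]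
    have h2 : ∀ T (hT : T ⊆ {v}), T = ∅ → cechRes k M hT (z T) =
        cechMk {v} (cechZeroEval k n M z) 0 := by
      rintro _ hT rfl
      rw [hz, cechRes_mk_zero]
    exact h2 _ _ (Finset.erase_singleton v)
  constructor
  · rintro ⟨z, hz, rfl⟩ v _
    have h : cechD k n M z {v} = 0 := congrFun hz.2 _
    rw [hsing v z ((cechZeroEval_eq_iff z _).1 rfl), cechMk_eq_zero_iff,
      sqfreeMonomial_singleton] at h
    exact h
  · intro hm
    let z : CechCochain k n M := Pi.single ∅ (cechMk ∅ m 0)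
    have hz0 : z ∅ = cechMk ∅ m 0 := Pi.single_eq_same _ _
    have hzm : cechZeroEval k n M z = m := (cechZeroEval_eq_iff z m).2 hz0
    have hz : z ∈ cechCochains k n M 0 := by
      intro S hS
      refine Pi.single_eq_of_ne ?_ _
      rintro rfl
      simp at hS
    refine ⟨z, ⟨hz, ?_⟩, hzm⟩
    change cechD k n M z = 0
    funext S
    by_cases hS : S.card = 1
    · obtain ⟨v, rfl⟩ := Finset.card_eq_one.1 hS
      rw [hsing v z (by rw [hzm, hz0]), hzm]
      obtain ⟨b, hb⟩ := hm v (Finset.mem_univ v)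
      exact cechMk_eq_zero_iff.2 ⟨b, by rwa [sqfreeMonomial_singleton]⟩
    · exact hone S hS z hz

theorem nonempty_equiv_of_surjective {R A A' B B' : Type*} [Ring R] [AddCommGroup A] [Module R A]
    [AddCommGroup B] [Module R B] [AddCommGroup A'] [Module R A'] [AddCommGroup B'] [Module R B']
    (f : A →ₗ[R] B) (f' : A' →ₗ[R] B') (hf : Function.Surjective f) (hf' : Function.Surjective f')
    (e : A ≃ₗ[R] A') (h : ∀ a, f a = 0 ↔ f' (e a) = 0) : Nonempty (B ≃ₗ[R] B') := by
  have hs : Function.Surjective (f' ∘ₗ e.toLinearMap) := hf'.comp e.surjective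
  refine ⟨(f.quotKerEquivOfSurjective hf).symm.trans ((Submodule.quotEquivOfEq _ _ ?_).trans
    ((f' ∘ₗ e.toLinearMap).quotKerEquivOfSurjective hs))⟩
  ext a
  exact h a

theorem exists_equiv_of_range_eq {R A A' B : Type*} [Ring R] [AddCommGroup A] [Module R A]
    [AddCommGroup B] [Module R B] [AddCommGroup A'] [Module R A'] (f : A →ₗ[R] B)
    (f' : A' →ₗ[R] B) (hf : Function.Injective f) (hf' : Function.Injective f')
    (h : ∀ b, (∃ a, f a = b) ↔ ∃ a, f' a = b) : ∃ e : A ≃ₗ[R] A', ∀ a, f' (e a) = f a := by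
  have hr : LinearMap.range f = LinearMap.range f' := Submodule.ext h
  refine ⟨(LinearEquiv.ofInjective f hf).trans ((LinearEquiv.ofEq _ _ hr).trans
    (LinearEquiv.ofInjective f' hf').symm), fun a => ?_⟩
  have := LinearEquiv.apply_symm_apply (LinearEquiv.ofInjective f' hf')
    (LinearEquiv.ofEq _ _ hr (LinearEquiv.ofInjective f hf a))
  exact congrArg Subtype.val this

-- Both sides embed naturally in `M` with image the `𝔪`-power torsion. Compatibility with maps,
-- needed to match the cokernels describing `H¹`, can be checked inside the module.
open LocalCohomologySequence in
theorem exists_locCoh_zero_equiv : ∃ (e : ∀ M : ModuleCat.{u} (MvPolynomial (Fin n) k),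
      (localCohomology (irrelevantIdeal k n) 0).obj M ≃ₗ[MvPolynomial (Fin n) k]
        cechCocycles k n M 0),
    ∀ (M N : ModuleCat.{u} (MvPolynomial (Fin n) k)) (f : M ⟶ N) (x),
      cechMap f.hom (e M x).1 = (e N ((localCohomology (irrelevantIdeal k n) 0).map f x)).1 := by
  obtain ⟨τ, hτ⟩ := exists_torsion (irrelevantIdeal k n)
  have h (M : ModuleCat.{u} (MvPolynomial (Fin n) k)) := exists_equiv_of_range_eq (τ.app M).hom
    (cechZeroEval k n M ∘ₗ (cechCocycles k n M 0).subtype) (hτ M).1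
    (fun z z' h => Subtype.ext (cechZeroEval_injective z.2.1 z'.2.1 h)) (fun m => by
      refine ((hτ M).2 m).trans ((forall_irrelevantIdeal_pow_iff m).trans
        ((exists_cechZeroEval_iff m).symm.trans ?_))
      exact ⟨fun ⟨z, hz, h⟩ => ⟨⟨z, hz⟩, h⟩, fun ⟨z, h⟩ => ⟨z.1, z.2, h⟩⟩)
  choose e he using h
  refine ⟨e, fun M N f x => ?_⟩
  refine cechZeroEval_injective (cechMap_mem _ (e M x).2.1) (e N _).2.1 ?_
  rw [cechZeroEval_cechMap]
  have h1 := he M x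
  have h2 := he N ((localCohomology (irrelevantIdeal k n) 0).map f x)
  have h3 := congr($(τ.naturality f) x)
  exact (congrArg f.hom h1).trans (h3.symm.trans h2.symm)

open LocalCohomologySequence in
/-- Local cohomology with support in the irrelevant ideal is Čech cohomology. -/
theorem nonempty_locCoh_equiv_cech (i : ℕ) (M : ModuleCat.{u} (MvPolynomial (Fin n) k)) :
    Nonempty ((localCohomology (irrelevantIdeal k n) i).obj M ≃ₗ[MvPolynomial (Fin n) k]
      CechCohomology k n M i) := by
  induction i generalizing M with
  | zero =>
    obtain ⟨e, -⟩ := exists_locCoh_zero_equiv (k := k) (n := n)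
    refine ⟨(e M).trans (Submodule.quotEquivOfEqBot _ ?_).symm⟩
    rw [eq_bot_iff]
    rintro z ⟨g, hg, hgz⟩
    -- There are no cochains in degree `-1`.
    have h0 : g = 0 := by
      funext S
      refine hg S ?_
      push_cast
      omega
    rw [h0, map_zero] at hgz
    exact Subtype.ext hgz.symm
  | succ i ih =>
    let S : ShortComplex (ModuleCat.{u} (MvPolynomial (Fin n) k)) :=
      ShortComplex.mk (Injective.ι M) (Limits.cokernel.π (Injective.ι M))
        (Limits.cokernel.condition _)
    have hS : S.ShortExact := ShortComplex.ShortExact.mk' (ShortComplex.exact_cokernel _)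
      inferInstance inferInstance
    have hinj : Injective S.X₂ := inferInstanceAs (Injective (Injective.under M))
    have hinj' : Module.Injective (MvPolynomial (Fin n) k) S.X₂ :=
      Module.injective_module_of_injective_object _ _
    have hE := cechCocycles_le_cechCoboundaries (E := S.X₂)
      (fun V w hw e he => exists_X_smul_eq_of_injective (k := k) (n := n) S.X₂ V hw he)
    have hf : Function.Injective S.f.hom := (ModuleCat.mono_iff_injective _).1 hS.mono_f
    have hg : Function.Surjective S.g.hom := (ModuleCat.epi_iff_surjective _).1 hS.epi_g
    have hfg : Function.Exact S.f.hom S.g.hom :=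
      (ShortComplex.ShortExact.moduleCat_exact_iff_function_exact S).1 hS.exact
    -- `H¹` is compared through its presentation as a cokernel in degree zero; the dimension shift
    -- applies only from `H²` on.
    cases i with
    | zero =>
      obtain ⟨e, he⟩ := exists_locCoh_zero_equiv (k := k) (n := n)
      obtain ⟨d, hd, hd'⟩ := exists_connecting_zero (J := irrelevantIdeal k n) hS
      obtain ⟨ψ, hψ, hψ'⟩ := exists_cech_connecting hf hfg hg 0 (hE 0)
      refine nonempty_equiv_of_surjective d.hom ψ hd hψ (e S.X₃) fun x => ?_
      rw [hψ']
      refine (hd' x).trans ⟨?_, ?_⟩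
      · rintro ⟨y, rfl⟩
        exact ⟨_, (e S.X₂ y).2, he _ _ S.g y⟩
      · rintro ⟨z, hz, hzx⟩
        refine ⟨(e S.X₂).symm ⟨z, hz⟩, (e S.X₃).injective (Subtype.ext ?_)⟩
        rw [← he, LinearEquiv.apply_symm_apply]
        exact hzx
    | succ i =>
      obtain ⟨e₁⟩ := nonempty_iso_succ (J := irrelevantIdeal k n) i hS
      obtain ⟨e₂⟩ := ih S.X₃
      obtain ⟨e₃⟩ := nonempty_cech_equiv_succ hf hfg hg hE i
      exact ⟨e₁.symm.toLinearEquiv.trans (e₂.trans e₃)⟩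

end Comparison
end

noncomputable section

/-! ### Coefficients of elements of face rings -/

/-! ### Exponent vectors in `ℤⁿ` and their supports -/

section Exponents

variable {n : ℕ}

/-- The exponent `α + a • 𝟏_S`. -/
def shiftExp (S : Finset (Fin n)) (a : ℤ) (α : Fin n → ℤ) : Fin n → ℤ :=
  fun i => α i + if i ∈ S then a else 0

theorem shiftExp_shiftExp (S : Finset (Fin n)) (a b : ℤ) (α : Fin n → ℤ) :
    shiftExp S a (shiftExp S b α) = shiftExp S (a + b) α := by
  funext i
  simp only [shiftExp]
  split_ifs <;> ring

theorem shiftExp_zero (S : Finset (Fin n)) (α : Fin n → ℤ) : shiftExp S 0 α = α := by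
  funext i
  simp [shiftExp]

theorem shiftExp_injective (S : Finset (Fin n)) (a : ℤ) : Function.Injective (shiftExp S a) := by
  intro α β h
  have := congrArg (shiftExp S (-a)) h
  simpa only [shiftExp_shiftExp, neg_add_cancel, shiftExp_zero] using this

theorem mem_intSupport {α : Fin n → ℤ} {i : Fin n} : i ∈ intSupport α ↔ α i ≠ 0 := by
  simp [intSupport]

theorem intSupport_shiftExp_subset (S : Finset (Fin n)) (a : ℤ) (α : Fin n → ℤ) :
    intSupport (shiftExp S a α) ⊆ S ∪ intSupport α := by
  intro i hi
  rw [mem_intSupport, shiftExp] at hi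
  rw [Finset.mem_union, mem_intSupport]
  by_contra h
  push Not at h
  simp [h.1, h.2] at hi

theorem union_intSupport_shiftExp (S : Finset (Fin n)) (a : ℤ) (α : Fin n → ℤ) :
    S ∪ intSupport (shiftExp S a α) = S ∪ intSupport α := by
  apply subset_antisymm
  · exact Finset.union_subset Finset.subset_union_left (intSupport_shiftExp_subset S a α)
  · refine Finset.union_subset Finset.subset_union_left ?_
    conv_lhs => rw [← shiftExp_zero S α, ← neg_add_cancel a, ← shiftExp_shiftExp]
    exact intSupport_shiftExp_subset S _ _

/-- The exponent in `ℕⁿ` given by an exponent in `ℤⁿ`. -/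
def natExp (β : Fin n → ℤ) : Fin n →₀ ℕ := Finsupp.equivFunOnFinite.symm fun i => (β i).toNat

theorem natExp_apply (β : Fin n → ℤ) (i : Fin n) : natExp β i = (β i).toNat := rfl

theorem support_natExp {β : Fin n → ℤ} (hβ : 0 ≤ β) : (natExp β).support = intSupport β := by
  ext i
  rw [Finsupp.mem_support_iff, mem_intSupport, natExp_apply]
  have := hβ i
  simp only [Pi.zero_apply] at this
  omega

theorem natExp_cast (a : Fin n →₀ ℕ) : natExp (fun i => (a i : ℤ)) = a := by
  ext i
  simp [natExp_apply]

end Exponents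

/-! ### Coefficients in face rings and membership in face modules -/

section FaceCoeff

variable (k : Type u) [Field k] {n : ℕ}

theorem sqfreeMonomial_pow_eq (S : Finset (Fin n)) (b : ℕ) :
    sqfreeMonomial k S ^ b = monomial (∑ i ∈ S, Finsupp.single i b) 1 := by
  rw [sqfreeMonomial, ← Finset.prod_pow, monomial_sum_one]
  simp only [X_pow_eq_monomial]

theorem sum_single_apply (S : Finset (Fin n)) (b : ℕ) (i : Fin n) :
    (∑ j ∈ S, Finsupp.single j b) i = if i ∈ S then b else 0 := by
  rw [Finsupp.finsetSum_apply]
  simp [Finsupp.single_apply]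

/-- Membership in a monomial ideal is tested monomial by monomial. As `Δ` is closed under subsets,
`x^a` is divisible by some `x^τ`, `τ ∉ Δ`, exactly when the support of `a` is not in `Δ`. -/
theorem mem_faceIdeal_iff (Δ : SimplComplex n) (f : MvPolynomial (Fin n) k) :
    f ∈ faceIdeal k Δ ↔ ∀ a ∈ f.support, a.support ∉ Δ := by
  have h : faceIdeal k Δ = Ideal.span ((fun s => monomial s (1 : k)) ''
      {s | ∃ τ, τ ∉ Δ ∧ s = ∑ i ∈ τ, Finsupp.single i 1}) := by
    unfold faceIdeal
    congr 1
    ext f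
    constructor
    · rintro ⟨τ, hτ, rfl⟩
      refine ⟨_, ⟨τ, hτ, rfl⟩, ?_⟩
      rw [← pow_one (sqfreeMonomial k τ), sqfreeMonomial_pow_eq]
    · rintro ⟨_, ⟨τ, hτ, rfl⟩, rfl⟩
      refine ⟨τ, hτ, ?_⟩
      rw [← pow_one (sqfreeMonomial k τ), sqfreeMonomial_pow_eq]
  rw [h, mem_ideal_span_monomial_image]
  refine forall₂_congr fun a _ => ⟨?_, fun ha => ?_⟩
  · rintro ⟨_, ⟨τ, hτ, rfl⟩, h⟩ ha
    refine hτ (Δ.lower (fun i hi => ?_) ha)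
    have := h i
    rw [sum_single_apply, if_pos hi] at this
    rw [Finsupp.mem_support_iff]
    omega
  · refine ⟨_, ⟨_, ha, rfl⟩, fun i => ?_⟩
    rw [sum_single_apply]
    split_ifs with hi
    · rw [Finsupp.mem_support_iff] at hi
      omega
    · omega

open Classical in
/-- The coefficient at `x^β` of an element of the face ring. -/
def faceCoeff {Δ : SimplComplex n} (x : MvPolynomial (Fin n) k ⧸ faceIdeal k Δ) (β : Fin n → ℤ) :
    k :=
  if 0 ≤ β ∧ intSupport β ∈ Δ then coeff (natExp β) (Quotient.out x) else 0

variable {k} {Δ Γ : SimplComplex n}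

/-- This makes `faceCoeff` independent of the representative: elements of the face ideal have no
monomials supported on faces. -/
theorem coeff_eq_of_mk_eq {p q : MvPolynomial (Fin n) k}
    (h : (Submodule.Quotient.mk p : MvPolynomial (Fin n) k ⧸ faceIdeal k Δ) =
      Submodule.Quotient.mk q) {a : Fin n →₀ ℕ} (ha : a.support ∈ Δ) : coeff a p = coeff a q := by
  rw [Submodule.Quotient.eq, mem_faceIdeal_iff] at h
  by_contra hne
  refine h a ?_ ha
  rw [mem_support_iff, coeff_sub]
  exact sub_ne_zero.2 hne

open Classical in
theorem faceCoeff_mk (p : MvPolynomial (Fin n) k) (β : Fin n → ℤ) :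
    faceCoeff k (Submodule.Quotient.mk p : MvPolynomial (Fin n) k ⧸ faceIdeal k Δ) β =
      if 0 ≤ β ∧ intSupport β ∈ Δ then coeff (natExp β) p else 0 := by
  unfold faceCoeff
  split_ifs with h
  · refine coeff_eq_of_mk_eq (Δ := Δ) (Quotient.out_eq _) ?_
    rw [support_natExp h.1]
    exact h.2
  · rfl

theorem faceCoeff_of_notMem (x : MvPolynomial (Fin n) k ⧸ faceIdeal k Δ) {β : Fin n → ℤ}
    (h : intSupport β ∉ Δ) : faceCoeff k x β = 0 :=
  if_neg fun h' => h h'.2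

theorem faceCoeff_of_neg (x : MvPolynomial (Fin n) k ⧸ faceIdeal k Δ) {β : Fin n → ℤ} {i : Fin n}
    (h : β i < 0) : faceCoeff k x β = 0 :=
  if_neg fun h' => absurd (h'.1 i) (not_le.2 h)

theorem faceCoeff_add (x y : MvPolynomial (Fin n) k ⧸ faceIdeal k Δ) (β : Fin n → ℤ) :
    faceCoeff k (x + y) β = faceCoeff k x β + faceCoeff k y β := by
  obtain ⟨p, rfl⟩ := Submodule.Quotient.mk_surjective _ x
  obtain ⟨q, rfl⟩ := Submodule.Quotient.mk_surjective _ y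
  rw [← Submodule.Quotient.mk_add, faceCoeff_mk, faceCoeff_mk, faceCoeff_mk]
  split_ifs
  · rw [coeff_add]
  · rw [add_zero]

theorem faceCoeff_smul (c : k) (x : MvPolynomial (Fin n) k ⧸ faceIdeal k Δ) (β : Fin n → ℤ) :
    faceCoeff k (c • x) β = c * faceCoeff k x β := by
  obtain ⟨p, rfl⟩ := Submodule.Quotient.mk_surjective _ x
  rw [← Submodule.Quotient.mk_smul, faceCoeff_mk, faceCoeff_mk]
  split_ifs
  · rw [coeff_smul, smul_eq_mul]
  · rw [mul_zero]

theorem eq_zero_of_faceCoeff {x : MvPolynomial (Fin n) k ⧸ faceIdeal k Δ}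
    (h : ∀ β, faceCoeff k x β = 0) : x = 0 := by
  obtain ⟨p, rfl⟩ := Submodule.Quotient.mk_surjective _ x
  rw [Submodule.Quotient.mk_eq_zero, mem_faceIdeal_iff]
  intro a ha haΔ
  have h1 := h fun i => (a i : ℤ)
  have h0 : (0 : Fin n → ℤ) ≤ fun i => (a i : ℤ) := fun i => Int.natCast_nonneg _
  rw [faceCoeff_mk, natExp_cast, if_pos ⟨h0, by rwa [← support_natExp h0, natExp_cast]⟩] at h1
  exact mem_support_iff.1 ha h1

theorem finite_faceCoeff (x : MvPolynomial (Fin n) k ⧸ faceIdeal k Δ) :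
    {β | faceCoeff k x β ≠ 0}.Finite := by
  obtain ⟨p, rfl⟩ := Submodule.Quotient.mk_surjective _ x
  refine (p.support.finite_toSet.image fun a i => (a i : ℤ)).subset ?_
  intro β hβ
  rw [Set.mem_ofPred_eq, faceCoeff_mk] at hβ
  split_ifs at hβ with h
  · refine ⟨natExp β, mem_support_iff.2 hβ, funext fun i => ?_⟩
    exact Int.toNat_of_nonneg (h.1 i)
  · exact absurd rfl hβ

/-- The hypothesis on `γ` is essential: outside `Δ` the left side is zero, but lowering the
exponents may shrink the support to a face and make the right side nonzero. -/
theorem faceCoeff_pow_smul (x : MvPolynomial (Fin n) k ⧸ faceIdeal k Δ) (S : Finset (Fin n))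
    (b : ℕ) {γ : Fin n → ℤ} (hγ : intSupport γ ∈ Δ) :
    faceCoeff k (sqfreeMonomial k S ^ b • x) γ = faceCoeff k x (shiftExp S (-b) γ) := by
  obtain ⟨p, rfl⟩ := Submodule.Quotient.mk_surjective _ x
  rw [← Submodule.Quotient.mk_smul, smul_eq_mul, faceCoeff_mk, faceCoeff_mk,
    sqfreeMonomial_pow_eq, coeff_monomial_mul']
  by_cases h0 : 0 ≤ shiftExp S (-b) γ
  · have h0' (i) : 0 ≤ γ i + if i ∈ S then (-b : ℤ) else 0 := h0 i
    have h1 : 0 ≤ γ := by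
      intro i
      have := h0' i
      simp only [Pi.zero_apply]
      split_ifs at this <;> omega
    have h2 : ∑ i ∈ S, Finsupp.single i b ≤ natExp γ := by
      intro i
      rw [sum_single_apply, natExp_apply]
      have := h0' i
      split_ifs at this ⊢ <;> omega
    have h3 : natExp γ - ∑ i ∈ S, Finsupp.single i b = natExp (shiftExp S (-b) γ) := by
      ext i
      rw [Finsupp.tsub_apply, sum_single_apply, natExp_apply, natExp_apply, shiftExp]
      split_ifs <;> omega
    have h4 : intSupport (shiftExp S (-b) γ) ∈ Δ := by
      refine Δ.lower (fun i hi => ?_) hγ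
      rw [mem_intSupport] at hi ⊢
      have := h0' i
      simp only [shiftExp] at hi
      split_ifs at this hi <;> omega
    rw [if_pos ⟨h1, hγ⟩, if_pos h2, if_pos ⟨h0, h4⟩, one_mul, h3]
  · refine Eq.trans ?_ (if_neg fun h => h0 h.1).symm
    split_ifs with h1 h2
    · exfalso
      apply h0
      intro i
      have := h2 i
      have h3 := h1.1 i
      rw [sum_single_apply, natExp_apply] at this
      simp only [Pi.zero_apply, shiftExp] at h3 ⊢
      split_ifs at this ⊢ <;> omega
    · rfl
    · rfl

theorem mem_faceModule_iff (h : Γ ≤ Δ) (x : MvPolynomial (Fin n) k ⧸ faceIdeal k Δ) :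
    x ∈ faceModule k h ↔ ∀ β, intSupport β ∈ Γ → faceCoeff k x β = 0 := by
  obtain ⟨p, rfl⟩ := Submodule.Quotient.mk_surjective _ x
  have : Submodule.Quotient.mk p ∈ faceModule k h ↔ p ∈ faceIdeal k Γ :=
    Submodule.Quotient.mk_eq_zero _
  rw [this, mem_faceIdeal_iff]
  constructor
  · intro hp β hβ
    rw [faceCoeff_mk]
    split_ifs with h'
    · by_contra hne
      exact hp _ (mem_support_iff.2 hne) (by rwa [support_natExp h'.1])
    · rfl
  · intro hp a ha haΓ
    have h0 : (0 : Fin n → ℤ) ≤ fun i => (a i : ℤ) := fun i => Int.natCast_nonneg _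
    have h1 := hp (fun i => (a i : ℤ)) (by rwa [← support_natExp h0, natExp_cast])
    rw [faceCoeff_mk, natExp_cast, if_pos ⟨h0, by
      rw [← support_natExp h0, natExp_cast]; exact h haΓ⟩] at h1
    exact mem_support_iff.1 ha h1

open Classical in
theorem faceCoeff_monomial (β γ : Fin n → ℤ) (hβ : 0 ≤ β) (hβΔ : intSupport β ∈ Δ) (c : k) :
    faceCoeff k (Submodule.Quotient.mk (monomial (natExp β) c) :
      MvPolynomial (Fin n) k ⧸ faceIdeal k Δ) γ = if γ = β then c else 0 := by
  rw [faceCoeff_mk, coeff_monomial]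
  by_cases h : γ = β
  · subst h
    rw [if_pos ⟨hβ, hβΔ⟩, if_pos rfl, if_pos rfl]
  · rw [if_neg h]
    split_ifs with h1 h2
    · exfalso
      apply h
      funext i
      have h3 := DFunLike.congr_fun h2 i
      rw [natExp_apply, natExp_apply] at h3
      have h4 := h1.1 i
      have h5 := hβ i
      simp only [Pi.zero_apply] at h4 h5
      omega
    · rfl
    · rfl

theorem mem_faceModuleDegree_iff (h : Γ ≤ Δ) (β : Fin n → ℤ) (m : faceModule k h) :
    m ∈ faceModuleDegree k h β ↔ ∀ γ, γ ≠ β → faceCoeff k m.1 γ = 0 := by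
  constructor
  · rintro ⟨q, hq, hqm⟩ γ hγ
    have hqm' : (Submodule.Quotient.mk q : MvPolynomial (Fin n) k ⧸ faceIdeal k Δ) = m.1 := hqm
    rw [← hqm', faceCoeff_mk]
    split_ifs with hc
    · have hle : polyDegree k β ≤ LinearMap.ker (lcoeff k (natExp γ)) := by
        refine Submodule.span_le.2 ?_
        rintro _ ⟨a, ha, rfl⟩
        rw [SetLike.mem_coe, LinearMap.mem_ker, lcoeff_apply, coeff_monomial, if_neg]
        rintro rfl
        apply hγ
        funext i
        rw [← ha i, natExp_apply]
        exact (Int.toNat_of_nonneg (hc.1 i)).symm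
      exact hle hq
    · rfl
  · intro hm
    by_cases hc : 0 ≤ β ∧ intSupport β ∈ Δ
    · refine ⟨monomial (natExp β) (faceCoeff k m.1 β), ?_, ?_⟩
      · rw [← mul_one (faceCoeff k m.1 β), ← smul_eq_mul, ← smul_monomial]
        exact Submodule.smul_mem _ _ (Submodule.subset_span
          ⟨_, fun i => Int.toNat_of_nonneg (hc.1 i), rfl⟩)
      · change (Submodule.Quotient.mk (monomial (natExp β) (faceCoeff k m.1 β)) :
          MvPolynomial (Fin n) k ⧸ faceIdeal k Δ) = m.1
        rw [← sub_eq_zero]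
        apply eq_zero_of_faceCoeff
        intro γ
        rw [sub_eq_add_neg, ← neg_one_smul k m.1, faceCoeff_add, faceCoeff_smul,
          faceCoeff_monomial β γ hc.1 hc.2]
        split_ifs with hγ
        · rw [hγ]; ring
        · rw [hm γ hγ]; ring
    · have : m = 0 := by
        apply Subtype.ext
        apply eq_zero_of_faceCoeff
        intro γ
        by_cases hγ : γ = β
        · rw [hγ]; exact if_neg hc
        · exact hm γ hγ
      rw [this]
      exact zero_mem _

end FaceCoeff
end

noncomputable section

/-! ### Coefficients of elements of localized face modules -/

section LocCoeff

variable {k : Type u} [Field k] {n : ℕ}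

theorem exists_cechMk_common {M : Type u} [AddCommGroup M] [Module (MvPolynomial (Fin n) k) M]
    {S : Finset (Fin n)} (y y' : cechLoc k M S) :
    ∃ (m m' : M) (a : ℕ), y = cechMk S m a ∧ y' = cechMk S m' a := by
  obtain ⟨m, a, rfl⟩ := exists_cechMk y
  obtain ⟨m', b, rfl⟩ := exists_cechMk y'
  refine ⟨sqfreeMonomial k S ^ b • m, sqfreeMonomial k S ^ a • m', b + a,
    (cechMk_cancel m a b).symm, ?_⟩
  rw [add_comm]
  exact (cechMk_cancel m' b a).symm

theorem base_smul_cechMk {M : Type u} [AddCommGroup M] [Module (MvPolynomial (Fin n) k) M]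
    [Module k M] [IsScalarTower k (MvPolynomial (Fin n) k) M] {S : Finset (Fin n)} (c : k) (m : M)
    (a : ℕ) : c • cechMk (k := k) S m a = cechMk S (c • m) a := by
  rw [← one_smul (MvPolynomial (Fin n) k) (cechMk S m a), ← smul_assoc, smul_cechMk, smul_assoc,
    one_smul]

variable {Δ Γ : SimplComplex n}

variable (Δ Γ) in
/-- The sets `S` such that the localization at `x^S` of the face module of `(Δ, Γ)` is nonzero
in degree `α`. -/
def IsDegreeFace (α : Fin n → ℤ) (S : Finset (Fin n)) : Prop :=
  S ∪ intSupport α ∈ Δ ∧ S ∪ intSupport α ∉ Γ ∧ ∀ i, i ∉ S → 0 ≤ α i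

/-- Well-definedness of the coefficient of a fraction `m / (x^S)^a` at `x^α`, read off at `α + a •
𝟏_S`. Both numerators are compared at the common exponent `α + (c + a + b) • 𝟏_S`. -/
theorem faceCoeff_cechMk_congr (h : Γ ≤ Δ) {S : Finset (Fin n)} {m m' : faceModule k h} {a b : ℕ}
    (hm : cechMk (k := k) S m a = cechMk S m' b) {α : Fin n → ℤ} (hα : S ∪ intSupport α ∈ Δ) :
    faceCoeff k m.1 (shiftExp S a α) = faceCoeff k m'.1 (shiftExp S b α) := by
  obtain ⟨c, hc⟩ := cechMk_eq_iff.1 hm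
  have hγ : intSupport (shiftExp S (c + a + b : ℤ) α) ∈ Δ :=
    Δ.lower (intSupport_shiftExp_subset S _ α) hα
  have := congrArg (fun m : faceModule k h => faceCoeff k m.1 (shiftExp S (c + a + b : ℤ) α)) hc
  simp only [SetLike.val_smul] at this
  rw [faceCoeff_pow_smul _ _ _ hγ, faceCoeff_pow_smul _ _ _ hγ, shiftExp_shiftExp,
    shiftExp_shiftExp] at this
  convert this using 3 <;> push_cast <;> ring

variable (k) in
open Classical in
/-- The coefficient at `x^α` of an element of the localization of a face module at `x^S`. -/
def locCoeff (h : Γ ≤ Δ) (S : Finset (Fin n)) (α : Fin n → ℤ) :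
    cechLoc k (faceModule k h) S →ₗ[k] k where
  toFun y := if S ∪ intSupport α ∈ Δ then
    faceCoeff k (exists_cechMk y).choose.1
      (shiftExp S ((exists_cechMk y).choose_spec.choose : ℕ) α) else 0
  map_add' y y' := by
    split_ifs with hα
    · obtain ⟨m, m', a, hy, hy'⟩ := exists_cechMk_common y y'
      have hs : y + y' = cechMk S (m + m') a := by rw [hy, hy', cechMk_add]
      rw [← faceCoeff_cechMk_congr h (hy.symm.trans (exists_cechMk y).choose_spec.choose_spec) hα,
        ← faceCoeff_cechMk_congr h (hy'.symm.trans (exists_cechMk y').choose_spec.choose_spec) hα,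
        ← faceCoeff_cechMk_congr h
          (hs.symm.trans (exists_cechMk (y + y')).choose_spec.choose_spec) hα]
      exact faceCoeff_add _ _ _
    · rw [add_zero]
  map_smul' c y := by
    split_ifs with hα
    · obtain ⟨m, a, hy⟩ := exists_cechMk y
      have hs : c • y = cechMk S (c • m) a := by rw [hy, base_smul_cechMk]
      rw [← faceCoeff_cechMk_congr h (hy.symm.trans (exists_cechMk y).choose_spec.choose_spec) hα,
        ← faceCoeff_cechMk_congr h
          (hs.symm.trans (exists_cechMk (c • y)).choose_spec.choose_spec) hα]
      exact faceCoeff_smul _ _ _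
    · exact (mul_zero _).symm

open Classical in
theorem locCoeff_cechMk (h : Γ ≤ Δ) (S : Finset (Fin n)) (α : Fin n → ℤ) (m : faceModule k h)
    (a : ℕ) : locCoeff k h S α (cechMk S m a) =
      if S ∪ intSupport α ∈ Δ then faceCoeff k m.1 (shiftExp S a α) else 0 := by
  refine ite_congr rfl (fun hα => ?_) fun _ => rfl
  exact (faceCoeff_cechMk_congr h (exists_cechMk (cechMk S m a)).choose_spec.choose_spec hα).symm

/-- If `S ∪ supp α` lies in `Γ`, elements of the face module have no coefficient there; a negative
entry off `S` is not cured by any denominator. -/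
theorem locCoeff_eq_zero (h : Γ ≤ Δ) {S : Finset (Fin n)} {α : Fin n → ℤ}
    (hF : ¬ IsDegreeFace Δ Γ α S) (y : cechLoc k (faceModule k h) S) : locCoeff k h S α y = 0 := by
  obtain ⟨m, a, rfl⟩ := exists_cechMk y
  rw [locCoeff_cechMk]
  split_ifs with hΔ
  · by_cases hΓ : S ∪ intSupport α ∈ Γ
    · exact (mem_faceModule_iff h _).1 m.2 _ (Γ.lower (intSupport_shiftExp_subset S _ α) hΓ)
    · have : ∃ i, i ∉ S ∧ α i < 0 := by
        by_contra! hc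
        exact hF ⟨hΔ, hΓ, hc⟩
      obtain ⟨i, hi, hα⟩ := this
      refine faceCoeff_of_neg _ (i := i) ?_
      simpa [shiftExp, hi] using hα
  · rfl

/-- The extra factor `x^S` forces every exponent `γ` that occurs to be positive on `S`, so `S ∪ supp
γ = supp γ`. Hence the coefficient of the fraction at `γ - (a + 1) • 𝟏_S` is that of the numerator.
-/
theorem faceCoeff_smul_eq_zero (h : Γ ≤ Δ) {S : Finset (Fin n)} {m : faceModule k h} {a : ℕ}
    {γ : Fin n → ℤ} (hγ : locCoeff k h S (shiftExp S (-(a + 1)) γ) (cechMk S m a) = 0) :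
    faceCoeff k (sqfreeMonomial k S ^ 1 • m.1) γ = 0 := by
  by_cases hΔ : intSupport γ ∈ Δ
  · rw [faceCoeff_pow_smul _ _ _ hΔ]
    by_cases hneg : ∃ i ∈ S, γ i ≤ 0
    · obtain ⟨i, hi, hi0⟩ := hneg
      refine faceCoeff_of_neg _ (i := i) ?_
      rw [shiftExp, if_pos hi]
      push_cast
      omega
    · push Not at hneg
      have hS : S ∪ intSupport γ = intSupport γ :=
        Finset.union_eq_right.2 fun i hi => mem_intSupport.2 (hneg i hi).ne'
      rw [locCoeff_cechMk, union_intSupport_shiftExp, hS, if_pos hΔ, shiftExp_shiftExp] at hγ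
      convert hγ using 2
      congr 1
      push_cast
      ring
  · exact faceCoeff_of_notMem _ hΔ

theorem eq_zero_of_locCoeff (h : Γ ≤ Δ) {S : Finset (Fin n)} {y : cechLoc k (faceModule k h) S}
    (hy : ∀ α, locCoeff k h S α y = 0) : y = 0 := by
  obtain ⟨m, a, rfl⟩ := exists_cechMk y
  rw [cechMk_eq_zero_iff]
  exact ⟨1, Subtype.ext (eq_zero_of_faceCoeff fun γ => faceCoeff_smul_eq_zero h (hy _))⟩

theorem finite_locCoeff (h : Γ ≤ Δ) {S : Finset (Fin n)} (y : cechLoc k (faceModule k h) S) :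
    {α | locCoeff k h S α y ≠ 0}.Finite := by
  obtain ⟨m, a, rfl⟩ := exists_cechMk y
  refine ((finite_faceCoeff m.1).preimage (shiftExp_injective S a).injOn).subset fun α hα => ?_
  rw [Set.mem_ofPred_eq, locCoeff_cechMk] at hα
  split_ifs at hα
  · exact hα
  · exact absurd rfl hα

theorem isHomogeneousLoc_iff (h : Γ ≤ Δ) (S : Finset (Fin n)) (α : Fin n → ℤ)
    (y : cechLoc k (faceModule k h) S) :
    IsHomogeneousLoc (faceModuleDegree k h) α S y ↔ ∀ β, β ≠ α → locCoeff k h S β y = 0 := by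
  constructor
  · rintro ⟨a, m, hm, hy⟩ β hβ
    have hy' : y = cechMk S m a := hy
    rw [hy', locCoeff_cechMk]
    split_ifs
    · exact (mem_faceModuleDegree_iff h _ m).1 hm _ ((shiftExp_injective S a).ne hβ)
    · rfl
  · intro hy
    obtain ⟨m, a, rfl⟩ := exists_cechMk y
    refine ⟨1 + a, sqfreeMonomial k S ^ 1 • m, ?_, (cechMk_cancel m a 1).symm⟩
    refine (mem_faceModuleDegree_iff h _ _).2 fun γ hγ => ?_
    refine faceCoeff_smul_eq_zero h (hy _ ?_)
    rintro rfl
    apply hγ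
    change γ = shiftExp S ((1 + a : ℕ) : ℤ) (shiftExp S (-(a + 1)) γ)
    rw [shiftExp_shiftExp]
    conv_lhs => rw [← shiftExp_zero S γ]
    congr 1
    push_cast
    ring

-- Restrictions preserve coefficients wherever the target is nonzero, so in each fine degree the
-- Čech differential becomes a simplicial coboundary.
open Classical in
theorem locCoeff_cechRes (h : Γ ≤ Δ) {T S : Finset (Fin n)} (hTS : T ⊆ S) (α : Fin n → ℤ)
    (y : cechLoc k (faceModule k h) T) :
    locCoeff k h S α (cechRes k _ hTS y) =
      if IsDegreeFace Δ Γ α S then locCoeff k h T α y else 0 := by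
  split_ifs with hF
  · obtain ⟨m, a, rfl⟩ := exists_cechMk y
    rw [cechRes_cechMk, locCoeff_cechMk, locCoeff_cechMk, if_pos hF.1,
      if_pos (show T ∪ intSupport α ∈ Δ from
        Δ.lower (Finset.union_subset_union_left hTS) hF.1), SetLike.val_smul,
      faceCoeff_pow_smul _ _ _ (Δ.lower (intSupport_shiftExp_subset S _ α) hF.1)]
    congr 1
    funext i
    have := @hTS i
    simp only [shiftExp, Finset.mem_sdiff]
    by_cases h1 : i ∈ S <;> by_cases h2 : i ∈ T <;> simp_all
  · exact locCoeff_eq_zero h hF _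

open Classical in
theorem exists_locCoeff_eq (h : Γ ≤ Δ) {S : Finset (Fin n)} {α : Fin n → ℤ}
    (hF : IsDegreeFace Δ Γ α S) :
    ∃ y : cechLoc k (faceModule k h) S, ∀ β, locCoeff k h S β y = if β = α then 1 else 0 := by
  -- `A` exceeds every `|α i|`, so `α + A • 𝟏_S` is positive on `S` and its support is exactly `S ∪
  -- supp α`.
  set A : ℕ := 1 + ∑ i, (α i).natAbs with hA
  have hle (i) : ((α i).natAbs : ℤ) + 1 ≤ A := by
    have := Finset.single_le_sum (f := fun i => (α i).natAbs) (fun _ _ => Nat.zero_le _)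
      (Finset.mem_univ i)
    omega
  have hpos : ∀ i ∈ S, 0 < shiftExp S A α i := by
    intro i hi
    have := hle i
    rw [shiftExp, if_pos hi]
    omega
  have h0 : 0 ≤ shiftExp S A α := by
    intro i
    by_cases hi : i ∈ S
    · exact (hpos i hi).le
    · simpa [shiftExp, hi] using hF.2.2 i hi
  have hsupp : intSupport (shiftExp S A α) = S ∪ intSupport α := by
    rw [← union_intSupport_shiftExp S A α]
    exact (Finset.union_eq_right.2 fun i hi => mem_intSupport.2 (hpos i hi).ne').symm
  have hΔ : intSupport (shiftExp S A α) ∈ Δ := hsupp ▸ hF.1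
  have hmem : (Submodule.Quotient.mk (monomial (natExp (shiftExp S A α)) (1 : k)) :
      MvPolynomial (Fin n) k ⧸ faceIdeal k Δ) ∈ faceModule k h := by
    refine (mem_faceModule_iff h _).2 fun γ hγ => ?_
    rw [faceCoeff_monomial _ _ h0 hΔ, if_neg]
    rintro rfl
    exact hF.2.1 (hsupp ▸ hγ)
  refine ⟨cechMk S ⟨_, hmem⟩ A, fun β => ?_⟩
  rw [locCoeff_cechMk]
  simp only [faceCoeff_monomial _ _ h0 hΔ, (shiftExp_injective S A).eq_iff]
  by_cases hβ : β = α
  · rw [if_pos hβ, if_pos (hβ ▸ hF.1)]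
  · rw [if_neg hβ, ite_self]

end LocCoeff
end

noncomputable section

/-! ### Relative simplicial chains and cochains -/

section RelativeCochains

variable (k : Type u) [Field k] {n : ℕ}

/-- The simplicial coboundary map, on all functions on subsets of `[n]`. -/
def coboundary : (Finset (Fin n) → k) →ₗ[k] (Finset (Fin n) → k) :=
  LinearMap.pi fun S => ∑ v ∈ S, (-1 : k) ^ (S.filter (· < v)).card • LinearMap.proj (S.erase v)

open Classical in
/-- Extension by zero of the restriction of functions to the sets which satisfy `P`. -/
def restrictTo (P : Finset (Fin n) → Prop) : (Finset (Fin n) → k) →ₗ[k] (Finset (Fin n) → k) where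
  toFun c S := if P S then c S else 0
  map_add' b c := by
    funext S
    simp only [Pi.add_apply]
    split_ifs
    · rfl
    · rw [add_zero]
  map_smul' r c := by
    funext S
    simp only [Pi.smul_apply, RingHom.id_apply]
    split_ifs
    · rfl
    · rw [smul_zero]

/-- The functions which vanish off the sets of cardinality `p` in the family `F`. -/
def faceCochains (F : Finset (Fin n) → Prop) (p : ℤ) : Submodule k (Finset (Fin n) → k) where
  carrier := {c | ∀ S : Finset (Fin n), ¬ (F S ∧ (S.card : ℤ) = p) → c S = 0}
  add_mem' hb hc S hS := by simp [hb S hS, hc S hS]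
  zero_mem' _ _ := rfl
  smul_mem' r c hc S hS := by simp [hc S hS]

/-- The coboundary map of the cochains of a family `F`. -/
def faceCoboundary (F : Finset (Fin n) → Prop) :
    (Finset (Fin n) → k) →ₗ[k] (Finset (Fin n) → k) :=
  restrictTo k F ∘ₗ coboundary k

/-- The boundary map of the chains of a family `F`. -/
def faceBoundary (F : Finset (Fin n) → Prop) :
    (Finset (Fin n) → k) →ₗ[k] (Finset (Fin n) → k) :=
  restrictTo k F ∘ₗ boundary k

variable {k}

theorem coboundary_apply (c : Finset (Fin n) → k) (S : Finset (Fin n)) :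
    coboundary k c S = ∑ v ∈ S, (-1 : k) ^ (S.filter (· < v)).card * c (S.erase v) := by
  simp [coboundary, LinearMap.pi_apply, LinearMap.sum_apply]

theorem boundary_apply (c : Finset (Fin n) → k) (T : Finset (Fin n)) :
    boundary k c T = ∑ v ∈ Tᶜ, (-1 : k) ^ (T.filter (· < v)).card * c (insert v T) := by
  simp [boundary, LinearMap.pi_apply, LinearMap.sum_apply]

open Classical in
theorem restrictTo_apply (P : Finset (Fin n) → Prop) (c : Finset (Fin n) → k)
    (S : Finset (Fin n)) : restrictTo k P c S = if P S then c S else 0 := rfl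

open Classical in
theorem faceCoboundary_apply (F : Finset (Fin n) → Prop) (c : Finset (Fin n) → k)
    (S : Finset (Fin n)) : faceCoboundary k F c S = if F S then coboundary k c S else 0 := rfl

open Classical in
theorem faceBoundary_apply (F : Finset (Fin n) → Prop) (c : Finset (Fin n) → k)
    (S : Finset (Fin n)) : faceBoundary k F c S = if F S then boundary k c S else 0 := rfl

theorem filter_lt_erase (S : Finset (Fin n)) (v : Fin n) :
    (S.erase v).filter (· < v) = S.filter (· < v) := by
  ext w
  simp only [Finset.mem_filter, Finset.mem_erase]
  exact ⟨fun h => ⟨h.1.2, h.2⟩, fun h => ⟨⟨h.2.ne, h.1⟩, h.2⟩⟩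

/-- Both sides sum over incidences, matched by `(S, v) ↦ (S \ {v}, v)`. The signs agree since
removing `v` does not change the elements below `v`. -/
theorem dotProduct_coboundary (b c : Finset (Fin n) → k) :
    b ⬝ᵥ coboundary k c = boundary k b ⬝ᵥ c := by
  simp only [dotProduct, coboundary_apply, boundary_apply, Finset.mul_sum, Finset.sum_mul]
  rw [Finset.sum_sigma', Finset.sum_sigma']
  refine Finset.sum_bij' (fun x _ => ⟨x.1.erase x.2, x.2⟩) (fun x _ => ⟨insert x.2 x.1, x.2⟩)
    ?_ ?_ ?_ ?_ ?_
  · rintro ⟨S, v⟩ _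
    simp
  · rintro ⟨S, v⟩ _
    simp
  · rintro ⟨S, v⟩ h
    simp only [Finset.mem_sigma, Finset.mem_univ, true_and] at h
    simp only [Finset.insert_erase h]
  · rintro ⟨T, v⟩ h
    simp only [Finset.mem_sigma, Finset.mem_univ, true_and, Finset.mem_compl] at h
    simp only [Finset.erase_insert h]
  · rintro ⟨S, v⟩ h
    simp only [Finset.mem_sigma, Finset.mem_univ, true_and] at h
    simp only [filter_lt_erase, Finset.insert_erase h]
    ring

theorem restrictTo_dotProduct (P : Finset (Fin n) → Prop) (b c : Finset (Fin n) → k) :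
    restrictTo k P b ⬝ᵥ c = b ⬝ᵥ restrictTo k P c := by
  refine Finset.sum_congr rfl fun S _ => ?_
  rw [restrictTo_apply, restrictTo_apply]
  split_ifs
  · rfl
  · rw [zero_mul, mul_zero]

/-- Adjoint maps have transposed matrices, and row rank equals column rank. -/
theorem finrank_range_eq_of_dotProduct {ι : Type*} [Fintype ι] [DecidableEq ι]
    (f g : (ι → k) →ₗ[k] (ι → k)) (h : ∀ b c, b ⬝ᵥ f c = g b ⬝ᵥ c) :
    Module.finrank k (LinearMap.range f) = Module.finrank k (LinearMap.range g) := by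
  have hm : LinearMap.toMatrix' g = (LinearMap.toMatrix' f).transpose := by
    ext i j
    have := h (Pi.single j 1) (Pi.single i 1)
    rw [single_one_dotProduct, dotProduct_single_one] at this
    rw [Matrix.transpose_apply, LinearMap.toMatrix'_apply, LinearMap.toMatrix'_apply]
    convert this.symm using 2
  have hf : LinearMap.range f = LinearMap.range (LinearMap.toMatrix' f).mulVecLin := by
    rw [← Matrix.toLin'_apply', Matrix.toLin'_toMatrix']
  have hg : LinearMap.range g = LinearMap.range (LinearMap.toMatrix' g).mulVecLin := by
    rw [← Matrix.toLin'_apply', Matrix.toLin'_toMatrix']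
  rw [hf, hg, hm]
  exact (Matrix.rank_transpose _).symm

theorem map_faceCochains {F : Finset (Fin n) → Prop} {p : ℤ}
    (f : (Finset (Fin n) → k) →ₗ[k] (Finset (Fin n) → k)) :
    (faceCochains k F p).map f =
      LinearMap.range (f ∘ₗ restrictTo k fun S => F S ∧ (S.card : ℤ) = p) := by
  rw [LinearMap.range_comp]
  congr 1
  ext c
  constructor
  · intro hc
    refine ⟨c, funext fun S => ?_⟩
    rw [restrictTo_apply]
    split_ifs with hS
    · rfl
    · exact (hc S hS).symm
  · rintro ⟨b, rfl⟩ S hS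
    exact if_neg hS

theorem dotProduct_faceCoboundary (F : Finset (Fin n) → Prop) (p : ℤ) (b c : Finset (Fin n) → k) :
    b ⬝ᵥ (faceCoboundary k F ∘ₗ restrictTo k fun S => F S ∧ (S.card : ℤ) = p) c =
      (faceBoundary k F ∘ₗ restrictTo k fun S => F S ∧ (S.card : ℤ) = p + 1) b ⬝ᵥ c := by
  simp only [LinearMap.comp_apply, faceCoboundary]
  rw [← restrictTo_dotProduct, dotProduct_coboundary, ← restrictTo_dotProduct]
  congr 1
  funext T
  rw [faceBoundary_apply, restrictTo_apply, boundary_apply, boundary_apply]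
  by_cases hF : F T
  · by_cases hT : (T.card : ℤ) = p
    · rw [if_pos ⟨hF, hT⟩, if_pos hF]
      refine Finset.sum_congr rfl fun v hv => ?_
      rw [restrictTo_apply, restrictTo_apply,
        Finset.card_insert_of_notMem (Finset.mem_compl.1 hv)]
      congr 1
      have hp : ((T.card + 1 : ℕ) : ℤ) = p + 1 := by
        push_cast
        rw [hT]
      by_cases hv' : F (insert v T)
      · rw [if_pos hv', if_pos ⟨hv', hp⟩]
      · rw [if_neg hv', if_neg fun h => hv' h.1]
    · rw [if_neg fun h => hT h.2, if_pos hF]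
      refine (Finset.sum_eq_zero fun v hv => ?_).symm
      rw [restrictTo_apply, Finset.card_insert_of_notMem (Finset.mem_compl.1 hv), if_neg, mul_zero]
      push_cast
      simp [hT]
  · rw [if_neg fun h => hF h.1, if_neg hF]

theorem finrank_map_faceBoundary (F : Finset (Fin n) → Prop) (p : ℤ) :
    Module.finrank k ((faceCochains k F (p + 1)).map (faceBoundary k F)) =
      Module.finrank k ((faceCochains k F p).map (faceCoboundary k F)) := by
  rw [map_faceCochains, map_faceCochains]
  exact (finrank_range_eq_of_dotProduct _ _ (dotProduct_faceCoboundary F p)).symm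

theorem faceCoboundary_mem {F : Finset (Fin n) → Prop} {p : ℤ} {c : Finset (Fin n) → k}
    (hc : c ∈ faceCochains k F p) : faceCoboundary k F c ∈ faceCochains k F (p + 1) := by
  intro S hS
  rw [faceCoboundary_apply]
  split_ifs with hF
  · rw [coboundary_apply]
    refine Finset.sum_eq_zero fun v hv => ?_
    rw [hc, mul_zero]
    rintro ⟨-, h⟩
    refine hS ⟨hF, ?_⟩
    rw [← h, ← Finset.card_erase_add_one hv]
    push_cast
    ring
  · rfl

theorem faceBoundary_mem {F : Finset (Fin n) → Prop} {p : ℤ} {c : Finset (Fin n) → k}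
    (hc : c ∈ faceCochains k F (p + 1)) : faceBoundary k F c ∈ faceCochains k F p := by
  intro S hS
  rw [faceBoundary_apply]
  split_ifs with hF
  · rw [boundary_apply]
    refine Finset.sum_eq_zero fun v hv => ?_
    rw [hc, mul_zero]
    rintro ⟨-, h⟩
    refine hS ⟨hF, ?_⟩
    rw [Finset.card_insert_of_notMem (Finset.mem_compl.1 hv)] at h
    push_cast at h
    linarith
  · rfl

/-- A face boundary map squares to zero if the coboundary map does. -/
theorem faceBoundary_faceBoundary {F : Finset (Fin n) → Prop} {p : ℤ}
    (h : ∀ c ∈ faceCochains k F (p - 1), faceCoboundary k F (faceCoboundary k F c) = 0)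
    {c : Finset (Fin n) → k} (hc : c ∈ faceCochains k F (p + 1)) :
    faceBoundary k F (faceBoundary k F c) = 0 := by
  have hr {q : ℤ} {b : Finset (Fin n) → k} (hb : b ∈ faceCochains k F q) :
      restrictTo k (fun S => F S ∧ (S.card : ℤ) = q) b = b := by
    funext S
    rw [restrictTo_apply]
    split_ifs with hS
    · rfl
    · exact (hb S hS).symm
  apply dotProduct_eq_zero
  intro x
  have hx : restrictTo k (fun S => F S ∧ (S.card : ℤ) = p - 1) x ∈ faceCochains k F (p - 1) :=
    fun S hS => if_neg hS
  have h1 := dotProduct_faceCoboundary F (p - 1) (faceBoundary k F c) x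
  have h2 := dotProduct_faceCoboundary F p c
    (faceCoboundary k F (restrictTo k (fun S => F S ∧ (S.card : ℤ) = p - 1) x))
  have h3 := faceCoboundary_mem hx
  simp only [LinearMap.comp_apply, sub_add_cancel] at h1 h2 h3
  rw [hr (faceBoundary_mem hc)] at h1
  rw [hr hc, hr h3, h _ hx, dotProduct_zero] at h2
  rw [← h1, ← h2]

/-- The cochains of a family of sets which is stable under adding and removing `j` are exact. -/
theorem exists_faceCoboundary_eq {F : Finset (Fin n) → Prop} (j : Fin n)
    (hj : ∀ S, j ∉ S → (F (insert j S) ↔ F S)) {p : ℤ} {z : Finset (Fin n) → k}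
    (hz : z ∈ faceCochains k F p) (hz0 : faceCoboundary k F z = 0) :
    ∃ g ∈ faceCochains k F (p - 1), faceCoboundary k F g = z := by
  -- The cone homotopy with apex `j`.
  refine ⟨fun S => if j ∈ S then 0 else (-1) ^ (S.filter (· < j)).card * z (insert j S), ?_, ?_⟩
  · intro S hS
    simp only
    split_ifs with hjS
    · rfl
    · rw [hz, mul_zero]
      rintro ⟨h1, h2⟩
      refine hS ⟨(hj S hjS).1 h1, ?_⟩
      rw [Finset.card_insert_of_notMem hjS] at h2
      push_cast at h2
      linarith
  · funext S
    rw [faceCoboundary_apply]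
    split_ifs with hF
    · rw [coboundary_apply]
      by_cases hjS : j ∈ S
      · rw [Finset.sum_eq_single_of_mem j hjS]
        · rw [if_neg (Finset.notMem_erase j S), filter_lt_erase, Finset.insert_erase hjS,
            ← mul_assoc, neg_one_pow_mul_self, one_mul]
        · intro v _ hv
          rw [if_pos (Finset.mem_erase.2 ⟨hv.symm, hjS⟩), mul_zero]
      -- For `j ∉ S`, the cocycle condition at `insert j S` expresses `z S` through the values of
      -- `z` on sets containing `j`.
      · have h1 := congrFun hz0 (insert j S)
        rw [faceCoboundary_apply, if_pos ((hj S hjS).2 hF), coboundary_apply, Pi.zero_apply,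
          Finset.sum_insert hjS, Finset.erase_insert hjS, ← filter_lt_erase,
          Finset.erase_insert hjS] at h1
        have h2 : z S = -((-1) ^ (S.filter (· < j)).card * ∑ v ∈ S,
            (-1) ^ ((insert j S).filter (· < v)).card * z ((insert j S).erase v)) := by
          linear_combination (-1) ^ (S.filter (· < j)).card * h1 -
            z S * neg_one_pow_mul_self (R := k) (S.filter (· < j)).card
        rw [h2, Finset.mul_sum, ← Finset.sum_neg_distrib]
        refine Finset.sum_congr rfl fun v hv => ?_
        have hvj : v ≠ j := fun h => hjS (h ▸ hv)
        rw [if_neg fun h => hjS (Finset.mem_of_mem_erase h),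
          Finset.erase_insert_of_ne hvj.symm]
        have h3 := sign_erase_comm (A := k) (Finset.mem_insert_of_mem hv)
          (Finset.mem_insert_self j S) hvj
        rw [Finset.erase_insert hjS, ← filter_lt_erase (insert j S) j, Finset.erase_insert hjS,
          Finset.erase_insert_of_ne hvj.symm, ← filter_lt_erase (insert j (S.erase v)),
          Finset.erase_insert fun h => hjS (Finset.mem_of_mem_erase h)] at h3
        have h4 := neg_one_pow_mul_self (R := k) ((S.erase v).filter (· < j)).card
        have h5 := neg_one_pow_mul_self (R := k) (S.filter (· < j)).card
        generalize (-1 : k) ^ ((S.erase v).filter (· < j)).card = B at *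
        generalize (-1 : k) ^ (S.filter (· < j)).card = C at *
        generalize (-1 : k) ^ (S.filter (· < v)).card = A at *
        generalize (-1 : k) ^ ((insert j S).filter (· < v)).card = D at *
        linear_combination z (insert j (S.erase v)) * (C * B * h3 - A * B * h5 - C * D * h4)
    · exact (hz S fun h => hF h.1).symm

end RelativeCochains
end

noncomputable section

/-! ### Relative homology of links -/

section LinkHomology

variable {k : Type u} [Field k] {n : ℕ}

variable (k) in
/-- The sign of the shuffle which sorts the concatenation of `σ` and a set `τ` disjoint from `σ`. -/
def linkSign (σ τ : Finset (Fin n)) : k := ∏ v ∈ τ, (-1) ^ (σ.filter (· < v)).card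

theorem linkSign_mul_self (σ τ : Finset (Fin n)) : linkSign k σ τ * linkSign k σ τ = 1 := by
  rw [linkSign, ← Finset.prod_mul_distrib]
  exact Finset.prod_eq_one fun v _ => neg_one_pow_mul_self _

variable (k) in
open Classical in
/-- The map which sends a chain of the star of `σ` to a chain of the link of `σ`. -/
def linkMap (σ : Finset (Fin n)) : (Finset (Fin n) → k) →ₗ[k] (Finset (Fin n) → k) where
  toFun c τ := if Disjoint σ τ then linkSign k σ τ * c (σ ∪ τ) else 0
  map_add' b c := by
    funext τ
    simp only [Pi.add_apply]
    split_ifs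
    · rw [mul_add]
    · rw [add_zero]
  map_smul' r c := by
    funext τ
    simp only [Pi.smul_apply, RingHom.id_apply, smul_eq_mul]
    split_ifs
    · ring
    · rw [mul_zero]

open Classical in
theorem linkMap_apply (σ : Finset (Fin n)) (c : Finset (Fin n) → k) (τ : Finset (Fin n)) :
    linkMap k σ c τ = if Disjoint σ τ then linkSign k σ τ * c (σ ∪ τ) else 0 := rfl

/-- Adding `v` to `ρ` changes the shuffle sign by the parity of the elements of `σ` below `v`,
exactly the discrepancy between the signs of `v` relative to `ρ` and to `σ ∪ ρ`. -/
theorem boundary_linkMap (σ : Finset (Fin n)) (c : Finset (Fin n) → k) :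
    boundary k (linkMap k σ c) = linkMap k σ (boundary k c) := by
  funext ρ
  rw [boundary_apply, linkMap_apply]
  split_ifs with hρ
  · rw [boundary_apply, Finset.mul_sum]
    symm
    apply Finset.sum_subset_zero_on_sdiff
    · exact Finset.compl_subset_compl.2 Finset.subset_union_right
    · intro v hv
      simp only [Finset.mem_sdiff, Finset.mem_compl, Finset.mem_union, not_or, not_and,
        not_not] at hv
      have hvσ : v ∈ σ := by
        by_contra h
        exact hv.1 (hv.2 h)
      rw [linkMap_apply, if_neg, mul_zero]
      exact fun h => Finset.disjoint_left.1 h hvσ (Finset.mem_insert_self v ρ)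
    · intro v hv
      simp only [Finset.mem_compl, Finset.mem_union, not_or] at hv
      rw [linkMap_apply, if_pos (Finset.disjoint_insert_right.2 ⟨hv.1, hρ⟩),
        Finset.union_insert, linkSign, linkSign, Finset.prod_insert hv.2, Finset.filter_union,
        Finset.card_union_of_disjoint (Finset.disjoint_filter_filter hρ), pow_add]
      ring
  · refine Finset.sum_eq_zero fun v _ => ?_
    rw [linkMap_apply, if_neg, mul_zero]
    exact fun h => hρ (h.mono_right (Finset.subset_insert v ρ))

theorem boundary_eq_zero_of_notMem {Δ : SimplComplex n} {c : Finset (Fin n) → k}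
    (hc : ∀ τ, τ ∉ Δ → c τ = 0) {τ : Finset (Fin n)} (hτ : τ ∉ Δ) : boundary k c τ = 0 := by
  rw [boundary_apply]
  refine Finset.sum_eq_zero fun v _ => ?_
  rw [hc, mul_zero]
  exact fun h => hτ (Δ.lower (Finset.subset_insert v τ) h)

theorem boundary_mem_simplicialChains {Δ : SimplComplex n} {j : ℤ} {c : Finset (Fin n) → k}
    (hc : c ∈ simplicialChains k Δ j) : boundary k c ∈ simplicialChains k Δ (j - 1) := by
  intro τ hτ
  by_cases hΔ : τ ∈ Δ
  · rw [boundary_apply]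
    refine Finset.sum_eq_zero fun v hv => ?_
    rw [hc, mul_zero]
    rintro ⟨-, h⟩
    refine hτ ⟨hΔ, ?_⟩
    rw [faceDim, Finset.card_insert_of_notMem (Finset.mem_compl.1 hv)] at h
    rw [faceDim]
    push_cast at h
    linarith
  · exact boundary_eq_zero_of_notMem (fun τ hτ => hc τ fun h => hτ h.1) hΔ

variable (Δ Γ : SimplComplex n) (σ : Finset (Fin n))

/-- The faces of `Δ` which contain `σ` and are not in `Γ`. -/
def IsStarFace (S : Finset (Fin n)) : Prop := σ ⊆ S ∧ S ∈ Δ ∧ S ∉ Γ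

variable {Δ Γ σ}

theorem mem_link {τ : Finset (Fin n)} : τ ∈ Δ.link σ ↔ Disjoint σ τ ∧ σ ∪ τ ∈ Δ :=
  ⟨fun h => h.2, fun h => ⟨Δ.lower Finset.subset_union_right h.2, h⟩⟩

theorem isStarFace_union {τ : Finset (Fin n)} (hτ : τ ∈ Δ.link σ) (hτΓ : τ ∉ Γ.link σ) :
    IsStarFace Δ Γ σ (σ ∪ τ) :=
  ⟨Finset.subset_union_left, (mem_link.1 hτ).2, fun h => hτΓ (mem_link.2 ⟨(mem_link.1 hτ).1, h⟩)⟩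

theorem IsStarFace.sdiff {S : Finset (Fin n)} (hS : IsStarFace Δ Γ σ S) :
    S \ σ ∈ Δ.link σ ∧ S \ σ ∉ Γ.link σ ∧ σ ∪ S \ σ = S := by
  have h : σ ∪ S \ σ = S := Finset.union_sdiff_of_subset hS.1
  refine ⟨?_, ?_, h⟩
  · rw [mem_link, h]
    exact ⟨Finset.disjoint_sdiff, hS.2.1⟩
  · rw [mem_link, h]
    exact fun h => hS.2.2 h.2

theorem faceDim_eq_iff {τ : Finset (Fin n)} (hτ : Disjoint σ τ) {p : ℤ} :
    faceDim τ = p - faceDim σ - 2 ↔ ((σ ∪ τ).card : ℤ) = p := by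
  rw [Finset.card_union_of_disjoint hτ, faceDim, faceDim]
  push_cast
  constructor <;> intro h <;> linarith

theorem linkMap_mem {p : ℤ} {c : Finset (Fin n) → k}
    (hc : c ∈ faceCochains k (IsStarFace Δ Γ σ) p) :
    linkMap k σ c ∈ simplicialChains k (Δ.link σ) (p - faceDim σ - 2) := by
  intro τ hτ
  rw [linkMap_apply]
  split_ifs with h
  · rw [hc, mul_zero]
    rintro ⟨hF, hp⟩
    exact hτ ⟨mem_link.2 ⟨h, hF.2.1⟩, (faceDim_eq_iff h).2 hp⟩
  · rfl

theorem linkMap_eq_of_isStarFace {S : Finset (Fin n)} (hS : IsStarFace Δ Γ σ S)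
    (c : Finset (Fin n) → k) : linkMap k σ c (S \ σ) = linkSign k σ (S \ σ) * c S := by
  rw [linkMap_apply, if_pos Finset.disjoint_sdiff, hS.sdiff.2.2]

/-- Every chain of the link of `σ` in `Δ` comes, up to chains of the link of `σ` in `Γ`, from a
chain on the faces of `Δ` which contain `σ` and are not in `Γ`. -/
theorem exists_linkMap_sub_mem {p : ℤ} {w : Finset (Fin n) → k}
    (hw : w ∈ simplicialChains k (Δ.link σ) (p - faceDim σ - 2)) :
    ∃ b ∈ faceCochains k (IsStarFace Δ Γ σ) p,
      w - linkMap k σ b ∈ simplicialChains k (Γ.link σ) (p - faceDim σ - 2) := by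
  classical
  refine ⟨fun S => if IsStarFace Δ Γ σ S then linkSign k σ (S \ σ) * w (S \ σ) else 0, ?_, ?_⟩
  · intro S hS
    simp only
    split_ifs with hF
    · rw [hw, mul_zero]
      rintro ⟨-, h⟩
      rw [faceDim_eq_iff Finset.disjoint_sdiff, hF.sdiff.2.2] at h
      exact hS ⟨hF, h⟩
    · rfl
  · intro τ hτ
    rw [Pi.sub_apply, linkMap_apply]
    by_cases hd : Disjoint σ τ
    · rw [if_pos hd, Finset.union_sdiff_cancel_left hd]
      split_ifs with hF
      · rw [← mul_assoc, linkSign_mul_self, one_mul, sub_self]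
      · rw [mul_zero, sub_zero]
        apply hw
        rintro ⟨h1, h2⟩
        exact hF (isStarFace_union h1 fun h => hτ ⟨h, h2⟩)
    · rw [if_neg hd, sub_zero]
      exact hw _ fun h => hd (mem_link.1 h.1).1

/-- The correction is supported on the link in `Γ`, so its boundary vanishes at `S \ σ`, which is
not in that link. -/
theorem boundary_eq_of_sub_mem {j : ℤ} {w b : Finset (Fin n) → k}
    (h : w - linkMap k σ b ∈ simplicialChains k (Γ.link σ) j) {S : Finset (Fin n)}
    (hS : IsStarFace Δ Γ σ S) :
    boundary k w (S \ σ) = linkSign k σ (S \ σ) * boundary k b S := by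
  rw [← linkMap_eq_of_isStarFace hS, ← boundary_linkMap, ← sub_eq_zero, ← Pi.sub_apply, ← map_sub]
  exact boundary_eq_zero_of_notMem (fun τ hτ => h τ fun h => hτ h.1) hS.sdiff.2.1

/-- `linkMap` commutes with the full boundary. On the link in `Δ`, the face boundary discards only
coefficients that correspond to faces of the link in `Γ`. -/
theorem linkMap_boundary_sub_mem {p : ℤ} {c : Finset (Fin n) → k}
    (hc : c ∈ faceCochains k (IsStarFace Δ Γ σ) (p + 1)) :
    boundary k (linkMap k σ c) - linkMap k σ (faceBoundary k (IsStarFace Δ Γ σ) c) ∈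
      simplicialChains k (Γ.link σ) (p - faceDim σ - 2) := by
  have h1 := boundary_mem_simplicialChains (linkMap_mem hc)
  have h2 := linkMap_mem (faceBoundary_mem hc)
  intro τ hτ
  by_cases hΔ : τ ∈ Δ.link σ ∧ faceDim τ = p - faceDim σ - 2
  · have hτΓ : τ ∉ Γ.link σ := fun h => hτ ⟨h, hΔ.2⟩
    rw [Pi.sub_apply, boundary_linkMap, linkMap_apply, linkMap_apply, faceBoundary_apply,
      if_pos (isStarFace_union hΔ.1 hτΓ), sub_self]
  · rw [Pi.sub_apply, h2 τ hΔ, h1 τ fun h => hΔ ⟨h.1, by linarith [h.2]⟩, sub_zero]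

/-- `linkMap` identifies chains on the relative star with chains of the link in `Δ` modulo those of
the link in `Γ`; kernel and image are computed by correcting with chains of the latter. -/
theorem nonempty_relHomology_equiv (p : ℤ) :
    Nonempty ((↥(faceCochains k (IsStarFace Δ Γ σ) p ⊓
        LinearMap.ker (faceBoundary k (IsStarFace Δ Γ σ))) ⧸
      ((faceCochains k (IsStarFace Δ Γ σ) (p + 1)).map
        (faceBoundary k (IsStarFace Δ Γ σ))).submoduleOf
        (faceCochains k (IsStarFace Δ Γ σ) p ⊓
          LinearMap.ker (faceBoundary k (IsStarFace Δ Γ σ)))) ≃ₗ[k]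
      relHomology k (Δ.link σ) (Γ.link σ) (p - faceDim σ - 2)) := by
  set F := IsStarFace Δ Γ σ with hFdef
  set Z := faceCochains k F p ⊓ LinearMap.ker (faceBoundary k F) with hZ
  set j := p - faceDim σ - 2 with hj
  have hcyc : ∀ c ∈ Z, linkMap k σ c ∈ relCycles k (Δ.link σ) (Γ.link σ) j := by
    rintro c ⟨hc, hc0⟩
    refine ⟨linkMap_mem hc, ?_⟩
    have h := linkMap_boundary_sub_mem (p := p - 1) (c := c) (by rwa [sub_add_cancel])
    rw [← hFdef, LinearMap.mem_ker.1 hc0, map_zero, sub_zero] at h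
    have e : p - 1 - faceDim σ - 2 = j - 1 := by rw [hj]; ring
    rwa [e] at h
  let Φ : Z →ₗ[k] relHomology k (Δ.link σ) (Γ.link σ) j :=
    (Submodule.mkQ _) ∘ₗ ((linkMap k σ).restrict hcyc)
  have hker : LinearMap.ker Φ =
      ((faceCochains k F (p + 1)).map (faceBoundary k F)).submoduleOf Z := by
    ext ⟨c, hc⟩
    have h1 : (⟨c, hc⟩ : Z) ∈ LinearMap.ker Φ ↔
        linkMap k σ c ∈ relBoundaries k (Δ.link σ) (Γ.link σ) j :=
      Submodule.Quotient.mk_eq_zero _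
    have e : j + 1 = p + 1 - faceDim σ - 2 := by rw [hj]; ring
    rw [h1, relBoundaries, e]
    change _ ↔ c ∈ (faceCochains k F (p + 1)).map (faceBoundary k F)
    constructor
    · intro h
      obtain ⟨_, ⟨w, hw, rfl⟩, u, hu, hwu⟩ := Submodule.mem_sup.1 h
      obtain ⟨b, hb, hwb⟩ := exists_linkMap_sub_mem (Γ := Γ) hw
      refine ⟨b, hb, funext fun S => ?_⟩
      rw [faceBoundary_apply]
      split_ifs with hS
      · have h2 := boundary_eq_of_sub_mem hwb hS
        have h3 := congrFun hwu (S \ σ)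
        rw [Pi.add_apply, hu _ fun h => hS.sdiff.2.1 h.1, add_zero, linkMap_eq_of_isStarFace hS,
          h2] at h3
        have h4 := linkSign_mul_self (k := k) σ (S \ σ)
        linear_combination linkSign k σ (S \ σ) * h3 + (c S - boundary k b S) * h4
      · exact (hc.1 S fun h => hS h.1).symm
    · rintro ⟨b, hb, hbc⟩
      change faceBoundary k F b = c at hbc
      subst hbc
      rw [← sub_sub_cancel (boundary k (linkMap k σ b)) (linkMap k σ (faceBoundary k F b))]
      exact sub_mem (Submodule.mem_sup_left ⟨_, linkMap_mem hb, rfl⟩)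
        (Submodule.mem_sup_right (linkMap_boundary_sub_mem hb))
  have hsurj : Function.Surjective Φ := by
    intro x
    obtain ⟨⟨z, hz⟩, rfl⟩ := Submodule.Quotient.mk_surjective _ x
    obtain ⟨b, hb, hzb⟩ := exists_linkMap_sub_mem (Γ := Γ) hz.1
    have hbZ : b ∈ Z := by
      refine ⟨hb, LinearMap.mem_ker.2 (funext fun S => ?_)⟩
      rw [faceBoundary_apply]
      split_ifs with hS
      · have h2 := boundary_eq_of_sub_mem hzb hS
        have h3 : boundary k z (S \ σ) = 0 := hz.2 _ fun h => hS.sdiff.2.1 h.1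
        have h4 := linkSign_mul_self (k := k) σ (S \ σ)
        rw [Pi.zero_apply]
        linear_combination linkSign k σ (S \ σ) * (h3 - h2) - boundary k b S * h4
      · rfl
    refine ⟨⟨b, hbZ⟩, ((Submodule.Quotient.eq _).2 ?_).symm⟩
    exact Submodule.mem_sup_right hzb
  rw [← hker]
  exact ⟨Φ.quotKerEquivOfSurjective hsurj⟩

theorem finrank_quotient_submoduleOf {V : Type*} [AddCommGroup V] [Module k V]
    [FiniteDimensional k V] {B Z : Submodule k V} (h : B ≤ Z) :
    Module.finrank k (Z ⧸ B.submoduleOf Z) + Module.finrank k B = Module.finrank k Z := by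
  rw [← (Submodule.submoduleOfEquivOfLe h).finrank_eq]
  exact Submodule.finrank_quotient_add_finrank _

theorem finrank_inf_ker {V : Type*} [AddCommGroup V] [Module k V] [FiniteDimensional k V]
    (f : V →ₗ[k] V) (K : Submodule k V) :
    Module.finrank k ↥(K ⊓ LinearMap.ker f) + Module.finrank k (K.map f) =
      Module.finrank k K := by
  have h1 := LinearMap.finrank_range_add_finrank_ker (f.domRestrict K)
  rw [LinearMap.range_domRestrict, LinearMap.ker_domRestrict] at h1
  rw [← h1, add_comm]
  congr 1
  exact ((Submodule.equivSubtypeMap K _).trans (LinearEquiv.ofEq _ _ (by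
    rw [Submodule.map_comap_subtype]))).finrank_eq.symm

/-- The relative homology of a link is dual to the cohomology of the relative star. -/
theorem finrank_relHomology_link (p : ℤ)
    (h : ∀ q, ∀ c ∈ faceCochains k (IsStarFace Δ Γ σ) q,
      faceCoboundary k (IsStarFace Δ Γ σ) (faceCoboundary k (IsStarFace Δ Γ σ) c) = 0) :
    Module.finrank k (relHomology k (Δ.link σ) (Γ.link σ) (p - faceDim σ - 2)) =
      Module.finrank k (↥(faceCochains k (IsStarFace Δ Γ σ) p ⊓
          LinearMap.ker (faceCoboundary k (IsStarFace Δ Γ σ))) ⧸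
        ((faceCochains k (IsStarFace Δ Γ σ) (p - 1)).map
          (faceCoboundary k (IsStarFace Δ Γ σ))).submoduleOf
          (faceCochains k (IsStarFace Δ Γ σ) p ⊓
            LinearMap.ker (faceCoboundary k (IsStarFace Δ Γ σ)))) := by
  obtain ⟨e⟩ := nonempty_relHomology_equiv (k := k) (Δ := Δ) (Γ := Γ) (σ := σ) p
  rw [← e.finrank_eq]
  set F := IsStarFace Δ Γ σ
  have h1 : (faceCochains k F (p + 1)).map (faceBoundary k F) ≤
      faceCochains k F p ⊓ LinearMap.ker (faceBoundary k F) := by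
    rintro _ ⟨c, hc, rfl⟩
    exact ⟨faceBoundary_mem hc, faceBoundary_faceBoundary (h (p - 1)) hc⟩
  have h2 : (faceCochains k F (p - 1)).map (faceCoboundary k F) ≤
      faceCochains k F p ⊓ LinearMap.ker (faceCoboundary k F) := by
    rintro _ ⟨c, hc, rfl⟩
    have := faceCoboundary_mem hc
    rw [sub_add_cancel] at this
    exact ⟨this, h _ c hc⟩
  -- Both dimensions equal that of the cochains in degree `p` minus the ranks of the coboundaries
  -- leaving and entering that degree.
  have a1 := finrank_quotient_submoduleOf h1
  have a2 := finrank_quotient_submoduleOf h2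
  have b1 := finrank_inf_ker (faceBoundary k F) (faceCochains k F p)
  have b2 := finrank_inf_ker (faceCoboundary k F) (faceCochains k F p)
  have c1 := finrank_map_faceBoundary (k := k) F p
  have c2 := finrank_map_faceBoundary (k := k) F (p - 1)
  rw [sub_add_cancel] at c2
  omega

end LinkHomology
end

noncomputable section

/-! ### The fine grading of the Čech cohomology of a face module -/

/-! ### Subspaces and decompositions transported from images -/

section LinearAlgebra

variable {k V N Q : Type*} [Field k] [AddCommGroup V] [Module k V] [AddCommGroup N] [Module k N]
variable [AddCommGroup Q] [Module k Q]

theorem nonempty_comap_range_equiv (f : V →ₗ[k] Q) (e : N ≃ₗ[k] Q) :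
    Nonempty ((LinearMap.range f).comap e.toLinearMap ≃ₗ[k] V ⧸ LinearMap.ker f) :=
  ⟨e.ofSubmodule' _ ≪≫ₗ f.quotKerEquivRange.symm⟩

/-- Independence is required of the images only, so the `f i` may have kernels; here these will be
coboundaries. -/
theorem isInternal_comap_range {ι : Type*} [DecidableEq ι] {D : ι → Type*}
    [∀ i, AddCommGroup (D i)] [∀ i, Module k (D i)] (f : ∀ i, D i →ₗ[k] Q) (e : N ≃ₗ[k] Q)
    (hind : ∀ (s : Finset ι) (c : ∀ i, D i), ∑ i ∈ s, f i (c i) = 0 → ∀ i ∈ s, f i (c i) = 0)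
    (hsum : ∀ q, ∃ (s : Finset ι) (c : ∀ i, D i), q = ∑ i ∈ s, f i (c i)) :
    DirectSum.IsInternal fun i => (LinearMap.range (f i)).comap e.toLinearMap := by
  refine DirectSum.isInternal_submodule_of_iSupIndep_of_iSup_eq_top ?_ ?_
  · rw [iSupIndep_iff_finsetSum_eq_zero_imp_eq_zero]
    intro s x hx hx0 j hj
    choose! c hc using hx
    rw [← e.map_eq_zero_iff]
    refine (hc j hj).symm.trans (hind s c ?_ j hj)
    rw [Finset.sum_congr rfl hc, ← map_zero e, ← hx0, map_sum]
    rfl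
  · rw [eq_top_iff]
    rintro x -
    obtain ⟨s, c, hsc⟩ := hsum (e x)
    rw [← e.symm_apply_apply x, hsc, map_sum]
    refine sum_mem fun i _ => Submodule.mem_iSup_of_mem i ⟨c i, ?_⟩
    exact (e.apply_symm_apply _).symm

end LinearAlgebra

section CechClass

variable {k : Type u} [Field k] {n : ℕ}
variable {M : Type u} [AddCommGroup M] [Module (MvPolynomial (Fin n) k) M]

/-- The cohomology class of a Čech cocycle. -/
def cechClass (i : ℕ) : cechCocycles k n M i →+ CechCohomology k n M i :=
  (Submodule.mkQ _).toAddMonoidHom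

theorem cechClass_eq_zero_iff {i : ℕ} (z : cechCocycles k n M i) :
    cechClass i z = 0 ↔ z.1 ∈ cechCoboundaries k n M i :=
  Submodule.Quotient.mk_eq_zero _

theorem cechClass_surjective (i : ℕ) :
    Function.Surjective (cechClass (k := k) (n := n) (M := M) i) :=
  Submodule.mkQ_surjective _

theorem smul_cechClass {i : ℕ} (r : MvPolynomial (Fin n) k) (z : cechCocycles k n M i) :
    r • cechClass i z = cechClass i (r • z) := rfl

theorem base_smul_cechClass [Module k M] [IsScalarTower k (MvPolynomial (Fin n) k) M] {i : ℕ}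
    (r : k) (z : cechCocycles k n M i) : r • cechClass i z = cechClass i (r • z) := rfl

theorem cechClass_eq_sum {i : ℕ} {ι : Type*} {s : Finset ι}
    {z : cechCocycles k n M i} {w : ι → cechCocycles k n M i}
    (h : z.1 = ∑ j ∈ s, (w j).1) : cechClass i z = ∑ j ∈ s, cechClass i (w j) := by
  rw [← map_sum]
  congr 1
  apply Subtype.ext
  rw [AddSubmonoidClass.coe_finsetSum, h]

theorem sum_mem_cechCoboundaries {i : ℕ} {ι : Type*} {s : Finset ι}
    {w : ι → cechCocycles k n M i} (h : ∑ j ∈ s, cechClass i (w j) = 0) :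
    ∑ j ∈ s, (w j).1 ∈ cechCoboundaries k n M i := by
  rwa [← map_sum, cechClass_eq_zero_iff, AddSubmonoidClass.coe_finsetSum] at h

end CechClass

/-! ### The strand of the Čech complex in one fine degree -/

section CechDegree

variable {k : Type u} [Field k] {n : ℕ} {Δ Γ : SimplComplex n}
variable (h : Γ ≤ Δ) (α : Fin n → ℤ)

variable (k) in
/-- The coefficients at `x^α` of a Čech cochain. -/
def cochainCoeff : CechCochain k n (faceModule k h) →ₗ[k] (Finset (Fin n) → k) :=
  LinearMap.pi fun S => locCoeff k h S α ∘ₗ LinearMap.proj S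

theorem cochainCoeff_apply (f : CechCochain k n (faceModule k h)) (S : Finset (Fin n)) :
    cochainCoeff k h α f S = locCoeff k h S α (f S) := rfl

variable {h} in
theorem cochain_ext {f g : CechCochain k n (faceModule k h)}
    (hfg : ∀ α, cochainCoeff k h α f = cochainCoeff k h α g) : f = g := by
  funext S
  rw [← sub_eq_zero]
  apply eq_zero_of_locCoeff h
  intro α
  rw [map_sub, sub_eq_zero]
  exact congrFun (hfg α) S

theorem cochainCoeff_mem {p : ℤ} {f : CechCochain k n (faceModule k h)}
    (hf : f ∈ cechCochains k n (faceModule k h) p) :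
    cochainCoeff k h α f ∈ faceCochains k (IsDegreeFace Δ Γ α) p := by
  intro S hS
  rw [cochainCoeff_apply]
  by_cases hp : (S.card : ℤ) = p
  · exact locCoeff_eq_zero h (fun hF => hS ⟨hF, hp⟩) _
  · rw [hf S hp, map_zero]

theorem neg_one_pow_smul_eq {M : Type*} [AddCommGroup M] [Module (MvPolynomial (Fin n) k) M]
    [Module k M] (a : ℕ) (m : M) :
    (-1 : MvPolynomial (Fin n) k) ^ a • m = (-1 : k) ^ a • m := by
  rcases neg_one_pow_eq_or (MvPolynomial (Fin n) k) a with h | h <;>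
    rcases Nat.even_or_odd a with h' | h' <;> simp [h'.neg_one_pow]

theorem cochainCoeff_cechD (f : CechCochain k n (faceModule k h)) :
    cochainCoeff k h α (cechD k n _ f) =
      faceCoboundary k (IsDegreeFace Δ Γ α) (cochainCoeff k h α f) := by
  funext S
  rw [cochainCoeff_apply, cechD_apply, map_sum, faceCoboundary_apply, coboundary_apply]
  split_ifs with hF
  · refine Finset.sum_congr rfl fun v _ => ?_
    rw [neg_one_pow_smul_eq, map_smul, locCoeff_cechRes, if_pos hF]
    rfl
  · exact Finset.sum_eq_zero fun v _ => locCoeff_eq_zero h hF _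

variable (k) in
open Classical in
/-- The basis element of degree `α` of the localization of a face module at `x^S`, or zero. -/
def locBasis (S : Finset (Fin n)) : cechLoc k (faceModule k h) S :=
  if hF : IsDegreeFace Δ Γ α S then (exists_locCoeff_eq h hF).choose else 0

open Classical in
theorem locCoeff_locBasis (S : Finset (Fin n)) (β : Fin n → ℤ) :
    locCoeff k h S β (locBasis k h α S) = if IsDegreeFace Δ Γ α S ∧ β = α then (1 : k) else 0 := by
  unfold locBasis
  by_cases hF : IsDegreeFace Δ Γ α S
  · rw [dif_pos hF, (exists_locCoeff_eq h hF).choose_spec β]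
    simp only [hF, true_and]
  · rw [dif_neg hF, map_zero, if_neg fun h => hF h.1]

variable (k) in
/-- The Čech cochain of degree `α` with given coefficients. -/
def cochainOfCoeff : (Finset (Fin n) → k) →ₗ[k] CechCochain k n (faceModule k h) :=
  LinearMap.pi fun S => (LinearMap.proj S).smulRight (locBasis k h α S)

theorem cochainOfCoeff_apply (c : Finset (Fin n) → k) (S : Finset (Fin n)) :
    cochainOfCoeff k h α c S = c S • locBasis k h α S := rfl

theorem cochainCoeff_cochainOfCoeff_of_ne {β : Fin n → ℤ} (hβ : β ≠ α)
    (c : Finset (Fin n) → k) : cochainCoeff k h β (cochainOfCoeff k h α c) = 0 := by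
  funext S
  rw [cochainCoeff_apply, cochainOfCoeff_apply, map_smul, locCoeff_locBasis,
    if_neg fun h => hβ h.2, smul_zero]
  rfl

theorem cochainCoeff_cochainOfCoeff {p : ℤ} {c : Finset (Fin n) → k}
    (hc : c ∈ faceCochains k (IsDegreeFace Δ Γ α) p) :
    cochainCoeff k h α (cochainOfCoeff k h α c) = c := by
  funext S
  rw [cochainCoeff_apply, cochainOfCoeff_apply, map_smul, locCoeff_locBasis]
  split_ifs with hF
  · rw [smul_eq_mul, mul_one]
  · rw [smul_zero]
    exact (hc S fun hF' => hF ⟨hF'.1, rfl⟩).symm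

theorem cochainOfCoeff_mem {p : ℤ} {c : Finset (Fin n) → k}
    (hc : c ∈ faceCochains k (IsDegreeFace Δ Γ α) p) :
    cochainOfCoeff k h α c ∈ cechCochains k n (faceModule k h) p := by
  intro S hS
  rw [cochainOfCoeff_apply, hc S fun h => hS h.2, zero_smul]

theorem cechD_cochainOfCoeff {p : ℤ} {c : Finset (Fin n) → k}
    (hc : c ∈ faceCochains k (IsDegreeFace Δ Γ α) p) :
    cechD k n _ (cochainOfCoeff k h α c) =
      cochainOfCoeff k h α (faceCoboundary k (IsDegreeFace Δ Γ α) c) := by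
  apply cochain_ext
  intro β
  rw [cochainCoeff_cechD]
  by_cases hβ : β = α
  · subst hβ
    rw [cochainCoeff_cochainOfCoeff h β hc,
      cochainCoeff_cochainOfCoeff h β (faceCoboundary_mem hc)]
  · rw [cochainCoeff_cochainOfCoeff_of_ne h α hβ, cochainCoeff_cochainOfCoeff_of_ne h α hβ,
      map_zero]

/-- For an arbitrary family of sets this fails; here it is inherited from `d² = 0` for Čech
cochains. -/
theorem faceCoboundary_faceCoboundary (h : Γ ≤ Δ) (α : Fin n → ℤ) (p : ℤ) (c : Finset (Fin n) → k)
    (hc : c ∈ faceCochains k (IsDegreeFace Δ Γ α) p) :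
    faceCoboundary k (IsDegreeFace Δ Γ α) (faceCoboundary k (IsDegreeFace Δ Γ α) c) = 0 := by
  have := congrArg (cochainCoeff k h α) (cechD_cechD (cochainOfCoeff k h α c))
  rwa [cochainCoeff_cechD, cochainCoeff_cechD, cochainCoeff_cochainOfCoeff h α hc, map_zero] at this

theorem isHomogeneousLoc_forall_iff (f : CechCochain k n (faceModule k h)) :
    (∀ S, IsHomogeneousLoc (faceModuleDegree k h) α S (f S)) ↔
      ∀ β, β ≠ α → cochainCoeff k h β f = 0 := by
  simp only [isHomogeneousLoc_iff]
  exact ⟨fun H β hβ => funext fun S => H S β hβ, fun H S β hβ => congrFun (H β hβ) S⟩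

variable (k Δ Γ) in
/-- The cocycles of the complex of coefficients at `x^α`. -/
def degreeCocycles (p : ℤ) : Submodule k (Finset (Fin n) → k) :=
  faceCochains k (IsDegreeFace Δ Γ α) p ⊓ LinearMap.ker (faceCoboundary k (IsDegreeFace Δ Γ α))

variable (k Δ Γ) in
/-- The coboundaries of the complex of coefficients at `x^α`. -/
def degreeCoboundaries (p : ℤ) : Submodule k (Finset (Fin n) → k) :=
  (faceCochains k (IsDegreeFace Δ Γ α) (p - 1)).map (faceCoboundary k (IsDegreeFace Δ Γ α))

theorem cochainOfCoeff_mem_cocycles {p : ℤ} {c : Finset (Fin n) → k}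
    (hc : c ∈ degreeCocycles k Δ Γ α p) :
    cochainOfCoeff k h α c ∈ cechCocycles k n (faceModule k h) p := by
  refine ⟨cochainOfCoeff_mem h α hc.1, LinearMap.mem_ker.2 ?_⟩
  rw [ cechD_cochainOfCoeff h α hc.1, LinearMap.mem_ker.1 hc.2, map_zero]

theorem cochainCoeff_mem_cocycles {p : ℤ} {z : CechCochain k n (faceModule k h)}
    (hz : z ∈ cechCocycles k n (faceModule k h) p) :
    cochainCoeff k h α z ∈ degreeCocycles k Δ Γ α p := by
  refine ⟨cochainCoeff_mem h α hz.1, LinearMap.mem_ker.2 ?_⟩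
  rw [← cochainCoeff_cechD, LinearMap.mem_ker.1 hz.2, map_zero]

variable (k) in
/-- The map from the cocycles of the complex of coefficients at `x^α` to Čech cohomology. -/
def degreeClass (i : ℕ) : degreeCocycles k Δ Γ α i →ₗ[k]
    CechCohomology k n (faceModule k h) i where
  toFun c := cechClass i ⟨cochainOfCoeff k h α c.1, cochainOfCoeff_mem_cocycles h α c.2⟩
  map_add' b c := by
    rw [← map_add]
    exact congrArg (cechClass i) (Subtype.ext (map_add _ _ _))
  map_smul' r c := by
    rw [RingHom.id_apply, base_smul_cechClass]
    exact congrArg (cechClass i) (Subtype.ext (map_smul _ _ _))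

theorem degreeClass_apply {i : ℕ} (c : degreeCocycles k Δ Γ α i) :
    degreeClass k h α i c =
      cechClass i ⟨cochainOfCoeff k h α c.1, cochainOfCoeff_mem_cocycles h α c.2⟩ := rfl

/-- A primitive of a homogeneous cocycle can be replaced by its component of degree `α`. -/
theorem degreeClass_eq_zero_iff {i : ℕ} (c : degreeCocycles k Δ Γ α i) :
    degreeClass k h α i c = 0 ↔ c.1 ∈ degreeCoboundaries k Δ Γ α i := by
  obtain ⟨c, hc⟩ := c
  rw [degreeClass_apply, cechClass_eq_zero_iff]
  constructor
  · rintro ⟨g, hg, hgc⟩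
    refine ⟨_, cochainCoeff_mem h α hg, ?_⟩
    rw [← cochainCoeff_cechD, hgc, cochainCoeff_cochainOfCoeff h α hc.1]
  · rintro ⟨b, hb, rfl⟩
    exact ⟨_, cochainOfCoeff_mem h α hb, cechD_cochainOfCoeff h α hb⟩

theorem ker_degreeClass (i : ℕ) : LinearMap.ker (degreeClass k h α i) =
    (degreeCoboundaries k Δ Γ α i).submoduleOf (degreeCocycles k Δ Γ α i) := by
  ext c
  rw [LinearMap.mem_ker, degreeClass_eq_zero_iff]
  rfl

theorem isHomogeneousClass_iff {i : ℕ} (x : CechCohomology k n (faceModule k h) i) :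
    IsHomogeneousClass (faceModuleDegree k h) i α x ↔
      x ∈ LinearMap.range (degreeClass k h α i) := by
  constructor
  · rintro ⟨⟨z, hz⟩, hh, rfl⟩
    refine ⟨⟨_, cochainCoeff_mem_cocycles h α hz⟩, ?_⟩
    refine congrArg (cechClass i) (Subtype.ext ?_)
    apply cochain_ext
    intro β
    by_cases hβ : β = α
    · subst hβ
      exact cochainCoeff_cochainOfCoeff h β (cochainCoeff_mem h β hz.1)
    · rw [cochainCoeff_cochainOfCoeff_of_ne h α hβ,
        (isHomogeneousLoc_forall_iff h α z).1 hh β hβ]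
  · rintro ⟨c, rfl⟩
    refine ⟨⟨_, cochainOfCoeff_mem_cocycles h α c.2⟩, ?_, rfl⟩
    exact (isHomogeneousLoc_forall_iff h α _).2 fun β hβ =>
      cochainCoeff_cochainOfCoeff_of_ne h α hβ _

theorem X_smul_mem_faceModuleDegree {m : faceModule k h} (hm : m ∈ faceModuleDegree k h α)
    (j : Fin n) :
    (X j : MvPolynomial (Fin n) k) • m ∈ faceModuleDegree k h (α + Pi.single j 1) := by
  rw [mem_faceModuleDegree_iff] at hm ⊢
  intro γ hγ
  by_cases hΔ : intSupport γ ∈ Δ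
  · rw [← sqfreeMonomial_singleton, ← pow_one (sqfreeMonomial k {j}), SetLike.val_smul,
      faceCoeff_pow_smul _ _ _ hΔ]
    apply hm
    rintro rfl
    apply hγ
    funext i
    by_cases hi : i = j
    · subst hi
      simp [shiftExp]
    · simp [shiftExp, hi]
  · exact faceCoeff_of_notMem _ hΔ

theorem X_smul_isHomogeneousLoc {S : Finset (Fin n)} {y : cechLoc k (faceModule k h) S}
    (hy : IsHomogeneousLoc (faceModuleDegree k h) α S y) (j : Fin n) :
    IsHomogeneousLoc (faceModuleDegree k h) (α + Pi.single j 1) S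
      ((X j : MvPolynomial (Fin n) k) • y) := by
  obtain ⟨a, m, hm, rfl⟩ := hy
  refine ⟨a, (X j : MvPolynomial (Fin n) k) • m, ?_, smul_cechMk _ _ _⟩
  convert X_smul_mem_faceModuleDegree h _ hm j using 2
  funext i
  exact add_right_comm _ _ _

variable {i : ℕ} {N : Type u} [AddCommGroup N] [Module (MvPolynomial (Fin n) k) N] [Module k N]
variable [IsScalarTower k (MvPolynomial (Fin n) k) N]
variable (e : N ≃ₗ[MvPolynomial (Fin n) k] CechCohomology k n (faceModule k h) i)

/-- The degree `α` part of a module identified with the Čech cohomology of a face module. -/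
def cechDegree : Submodule k N :=
  Submodule.span k {c | IsHomogeneousClass (faceModuleDegree k h) i α (e c)}

/-- Homogeneous classes of degree `α` already form a subspace, so taking the span adds nothing. -/
theorem cechDegree_eq_comap : cechDegree h α e =
    (LinearMap.range (degreeClass k h α i)).comap (e.restrictScalars k).toLinearMap := by
  apply le_antisymm
  · exact Submodule.span_le.2 fun x hx => (isHomogeneousClass_iff h α (e x)).1 hx
  · exact fun x hx => Submodule.subset_span ((isHomogeneousClass_iff h α (e x)).2 hx)

theorem mem_cechDegree_iff (x : N) :
    x ∈ cechDegree h α e ↔ e x ∈ LinearMap.range (degreeClass k h α i) := by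
  rw [cechDegree_eq_comap]
  rfl

/-- The degree `α` part of Čech cohomology is the cohomology of the complex of coefficients
at `x^α`. -/
theorem nonempty_cechDegree_equiv :
    Nonempty (cechDegree h α e ≃ₗ[k]
      (degreeCocycles k Δ Γ α i ⧸
        (degreeCoboundaries k Δ Γ α i).submoduleOf (degreeCocycles k Δ Γ α i))) := by
  rw [cechDegree_eq_comap, ← ker_degreeClass h α i]
  exact nonempty_comap_range_equiv _ _

theorem cechDegree_eq_bot (hα : degreeCocycles k Δ Γ α i ≤ degreeCoboundaries k Δ Γ α i) :
    cechDegree h α e = ⊥ := by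
  rw [eq_bot_iff]
  intro x hx
  obtain ⟨c, hc⟩ := (mem_cechDegree_iff h α e x).1 hx
  rw [(degreeClass_eq_zero_iff h α c).2 (hα c.2)] at hc
  exact (Submodule.mem_bot k).2 (e.map_eq_zero_iff.1 hc.symm)

/-- The degree `β` component of a primitive of the whole sum is a primitive of its `β` term. -/
theorem degreeClass_eq_zero_of_sum (s : Finset (Fin n → ℤ))
    (c : ∀ α, degreeCocycles k Δ Γ α i) (hc : ∑ α ∈ s, degreeClass k h α i (c α) = 0) :
    ∀ β ∈ s, degreeClass k h β i (c β) = 0 := by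
  classical
  intro β hβ
  obtain ⟨g, hg, hgz⟩ := sum_mem_cechCoboundaries (k := k) (n := n) (M := faceModule k h) (i := i)
    (s := s) (w := fun α => ⟨_, cochainOfCoeff_mem_cocycles h α (c α).2⟩) hc
  rw [degreeClass_eq_zero_iff]
  refine ⟨_, cochainCoeff_mem h β hg, ?_⟩
  rw [← cochainCoeff_cechD, hgz, map_sum, Finset.sum_eq_single_of_mem β hβ]
  · exact cochainCoeff_cochainOfCoeff h β (c β).2.1
  · intro α _ hα
    exact cochainCoeff_cochainOfCoeff_of_ne h α hα.symm _

theorem exists_eq_sum_cochainOfCoeff {p : ℤ} {z : CechCochain k n (faceModule k h)}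
    (hz : z ∈ cechCochains k n (faceModule k h) p) :
    ∃ s : Finset (Fin n → ℤ), z = ∑ α ∈ s, cochainOfCoeff k h α (cochainCoeff k h α z) := by
  classical
  let s : Finset (Fin n → ℤ) := Finset.univ.biUnion fun S => (finite_locCoeff h (z S)).toFinset
  refine ⟨s, ?_⟩
  apply cochain_ext
  intro β
  rw [map_sum]
  by_cases hβ : β ∈ s
  · rw [Finset.sum_eq_single_of_mem β hβ]
    · exact (cochainCoeff_cochainOfCoeff h β (cochainCoeff_mem h β hz)).symm
    · intro α _ hα
      exact cochainCoeff_cochainOfCoeff_of_ne h α hα.symm _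
  · rw [Finset.sum_eq_zero fun α hα =>
      cochainCoeff_cochainOfCoeff_of_ne h α (by rintro rfl; exact hβ hα) _]
    funext S
    by_contra hne
    exact hβ (Finset.mem_biUnion.2 ⟨S, Finset.mem_univ S, (Set.Finite.mem_toFinset _).2 hne⟩)

theorem exists_eq_sum_degreeClass (x : CechCohomology k n (faceModule k h) i) :
    ∃ (s : Finset (Fin n → ℤ)) (c : ∀ α, degreeCocycles k Δ Γ α i),
      x = ∑ α ∈ s, degreeClass k h α i (c α) := by
  obtain ⟨⟨z, hz⟩, rfl⟩ := cechClass_surjective (k := k) (n := n) (M := faceModule k h) i x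
  obtain ⟨s, hs⟩ := exists_eq_sum_cochainOfCoeff h hz.1
  refine ⟨s, fun α => ⟨_, cochainCoeff_mem_cocycles h α hz⟩, ?_⟩
  simp only [degreeClass_apply]
  exact cechClass_eq_sum (k := k) (n := n) (M := faceModule k h) hs

theorem isFineGrading_cechDegree : IsFineGrading fun α => cechDegree h α e := by
  constructor
  · simp only [cechDegree_eq_comap]
    exact isInternal_comap_range (fun α => degreeClass k h α i) (e.restrictScalars k)
      (degreeClass_eq_zero_of_sum h) (exists_eq_sum_degreeClass h)
  · intro α j m hm
    rw [mem_cechDegree_iff, ← isHomogeneousClass_iff] at hm ⊢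
    obtain ⟨z, hz, hzm⟩ := hm
    refine ⟨(X j : MvPolynomial (Fin n) k) • z, fun S => X_smul_isHomogeneousLoc h α (hz S) j, ?_⟩
    rw [map_smul, hzm]
    exact smul_cechClass _ _

/-- For `α ≤ 0`, nonnegativity off `S` says that `α` vanishes off `S`. -/
theorem isDegreeFace_iff_isStarFace (hα : α ≤ 0) (S : Finset (Fin n)) :
    IsDegreeFace Δ Γ α S ↔ IsStarFace Δ Γ (intSupport α) S := by
  have hS : (∀ i, i ∉ S → 0 ≤ α i) ↔ intSupport α ⊆ S := by
    constructor
    · intro H i hi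
      by_contra hiS
      exact mem_intSupport.1 hi (le_antisymm (hα i) (H i hiS))
    · intro H i hi
      by_contra hne
      exact hi (H (mem_intSupport.2 fun h0 => hne h0.ge))
  unfold IsDegreeFace IsStarFace
  rw [hS]
  constructor
  · rintro ⟨h1, h2, h3⟩
    rw [Finset.union_eq_left.2 h3] at h1 h2
    exact ⟨h3, h1, h2⟩
  · rintro ⟨h3, h1, h2⟩
    rw [Finset.union_eq_left.2 h3]
    exact ⟨h1, h2, h3⟩

/-- Cohomology stands on the left and homology on the right, so the isomorphism is obtained by
comparing finite dimensions and is not canonical. -/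
theorem nonempty_cechDegree_equiv_relHomology (hα : α ≤ 0) :
    Nonempty (cechDegree h α e ≃ₗ[k]
      relHomology k (Δ.link (intSupport α)) (Γ.link (intSupport α))
        ((i : ℤ) - faceDim (intSupport α) - 2)) := by
  obtain ⟨e1⟩ := nonempty_cechDegree_equiv h α e
  have hF : IsDegreeFace Δ Γ α = IsStarFace Δ Γ (intSupport α) :=
    funext fun S => propext (isDegreeFace_iff_isStarFace α hα S)
  have hdd := faceCoboundary_faceCoboundary (k := k) h α
  rw [hF] at hdd
  have hr := finrank_relHomology_link (k := k) (i : ℤ) hdd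
  refine ⟨e1 ≪≫ₗ LinearEquiv.ofFinrankEq _ _ ?_⟩
  rw [hr]
  unfold degreeCocycles degreeCoboundaries
  rw [hF]

/-- If `α_j > 0`, then `j ∈ supp α` and the sign condition at `j` always holds, so adding or
removing `j` does not affect the family and the strand is exact. If `supp α ∉ Δ`, the family is
empty. -/
theorem cechDegree_eq_bot_of_not (hα : ¬ (α ≤ 0 ∧ intSupport α ∈ Δ)) :
    cechDegree h α e = ⊥ := by
  apply cechDegree_eq_bot
  rintro z ⟨hz, hz0⟩
  by_cases hΔ : intSupport α ∈ Δ
  · have : ∃ j, 0 < α j := by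
      by_contra! H
      exact hα ⟨H, hΔ⟩
    obtain ⟨j, hj⟩ := this
    refine exists_faceCoboundary_eq j (fun S hS => ?_) hz hz0
    have hu : insert j S ∪ intSupport α = S ∪ intSupport α := by
      rw [Finset.insert_union, Finset.insert_eq_self]
      exact Finset.mem_union_right _ (mem_intSupport.2 hj.ne')
    unfold IsDegreeFace
    rw [hu]
    refine and_congr_right fun _ => and_congr_right fun _ => ⟨fun H i hi => ?_, fun H i hi =>
      H i fun h => hi (Finset.mem_insert_of_mem h)⟩
    by_cases hij : i = j
    · exact hij ▸ hj.le
    · exact H i fun h => (Finset.mem_insert.1 h).elim hij hi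
  · have : z = 0 := funext fun S => hz S fun hS =>
      hΔ (Δ.lower Finset.subset_union_right hS.1.1)
    rw [this]
    exact zero_mem _

end CechDegree
end

noncomputable section

/-! ### Hilbert series -/

section HilbertSeries

variable {n : ℕ}

open Classical in
/-- The sum of the monomials with support `σ`. -/
def supportSeries (σ : Finset (Fin n)) : MvPowerSeries (Fin n) ℚ :=
  fun a => if a.support = σ then 1 else 0

open Classical in
theorem coeff_supportSeries (σ : Finset (Fin n)) (a : Fin n →₀ ℕ) :
    MvPowerSeries.coeff a (supportSeries σ) = if a.support = σ then 1 else 0 := rfl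

/-- At an exponent with `a j ≥ 2` the two terms on the left cancel, so only `a j = 1` survives, as
on the right. -/
theorem supportSeries_insert {σ : Finset (Fin n)} {j : Fin n} (hj : j ∉ σ) :
    supportSeries (insert j σ) * (1 - MvPowerSeries.X j) =
      supportSeries σ * MvPowerSeries.X j := by
  classical
  ext a
  rw [mul_sub, mul_one, map_sub, MvPowerSeries.X_def, MvPowerSeries.coeff_mul_monomial,
    MvPowerSeries.coeff_mul_monomial]
  simp only [coeff_supportSeries, mul_one]
  have hs (b : Fin n →₀ ℕ) (τ : Finset (Fin n)) : b.support = τ ↔ ∀ i, b i ≠ 0 ↔ i ∈ τ := by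
    simp [Finset.ext_iff]
  by_cases h0 : a j = 0
  · have h1 : ¬ Finsupp.single j 1 ≤ a := fun h => by
      have := h j
      rw [Finsupp.single_eq_same] at this
      omega
    rw [if_neg h1, if_neg h1, sub_zero, if_neg]
    intro h
    exact ((hs _ _).1 h j).2 (Finset.mem_insert_self j σ) h0
  · have h1 : Finsupp.single j 1 ≤ a := by
      rw [Finsupp.single_le_iff]
      omega
    rw [if_pos h1, if_pos h1]
    have hne (i : Fin n) (hi : i ≠ j) : (a - Finsupp.single j 1 : Fin n →₀ ℕ) i = a i := by
      rw [Finsupp.tsub_apply, Finsupp.single_eq_of_ne hi, tsub_zero]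
    have hj1 : (a - Finsupp.single j 1 : Fin n →₀ ℕ) j = a j - 1 := by
      rw [Finsupp.tsub_apply, Finsupp.single_eq_same]
    by_cases h2 : a j = 1
    · have e1 : ¬ (a - Finsupp.single j 1).support = insert j σ := fun h =>
        ((hs _ _).1 h j).2 (Finset.mem_insert_self j σ) (by rw [hj1, h2])
      rw [if_neg e1, sub_zero]
      refine if_congr ?_ rfl rfl
      rw [hs, hs]
      refine forall_congr' fun i => ?_
      by_cases hi : i = j
      · subst hi
        simp [h2, hj]
      · rw [hne i hi, Finset.mem_insert]
        simp [hi]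
    · have e1 : ¬ (a - Finsupp.single j 1).support = σ := fun h =>
        hj (((hs _ _).1 h j).1 (by rw [hj1]; omega))
      rw [if_neg e1, sub_eq_zero]
      refine if_congr ?_ rfl rfl
      rw [hs, hs]
      refine forall_congr' fun i => ?_
      by_cases hi : i = j
      · subst hi
        refine iff_congr ?_ Iff.rfl
        rw [hj1]
        omega
      · rw [hne i hi]

theorem prod_X_mul_inv (σ : Finset (Fin n)) :
    ∏ j ∈ σ, (MvPowerSeries.X j * (1 - MvPowerSeries.X j)⁻¹) = supportSeries σ := by
  classical
  induction σ using Finset.induction_on with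
  | empty =>
    rw [Finset.prod_empty]
    ext a
    rw [coeff_supportSeries, MvPowerSeries.coeff_one]
    exact if_congr Finsupp.support_eq_empty.symm rfl rfl
  | insert j σ hj ih =>
    have hc :
        MvPowerSeries.constantCoeff (1 - MvPowerSeries.X j : MvPowerSeries (Fin n) ℚ) ≠ 0 := by
      simp
    rw [Finset.prod_insert hj, ih, mul_right_comm, mul_comm (MvPowerSeries.X j),
      ← supportSeries_insert hj, mul_assoc, MvPowerSeries.mul_inv_cancel _ hc, mul_one]

-- Each monomial has one support, so only `σ = supp α` contributes to the coefficient of `t^α`.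
open Classical in
theorem substInv_sum_apply (Δ : SimplComplex n) (d : Finset (Fin n) → ℚ) (α : Fin n → ℤ) :
    substInv (∑ σ : Finset (Fin n) with σ ∈ Δ, MvPowerSeries.C (d σ) *
      ∏ j ∈ σ, (MvPowerSeries.X j * (1 - MvPowerSeries.X j)⁻¹)) α =
      if α ≤ 0 ∧ intSupport α ∈ Δ then d (intSupport α) else 0 := by
  unfold substInv
  by_cases hα : α ≤ 0
  · have hs : (Finsupp.equivFunOnFinite.symm fun i => (α i).natAbs).support = intSupport α := by
      ext i
      simp [mem_intSupport]
    rw [if_pos hα, map_sum]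
    simp only [prod_X_mul_inv, MvPowerSeries.coeff_C_mul, coeff_supportSeries, hs, hα, true_and,
      mul_ite, mul_one, mul_zero]
    rw [Finset.sum_ite_eq]
    simp
  · rw [if_neg hα, if_neg fun h => hα h.1]

end HilbertSeries
end

open Classical in
theorem mainTheorem12 (k : Type u) [Field k] (n : ℕ) (Δ Γ : SimplComplex n) (hΓ : Γ < Δ) (i : ℕ) :
    ∃ e : LocCoh k n (faceModule k hΓ.le) i ≃ₗ[MvPolynomial (Fin n) k]
        CechCohomology k n (faceModule k hΓ.le) i,
      let H : (Fin n → ℤ) → Submodule k (LocCoh k n (faceModule k hΓ.le) i) :=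
        locCohDegree (faceModuleDegree k hΓ.le) e
      IsFineGrading H ∧
      (∀ α : Fin n → ℤ, Module.Finite k (H α)) ∧
      (∀ α : Fin n → ℤ, α ≤ 0 → intSupport α ∈ Δ →
        Nonempty (H α ≃ₗ[k]
          relHomology k (Δ.link (intSupport α)) (Γ.link (intSupport α))
            ((i : ℤ) - faceDim (intSupport α) - 2))) ∧
      (∀ α : Fin n → ℤ, ¬ (α ≤ 0 ∧ intSupport α ∈ Δ) → H α = ⊥) ∧
      hilbertSeries H = substInv (∑ σ : Finset (Fin n) with σ ∈ Δ,
        MvPowerSeries.C (Module.finrank k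
          (relHomology k (Δ.link σ) (Γ.link σ) ((i : ℤ) - faceDim σ - 2)) : ℚ) *
        ∏ j ∈ σ, (MvPowerSeries.X j * (1 - MvPowerSeries.X j)⁻¹)) := by
  obtain ⟨e⟩ := nonempty_locCoh_equiv_cech i
    (ModuleCat.of (MvPolynomial (Fin n) k) (faceModule k hΓ.le))
  -- Each degree is a subquotient of the functions on the finite set of subsets of `[n]`.
  have hfin (α) : Module.Finite k (cechDegree hΓ.le α e) := by
    obtain ⟨e1⟩ := nonempty_cechDegree_equiv hΓ.le α e
    exact Module.Finite.equiv e1.symm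
  have hhom (α) (hα : α ≤ 0) := nonempty_cechDegree_equiv_relHomology hΓ.le α e hα
  have hbot (α) (hα : ¬ (α ≤ 0 ∧ intSupport α ∈ Δ)) := cechDegree_eq_bot_of_not hΓ.le α e hα
  refine ⟨e, isFineGrading_cechDegree hΓ.le e, hfin, fun α hα _ => hhom α hα, hbot, ?_⟩
  funext α
  rw [substInv_sum_apply Δ fun σ => (Module.finrank k
    (relHomology k (Δ.link σ) (Γ.link σ) ((i : ℤ) - faceDim σ - 2)) : ℚ)]
  change (Module.finrank k (cechDegree hΓ.le α e) : ℚ) = _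
  split_ifs with hα
  · obtain ⟨e1⟩ := hhom α hα.1
    rw [e1.finrank_eq]
  · rw [hbot α hα, finrank_bot, Nat.cast_zero]
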